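/- An instance of \emph{colorful sum of radii} consists of a finite metric space $(P,d)$ with $n=|P|$ points that is partitioned into $\omega$ classes $P_1,\dots,P_\omega$, an integer $k$ with $1\le k\le n$, and numbers $m_1,\dots,m_\omega\in\mathbb N$; put $m=\sum_{i=1}^{\omega}m_i$. A feasible solution consists of a set $\mathcal C\subseteq P$ of $k$ centers, a set $\mathcal M\subseteq P$ of outliers with $|\mathcal M\cap P_i|\le m_i$ for all $i$, and an assignment $\sigma:P\to\mathcal C\cup\mathcal M$ with $\sigma(p)=p$ for $p\in\mathcal M$ and $\sigma(p)\in\mathcal C$ for $p\notin\mathcal M$. Its cost is $\sum_{c\in\mathcal C}\max_{p\in\sigma^{-1}(c)}d(p,c)$, where the maximum over the empty set is $0$. \textbf{Theorem.} There are a deterministic algorithm and an absolute constant $c$ such that, for every instance and every real $\varepsilon>0$, the algorithm on input (instance, $\varepsilon$) outputs a feasible solution whose cost is at most $(7+\varepsilon)$ times the cost of every feasible solution, after at most $$c\cdot n^{\omega^2}\cdot\Bigl((k+m)\cdot\log\max\{2,\,k,\,k/\varepsilon\}\Bigr)^{k}$$ steps, where $\log$ is the natural logarithm. (For $0<\varepsilon\le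 1$ and $k/\varepsilon\ge 2$ the logarithm is just $\log(k/\varepsilon)$.) The running time is that of a real RAM: the distances are available in a table with random access, and reading or writing a memory cell, adding, subtracting or comparing natural numbers, and performing a field operation or a comparison on real numbers cost one step each. -/

import Mathlib

open scoped NNReal

noncomputable section

namespace RealRAM

/-! A deterministic real RAM in structured form. A machine state consists of zero-initialised
arrays of natural numbers and arrays of real numbers; array names are literals of the program, so
that a program uses finitely many arrays, and a scalar variable is cell `0` of an array. Indices are
computed, which gives indirect addressing. In addition there is a read-only two-dimensional table of
real input numbers. Every elementary operation costs one step. On natural numbers these are only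
addition, truncated subtraction and comparison; on real numbers they are the field operations and
comparison. There is no rounding of reals to integers and there are no real constants in programs
other than natural numbers. -/

/-- Expressions with values in `ℕ`. -/
inductive NatExpr : Type
  | const (c : ℕ)
  | get (a : ℕ) (i : NatExpr)
  | add (e f : NatExpr)
  | sub (e f : NatExpr)

/-- Expressions with values in `ℝ`; `table i j` reads the input table. -/
inductive RealExpr : Type
  | ofNat (e : NatExpr)
  | get (a : ℕ) (i : NatExpr)
  | table (i j : NatExpr)
  | add (e f : RealExpr)
  | sub (e f : RealExpr)
  | mul (e f : RealExpr)
  | div (e f : RealExpr)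

/-- Tests. -/
inductive Test : Type
  | natLe (e f : NatExpr)
  | realLe (e f : RealExpr)
  | not (b : Test)
  | and (b c : Test)

/-- Programs. `setNat a i e` stores the value of `e` in cell `i` of the array `a` of natural
numbers, and `setReal` does the same for real numbers. -/
inductive Program : Type
  | skip
  | setNat (a : ℕ) (i : NatExpr) (e : NatExpr)
  | setReal (a : ℕ) (i : NatExpr) (e : RealExpr)
  | seq (p q : Program)
  | cond (b : Test) (p q : Program)
  | loop (b : Test) (p : Program)

/-- The memory: `nat a i` and `real a i` are the contents of cell `i` of the array named `a`. -/
structure State : Type where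
  nat : ℕ → ℕ → ℕ
  real : ℕ → ℕ → ℝ

/-- Value of an expression. -/
def NatExpr.eval (s : State) : NatExpr → ℕ
  | .const c => c
  | .get a i => s.nat a (i.eval s)
  | .add e f => e.eval s + f.eval s
  | .sub e f => e.eval s - f.eval s

/-- Number of elementary operations needed for evaluating an expression. -/
def NatExpr.steps : NatExpr → ℕ
  | .const _ => 1
  | .get _ i => i.steps + 1
  | .add e f => e.steps + f.steps + 1
  | .sub e f => e.steps + f.steps + 1

/-- Value of an expression, where `T` is the input table (a quotient with divisor `0` is `0`). -/
def RealExpr.eval (T : ℕ → ℕ → ℝ) (s : State) : RealExpr → ℝ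
  | .ofNat e => (e.eval s : ℝ)
  | .get a i => s.real a (i.eval s)
  | .table i j => T (i.eval s) (j.eval s)
  | .add e f => e.eval T s + f.eval T s
  | .sub e f => e.eval T s - f.eval T s
  | .mul e f => e.eval T s * f.eval T s
  | .div e f => e.eval T s / f.eval T s

/-- Number of elementary operations needed for evaluating an expression. -/
def RealExpr.steps : RealExpr → ℕ
  | .ofNat e => e.steps + 1
  | .get _ i => i.steps + 1
  | .table i j => i.steps + j.steps + 1
  | .add e f => e.steps + f.steps + 1
  | .sub e f => e.steps + f.steps + 1
  | .mul e f => e.steps + f.steps + 1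
  | .div e f => e.steps + f.steps + 1

/-- The test holds in the state `s`. -/
def Test.Holds (T : ℕ → ℕ → ℝ) (s : State) : Test → Prop
  | .natLe e f => e.eval s ≤ f.eval s
  | .realLe e f => e.eval T s ≤ f.eval T s
  | .not b => ¬ b.Holds T s
  | .and b c => b.Holds T s ∧ c.Holds T s

/-- Number of elementary operations needed for a test. -/
def Test.steps : Test → ℕ
  | .natLe e f => e.steps + f.steps + 1
  | .realLe e f => e.steps + f.steps + 1
  | .not b => b.steps + 1
  | .and b c => b.steps + c.steps + 1

/-- Store `v` in cell `i` of the array `a` of natural numbers. -/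
def State.storeNat (s : State) (a i v : ℕ) : State :=
  { s with nat := Function.update s.nat a (Function.update (s.nat a) i v) }

/-- Store `v` in cell `i` of the array `a` of real numbers. -/
def State.storeReal (s : State) (a i : ℕ) (v : ℝ) : State :=
  { s with real := Function.update s.real a (Function.update (s.real a) i v) }

/-- `Run T p s t s'`: with the input table `T`, the program `p` started in the state `s` halts
after exactly `t` steps in the state `s'`. -/
inductive Run (T : ℕ → ℕ → ℝ) : Program → State → ℕ → State → Prop
  | skip (s : State) : Run T .skip s 1 s
  | setNat (s : State) (a : ℕ) (i e : NatExpr) :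
      Run T (.setNat a i e) s (i.steps + e.steps + 1) (s.storeNat a (i.eval s) (e.eval s))
  | setReal (s : State) (a : ℕ) (i : NatExpr) (e : RealExpr) :
      Run T (.setReal a i e) s (i.steps + e.steps + 1) (s.storeReal a (i.eval s) (e.eval T s))
  | seq {p q : Program} {s s' s'' : State} {t t' : ℕ} (hp : Run T p s t s')
      (hq : Run T q s' t' s'') : Run T (.seq p q) s (t + t') s''
  | condTrue {b : Test} {p q : Program} {s s' : State} {t : ℕ} (hb : b.Holds T s)
      (hp : Run T p s t s') : Run T (.cond b p q) s (b.steps + 1 + t) s'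
  | condFalse {b : Test} {p q : Program} {s s' : State} {t : ℕ} (hb : ¬ b.Holds T s)
      (hq : Run T q s t s') : Run T (.cond b p q) s (b.steps + 1 + t) s'
  | loopStop {b : Test} {p : Program} {s : State} (hb : ¬ b.Holds T s) :
      Run T (.loop b p) s (b.steps + 1) s
  | loopStep {b : Test} {p : Program} {s s' s'' : State} {t t' : ℕ} (hb : b.Holds T s)
      (hp : Run T p s t s') (hl : Run T (.loop b p) s' t' s'') :
      Run T (.loop b p) s (b.steps + 1 + t + t') s''

end RealRAM

namespace ColorfulRadii

/-- An instance of colorful clustering: a finite metric space `P` of `n` points (identified with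
`Fin n`), partitioned into `ω` classes by `color`, a bound `outlierBound i` on the number of
outliers in class `i`, and a number `k` of centers. -/
structure Instance : Type where
  n : ℕ
  ω : ℕ
  k : ℕ
  metric : MetricSpace (Fin n)
  color : Fin n → Fin ω
  outlierBound : Fin ω → ℕ
  one_le_k : 1 ≤ k
  k_le_n : k ≤ n

/-- The distance between two points. -/
def Instance.d (I : Instance) (p q : Fin I.n) : ℝ≥0 :=
  @nndist (Fin I.n) I.metric.toPseudoMetricSpace.toNNDist p q

/-- The total number of allowed outliers. -/
def Instance.m (I : Instance) : ℕ := ∑ i, I.outlierBound i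

/-- A candidate solution: centers, outliers and an assignment of the points. -/
structure Solution (n : ℕ) : Type where
  centers : Finset (Fin n)
  outliers : Finset (Fin n)
  assign : Fin n → Fin n

/-- Exactly `k` centers, at most `outlierBound i` outliers from class `i`, every outlier is assigned
to itself and every other point is assigned to a center. -/
structure Instance.IsFeasible (I : Instance) (S : Solution I.n) : Prop where
  card_centers : S.centers.card = I.k
  card_outliers : ∀ i : Fin I.ω, (S.outliers.filter (fun p => I.color p = i)).card ≤ I.outlierBound i
  assign_outlier : ∀ p ∈ S.outliers, S.assign p = p
  assign_center : ∀ p ∉ S.outliers, S.assign p ∈ S.centers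

/-- The largest distance from `c` to a point assigned to `c` (it is `0` if there is none). -/
def Instance.radius (I : Instance) (S : Solution I.n) (c : Fin I.n) : ℝ≥0 :=
  (Finset.univ.filter (fun p => S.assign p = c)).sup (fun p => I.d p c)

/-- The sum of the cluster radii. -/
def Instance.cost (I : Instance) (S : Solution I.n) : ℝ :=
  ∑ c ∈ S.centers, (I.radius S c : ℝ)

/-- `S` is feasible and its cost is at most `α` times that of any feasible solution. -/
def Instance.IsApprox (I : Instance) (α : ℝ) (S : Solution I.n) : Prop :=
  I.IsFeasible S ∧ ∀ S' : Solution I.n, I.IsFeasible S' → I.cost S ≤ α * I.cost S'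

/-- The input table of distances. -/
def Instance.distTable (I : Instance) (i j : ℕ) : ℝ :=
  if h : i < I.n ∧ j < I.n then (I.d ⟨i, h.1⟩ ⟨j, h.2⟩ : ℝ) else 0

/-- The initial memory. Array `0` of natural numbers holds `n, k, ω`, array `1` the colors of the
points, array `2` the outlier bounds; cell `0` of array `0` of real numbers holds `ε`. All other
cells hold `0`. -/
def Instance.input (I : Instance) (ε : ℝ) : RealRAM.State where
  nat
    | 0, 0 => I.n
    | 0, 1 => I.k
    | 0, 2 => I.ω
    | 1, i => if h : i < I.n then (I.color ⟨i, h⟩ : ℕ) else 0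
    | 2, i => if h : i < I.ω then I.outlierBound ⟨i, h⟩ else 0
    | _, _ => 0
  real
    | 0, 0 => ε
    | _, _ => 0

/-- The final memory `s` represents `S`: array `3` of natural numbers marks the centers and array
`4` the outliers (by the entry `1`), and array `5` holds the assignment. -/
def IsOutput {n : ℕ} (s : RealRAM.State) (S : Solution n) : Prop :=
  ∀ p : Fin n, (s.nat 3 p = 1 ↔ p ∈ S.centers) ∧ (s.nat 4 p = 1 ↔ p ∈ S.outliers) ∧
    s.nat 5 p = S.assign p

end ColorfulRadii

end

/-! The algorithm is a branching greedy cover. Fix a solution `S` to compare with. As long as some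
class has more uncovered points than its outlier bound `b`, one of its first `b + 1` uncovered
points is not an outlier of `S` (`exists_pick`). Guess that point, and guess the radius of its
cluster in `S` from the geometric sequence `R, (2/7)R, (2/7)²R, …`. By the triangle inequality the
ball of twice the guessed radius contains the whole cluster. Every such round finishes a new cluster
of `S`, so after `k` rounds no class is in excess and the uncovered points can serve as outliers
(`exists_run`). A guess overshoots by a factor of at most 7/2, so a cluster of radius `ρ` is charged
at most `7ρ`, plus an error from the last guess of the sequence. Trying all decisions enumerates `k`
choices of a point among at most `m + 1` and `k` choices of a radius among `G`.

For `G` to be logarithmic in `k/ε`, the bound `R` has to be within a constant factor of the largest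
radius of `S`. The ratio of distances is unbounded, so `R` is found adaptively. `lowerP` starts from
a trivial upper bound and runs the search with the first point prescribed. If the search finds a
solution, `R` drops to at most half and the same first point is tried again; otherwise that first
point is discarded for good, because at this and every smaller `R` a solution that beats the best
one and admits this first point must have a radius above `R`. The searches thus number at most the
possible first points plus the lowerings, instead of their product. `raiseP` then doubles `R` until
it exceeds twice the best cost; on the way it meets the scale of any solution that could still be
much better.

The lowerings are counted by a packing argument (`Scale.succ`). Whenever `R` has dropped by a large
factor in `k`, the best cost is comparable to a distance between two points that is tiny in
comparison with earlier scales; these two points enlarge a set of well separated points. A separated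
set has at most `k + m` points, since a solution at scale `R` puts them into different balls or
among the outliers. This gives `O(k(k+m))` lowerings.

A search with prescribed first point takes `(m+1)^(k-1) · G^k · O(nk)` steps, so the total is `O(n
(k+m)^k k² G^k)` (`totalTime_le`). Since `log (7/2) > 1`, `G` is at most a constant below 1 times
the logarithm in the theorem, up to an additive constant. The resulting exponential gain absorbs
`k²` (`exists_const_guesses`). -/

noncomputable section

/-! ### Program logic with step counts for the real RAM. -/

namespace RealRAM

/-- The program halts within `τ` steps in a state that satisfies `Q`. -/
def WP (T : ℕ → ℕ → ℝ) (p : Program) (τ : ℕ) (Q : State → Prop) (s : State) : Prop :=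
  ∃ t s', Run T p s t s' ∧ t ≤ τ ∧ Q s'

variable {T : ℕ → ℕ → ℝ} {p q : Program} {τ τ' : ℕ} {Q Q' : State → Prop} {s : State}

theorem WP.mono (h : WP T p τ Q s) (hτ : τ ≤ τ') (hQ : ∀ s', Q s' → Q' s') : WP T p τ' Q' s := by
  obtain ⟨t, s', hr, ht, hq⟩ := h
  exact ⟨t, s', hr, ht.trans hτ, hQ _ hq⟩

theorem WP.seq (h : WP T p τ (WP T q τ' Q) s) : WP T (.seq p q) (τ + τ') Q s := by
  obtain ⟨t, s', hr, ht, t', s'', hr', ht', hq⟩ := h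
  exact ⟨_, s'', .seq hr hr', by omega, hq⟩

theorem WP.cond {b : Test} (ht : b.Holds T s → WP T p τ Q s)
    (hf : ¬ b.Holds T s → WP T q τ Q s) : WP T (.cond b p q) (τ + (b.steps + 1)) Q s := by
  by_cases hb : b.Holds T s
  · obtain ⟨t, s', hr, ht, hq⟩ := ht hb
    exact ⟨_, s', .condTrue hb hr, by omega, hq⟩
  · obtain ⟨t, s', hr, ht, hq⟩ := hf hb
    exact ⟨_, s', .condFalse hb hr, by omega, hq⟩

/-- A loop with an invariant that is indexed by the number of iterations made so far. -/
theorem WP.loop {b : Test} (Inv : ℕ → State → Prop) (N : ℕ) (h0 : Inv 0 s)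
    (hN : ∀ j s, Inv j s → b.Holds T s → j < N)
    (hstep : ∀ j s, Inv j s → b.Holds T s → WP T p τ (Inv (j + 1)) s) :
    WP T (.loop b p) (N * (τ + (b.steps + 1)) + (b.steps + 1))
      (fun s' => ∃ j, Inv j s' ∧ ¬ b.Holds T s') s := by
  suffices H : ∀ r j s, Inv j s → N ≤ j + r → WP T (.loop b p)
      (r * (τ + (b.steps + 1)) + (b.steps + 1)) (fun s' => ∃ j, Inv j s' ∧ ¬ b.Holds T s') s from
    H N 0 s h0 (by omega)
  intro r
  induction r with
  | zero =>
    intro j s hj hr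
    have hb : ¬ b.Holds T s := fun hb => by have := hN j s hj hb; omega
    exact ⟨_, s, .loopStop hb, by omega, j, hj, hb⟩
  | succ r ih =>
    intro j s hj hr
    by_cases hb : b.Holds T s
    · obtain ⟨t, s', hr1, ht, hq⟩ := hstep j s hj hb
      obtain ⟨t', s'', hr2, ht', hq'⟩ := ih (j + 1) s' hq (by omega)
      refine ⟨_, s'', .loopStep hb hr1 hr2, ?_, hq'⟩
      rw [Nat.succ_mul]; omega
    · exact ⟨_, s, .loopStop hb, by omega, j, hj, hb⟩

/-- The effect of a program without loops. -/
def Program.exec (T : ℕ → ℕ → ℝ) : Program → State → State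
  | .skip, s => s
  | .setNat a i e, s => s.storeNat a (i.eval s) (e.eval s)
  | .setReal a i e, s => s.storeReal a (i.eval s) (e.eval T s)
  | .seq p q, s => q.exec T (p.exec T s)
  | .cond b p q, s => open scoped Classical in if b.Holds T s then p.exec T s else q.exec T s
  | .loop _ _, s => s

/-- A bound for the number of steps of a program without loops. -/
def Program.maxSteps : Program → ℕ
  | .skip => 1
  | .setNat _ i e => i.steps + e.steps + 1
  | .setReal _ i e => i.steps + e.steps + 1
  | .seq p q => p.maxSteps + q.maxSteps
  | .cond b p q => b.steps + 1 + (p.maxSteps + q.maxSteps)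
  | .loop _ _ => 0

/-- The program has no loops. -/
def Program.loopFree : Program → Bool
  | .seq p q => p.loopFree && q.loopFree
  | .cond _ p q => p.loopFree && q.loopFree
  | .loop _ _ => false
  | _ => true

/-- Straight-line code is run symbolically, so its specification reduces to simplifying
`Program.exec`, and its step bound is a closed numeral. -/
theorem WP.exec : ∀ {p : Program} {s : State}, p.loopFree = true →
    WP T p p.maxSteps (fun s' => s' = p.exec T s) s := by
  intro p
  induction p with
  | skip => exact fun _ => ⟨_, _, .skip _, le_rfl, rfl⟩
  | setNat a i e => exact fun _ => ⟨_, _, .setNat _ _ _ _, le_rfl, rfl⟩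
  | setReal a i e => exact fun _ => ⟨_, _, .setReal _ _ _ _, le_rfl, rfl⟩
  | seq p q ihp ihq =>
    intro s h
    simp only [Program.loopFree, Bool.and_eq_true] at h
    exact .seq ((ihp h.1).mono le_rfl fun _ hs' => (ihq h.2).mono le_rfl fun _ hs'' => by
      rw [hs'', hs']; rfl)
  | cond b p q ihp ihq =>
    intro s h
    simp only [Program.loopFree, Bool.and_eq_true] at h
    refine (WP.cond (τ := p.maxSteps + q.maxSteps)
      (fun hb => (ihp h.1).mono (Nat.le_add_right _ _) fun s' hs' => ?_)
      (fun hb => (ihq h.2).mono (Nat.le_add_left _ _) fun s' hs' => ?_)).mono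
      (by simp only [Program.maxSteps]; omega) fun _ h => h
    · rw [hs', Program.exec, if_pos hb]
    · rw [hs', Program.exec, if_neg hb]
  | loop b p => intro s h; simp [Program.loopFree] at h

theorem WP.of_exec (hp : p.loopFree = true) (hτ : p.maxSteps ≤ τ) (h : Q (p.exec T s)) :
    WP T p τ Q s :=
  (WP.exec hp).mono hτ fun _ hs' => hs' ▸ h

/-- The program writes to the array `a` of natural numbers. -/
def Program.writesNat (a : ℕ) : Program → Bool
  | .setNat b _ _ => a == b
  | .seq p q => p.writesNat a || q.writesNat a
  | .cond _ p q => p.writesNat a || q.writesNat a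
  | .loop _ p => p.writesNat a
  | _ => false

/-- The program writes to the array `a` of real numbers. -/
def Program.writesReal (a : ℕ) : Program → Bool
  | .setReal b _ _ => a == b
  | .seq p q => p.writesReal a || q.writesReal a
  | .cond _ p q => p.writesReal a || q.writesReal a
  | .loop _ p => p.writesReal a
  | _ => false

@[simp] theorem State.storeNat_nat_self (s : State) (a i v : ℕ) :
    (s.storeNat a i v).nat a = Function.update (s.nat a) i v := by simp [State.storeNat]
theorem State.storeNat_nat_ne (s : State) (a i v : ℕ) {b : ℕ} (h : b ≠ a) :
    (s.storeNat a i v).nat b = s.nat b := by simp [State.storeNat, h]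
@[simp] theorem State.storeNat_real (s : State) (a i v : ℕ) :
    (s.storeNat a i v).real = s.real := rfl
@[simp] theorem State.storeReal_real_self (s : State) (a i : ℕ) (v : ℝ) :
    (s.storeReal a i v).real a = Function.update (s.real a) i v := by simp [State.storeReal]
theorem State.storeReal_real_ne (s : State) (a i : ℕ) (v : ℝ) {b : ℕ} (h : b ≠ a) :
    (s.storeReal a i v).real b = s.real b := by simp [State.storeReal, h]
@[simp] theorem State.storeReal_nat (s : State) (a i : ℕ) (v : ℝ) :
    (s.storeReal a i v).nat = s.nat := rfl

/-- Array names are literals, so whether a program writes to an array is decided syntactically.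
Invariants then need to mention only what a loop changes, and the side conditions hold by `rfl`. -/
theorem Run.frame {s s' : State} {t : ℕ} (h : Run T p s t s') :
    (∀ a, p.writesNat a = false → s'.nat a = s.nat a) ∧
    (∀ a, p.writesReal a = false → s'.real a = s.real a) := by
  induction h with
  | skip => simp
  | setNat s a i e =>
    refine ⟨fun b hb => State.storeNat_nat_ne _ _ _ _ ?_, fun _ _ => rfl⟩
    simpa [Program.writesNat] using hb
  | setReal s a i e =>
    refine ⟨fun _ _ => rfl, fun b hb => State.storeReal_real_ne _ _ _ _ ?_⟩
    simpa [Program.writesReal] using hb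
  | seq _ _ ih ih' =>
    constructor
    · intro a ha
      simp only [Program.writesNat, Bool.or_eq_false_iff] at ha
      rw [ih'.1 a ha.2, ih.1 a ha.1]
    · intro a ha
      simp only [Program.writesReal, Bool.or_eq_false_iff] at ha
      rw [ih'.2 a ha.2, ih.2 a ha.1]
  | condTrue _ _ ih =>
    constructor
    · intro a ha
      simp only [Program.writesNat, Bool.or_eq_false_iff] at ha
      exact ih.1 a ha.1
    · intro a ha
      simp only [Program.writesReal, Bool.or_eq_false_iff] at ha
      exact ih.2 a ha.1
  | condFalse _ _ ih =>
    constructor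
    · intro a ha
      simp only [Program.writesNat, Bool.or_eq_false_iff] at ha
      exact ih.1 a ha.2
    · intro a ha
      simp only [Program.writesReal, Bool.or_eq_false_iff] at ha
      exact ih.2 a ha.2
  | loopStop => simp
  | loopStep _ _ _ ih ih' =>
    exact ⟨fun a ha => (ih'.1 a ha).trans (ih.1 a ha), fun a ha => (ih'.2 a ha).trans (ih.2 a ha)⟩

/-- Arrays to which a program does not write keep their contents. -/
def Frame (p : Program) (s s' : State) : Prop :=
  (∀ a, p.writesNat a = false → s'.nat a = s.nat a) ∧
    ∀ a, p.writesReal a = false → s'.real a = s.real a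

theorem WP.frame (h : WP T p τ Q s) : WP T p τ (fun s' => Q s' ∧ Frame p s s') s := by
  obtain ⟨t, s', hr, ht, hq⟩ := h
  exact ⟨t, s', hr, ht, hq, hr.frame⟩

/-- The scalar variable `a`. -/
abbrev NatExpr.var (a : ℕ) : NatExpr := .get a (.const 0)

/-- The scalar variable `a`. -/
abbrev RealExpr.var (a : ℕ) : RealExpr := .get a (.const 0)

/-- Strict comparison. -/
abbrev Test.natLt (e f : NatExpr) : Test := .not (.natLe f e)

/-- Equality. -/
abbrev Test.natEq (e f : NatExpr) : Test := .and (.natLe e f) (.natLe f e)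

/-- Strict comparison. -/
abbrev Test.realLt (e f : RealExpr) : Test := .not (.realLe f e)

/-- `for v := 0, 1, …, e - 1 do p`. -/
def Program.forLoop (v : ℕ) (e : NatExpr) (p : Program) : Program :=
  .seq (.setNat v (.const 0) (.const 0)) (.loop (.natLt (.var v) e)
    (.seq p (.setNat v (.const 0) (.add (.var v) (.const 1)))))

theorem WP.forLoop {v : ℕ} {e : NatExpr} (Inv : ℕ → State → Prop) (N : ℕ)
    (h0 : Inv 0 (s.storeNat v 0 0))
    (hN : ∀ j s, Inv j s → e.eval s = N ∧ s.nat v 0 = j)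
    (hstep : ∀ j s, j < N → Inv j s →
      WP T p τ (fun s' => s'.nat v 0 = j ∧ Inv (j + 1) (s'.storeNat v 0 (j + 1))) s) :
    WP T (.forLoop v e p) (N * (τ + (e.steps + 11)) + (e.steps + 8)) (Inv N) s := by
  let I : ℕ → State → Prop := fun j s => Inv j s ∧ j ≤ N
  have hl : WP T (.loop (.natLt (.var v) e)
      (.seq p (.setNat v (.const 0) (.add (.var v) (.const 1))))) _ _ (s.storeNat v 0 0) :=
    WP.loop (τ := τ + 6) I N ⟨h0, Nat.zero_le _⟩ (fun j s hj hb => by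
      have := hN j s hj.1
      simp only [Test.Holds, NatExpr.eval] at hb
      omega) (fun j s hj hb => by
      have h := hN j s hj.1
      have hjN : j < N := by
        simp only [Test.Holds, NatExpr.eval] at hb
        omega
      refine WP.seq ((hstep j s hjN hj.1).mono le_rfl fun s' hs' => ?_)
      refine WP.of_exec rfl (by simp [Program.maxSteps, NatExpr.steps]) ?_
      refine ⟨?_, hjN⟩
      simpa [Program.exec, NatExpr.eval, hs'.1] using hs'.2)
  obtain ⟨t, s', hr, ht, j, hj, hb⟩ := hl
  have hjN : j = N := by
    have h := hN j s' hj.1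
    have := hj.2
    simp only [Test.Holds, NatExpr.eval] at hb
    omega
  refine ⟨_, s', .seq (.setNat _ _ _ _) hr, ?_, hjN ▸ hj.1⟩
  refine (Nat.add_le_add_left ht _).trans ?_
  simp only [Test.steps, NatExpr.steps]
  have : τ + 6 + (1 + 1 + e.steps + 1 + 1 + 1) = τ + (e.steps + 11) := by omega
  nlinarith

theorem Frame.refl (p : Program) (s : State) : Frame p s s := ⟨fun _ _ => rfl, fun _ _ => rfl⟩

/-- A `for` loop, where the invariant need not mention what the loop does not change. -/
theorem WP.forFrame {v : ℕ} {e : NatExpr} (Inv : ℕ → State → Prop) (N : ℕ)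
    (hN : ∀ s', Frame (.forLoop v e p) s s' → e.eval s' = N)
    (hv : p.writesNat v = false) (h0 : Inv 0 (s.storeNat v 0 0))
    (hstep : ∀ j s', j < N → Frame (.forLoop v e p) s s' → s'.nat v 0 = j → Inv j s' →
      WP T p τ (fun s'' => Inv (j + 1) (s''.storeNat v 0 (j + 1))) s') :
    WP T (.forLoop v e p) (N * (τ + (e.steps + 11)) + (e.steps + 8))
      (fun s' => Inv N s' ∧ Frame (.forLoop v e p) s s') s := by
  refine (WP.forLoop (fun j s' => Inv j s' ∧ s'.nat v 0 = j ∧ Frame (.forLoop v e p) s s') N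
    ⟨h0, by simp, ?_⟩ (fun j s' h => ⟨hN s' h.2.2, h.2.1⟩) fun j s' hj h => ?_).mono le_rfl
      fun s' h => ⟨h.1, h.2.2⟩
  · refine ⟨fun a ha => ?_, fun _ _ => rfl⟩
    simp only [Program.forLoop, Program.writesNat, Bool.or_eq_false_iff, beq_eq_false_iff_ne] at ha
    rw [State.storeNat_nat_ne _ _ _ _ ha.1]
  · refine (hstep j s' hj h.2.2 h.2.1 h.1).frame.mono le_rfl fun s'' h'' => ⟨?_, h''.1, ?_, ?_⟩
    · rw [h''.2.1 v hv, h.2.1]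
    · simp
    · refine ⟨fun a ha => ?_, fun a ha => ?_⟩
      · have ha' := ha
        simp only [Program.forLoop, Program.writesNat, Bool.or_eq_false_iff,
          beq_eq_false_iff_ne] at ha'
        rw [State.storeNat_nat_ne _ _ _ _ ha'.1, h''.2.1 a ha'.2.1, h.2.2.1 a ha]
      · have ha' := ha
        simp only [Program.forLoop, Program.writesReal, Bool.false_or, Bool.or_false] at ha'
        rw [State.storeNat_real, h''.2.2 a ha', h.2.2.2 a ha]

/-- A loop, where the invariant need not mention what the loop does not change. -/
theorem WP.loopFrame {b : Test} (Inv : ℕ → State → Prop) (N : ℕ) (h0 : Inv 0 s)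
    (hN : ∀ j s', Frame (.loop b p) s s' → Inv j s' → b.Holds T s' → j < N)
    (hstep : ∀ j s', Frame (.loop b p) s s' → Inv j s' → b.Holds T s' →
      WP T p τ (Inv (j + 1)) s') :
    WP T (.loop b p) (N * (τ + (b.steps + 1)) + (b.steps + 1))
      (fun s' => ∃ j, Inv j s' ∧ ¬ b.Holds T s' ∧ Frame (.loop b p) s s') s := by
  refine (WP.loop (fun j s' => Inv j s' ∧ Frame (.loop b p) s s') N ⟨h0, Frame.refl _ _⟩
    (fun j s' h => hN j s' h.2 h.1) fun j s' h hb => ?_).mono le_rfl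
      fun s' ⟨j, h, hb⟩ => ⟨j, h.1, hb, h.2⟩
  refine (hstep j s' h.2 h.1 hb).frame.mono le_rfl fun s'' h'' => ⟨h''.1, ?_, ?_⟩
  · exact fun a ha => (h''.2.1 a ha).trans (h.2.1 a ha)
  · exact fun a ha => (h''.2.2 a ha).trans (h.2.2 a ha)

/-- The step of a loop that fills an array from left to right. -/
theorem update_ite_lt {α : Type*} (f g : ℕ → α) (j : ℕ) {v : α} (hv : v = f j) :
    Function.update (fun q => if q < j then f q else g q) j v =
      fun q => if q < j + 1 then f q else g q := by
  funext q
  rw [Function.update_apply]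
  split_ifs with h1 h2 h3 h4 h5
  · rw [hv, h1]
  · omega
  · rfl
  · omega
  · omega
  · rfl

end RealRAM

namespace ColorfulRadii

/-! ### Greedy covering, as a function of the branching decisions -/

/-- The data of an instance, indexed by natural numbers. -/
structure Data : Type where
  n : ℕ
  k : ℕ
  col : ℕ → ℕ
  bnd : ℕ → ℕ
  d : ℕ → ℕ → ℝ

/-- The metric axioms, for the points below `n`. -/
structure Data.Good (D : Data) : Prop where
  self : ∀ i, D.d i i = 0
  symm : ∀ i j, D.d i j = D.d j i
  nonneg : ∀ i j, 0 ≤ D.d i j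
  triangle : ∀ i j l, i < D.n → j < D.n → l < D.n → D.d i l ≤ D.d i j + D.d j l
  one_le_k : 1 ≤ D.k
  k_le_n : D.k ≤ D.n

/-- A partial clustering: `cov` marks the covered points, `asg` is the assignment and `isC` marks
the centers. -/
structure Cover : Type where
  cov : ℕ → ℕ
  asg : ℕ → ℕ
  isC : ℕ → ℕ
  cost : ℝ

namespace Data

variable (D : Data)

/-- The number of uncovered points before `p` in the class of `p`. -/
def rank (cov : ℕ → ℕ) (p : ℕ) : ℕ :=
  ((Finset.range p).filter (fun q => cov q = 0 ∧ D.col q = D.col p)).card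

/-- `p` is an uncovered point that exceeds the outlier bound of its class. -/
def Excess (cov : ℕ → ℕ) (p : ℕ) : Prop := cov p = 0 ∧ D.bnd (D.col p) ≤ D.rank cov p

open Classical in
/-- The successor of a class in which the points below `j` exceed the outlier bound, `0` if there
is none. -/
def excessClass (cov : ℕ → ℕ) : ℕ → ℕ
  | 0 => 0
  | j + 1 => if D.Excess cov j then D.col j + 1 else excessClass cov j

/-- The point with number `a` among the uncovered points of the class `v - 1`. -/
def pick (cov : ℕ → ℕ) (v a : ℕ) : ℕ → ℕ
  | 0 => 0
  | j + 1 => if cov j = 0 ∧ D.col j + 1 = v ∧ D.rank cov j = a then j else pick cov v a j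

/-- `q` is newly covered by the ball of radius `r` around `p`. -/
def Hit (cov : ℕ → ℕ) (p : ℕ) (r : ℝ) (q : ℕ) : Prop := cov q = 0 ∧ D.d p q ≤ r

open Classical in
/-- The largest distance from `p` to a newly covered point below `j`. -/
def hitRadius (cov : ℕ → ℕ) (p : ℕ) (r : ℝ) : ℕ → ℝ
  | 0 => 0
  | j + 1 => if D.Hit cov p r j then max (hitRadius cov p r j) (D.d p j) else hitRadius cov p r j

/-- Nothing is covered. -/
def start : Cover where
  cov _ := 0
  asg q := if q < D.n then q else 0
  isC _ := 0
  cost := 0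

open Classical in
/-- Add the ball of radius `r` around `p`. -/
def addBall (C : Cover) (p : ℕ) (r : ℝ) : Cover where
  cov q := if q < D.n ∧ D.Hit C.cov p r q then 1 else C.cov q
  asg q := if q < D.n ∧ D.Hit C.cov p r q then p else C.asg q
  isC := Function.update C.isC p 1
  cost := C.cost + D.hitRadius C.cov p r D.n

/-- The class that is branched over. -/
abbrev viol (C : Cover) : ℕ := D.excessClass C.cov D.n

/-- The new center for the decision `a`. -/
abbrev center (C : Cover) (a : ℕ) : ℕ := D.pick C.cov (D.viol C) a D.n

/-- One branching step. -/
def step (C : Cover) (a : ℕ) (r : ℝ) : Cover :=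
  if D.viol C = 0 then C else D.addBall C (D.center C a) r

/-- The result of the first `l` decisions. -/
def run (rad : ℕ → ℝ) (δ : ℕ → ℕ) : ℕ → Cover
  | 0 => D.start
  | l + 1 => D.step (run rad δ l) (δ (l + l)) (rad (δ (l + l + 1)))

variable {D}

theorem rank_lt_rank {cov : ℕ → ℕ} {p q : ℕ} (hpq : p < q) (hp : cov p = 0)
    (h : D.col p = D.col q) : D.rank cov p < D.rank cov q := by
  refine Finset.card_lt_card (Finset.ssubset_iff_of_subset ?_ |>.2 ⟨p, ?_, ?_⟩)
  · intro x hx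
    simp only [Finset.mem_filter, Finset.mem_range] at hx ⊢
    exact ⟨by omega, hx.2.1, hx.2.2.trans h⟩
  · simp [hpq, hp, h]
  · simp

theorem rank_inj {cov : ℕ → ℕ} {p q : ℕ} (hp : cov p = 0) (hq : cov q = 0)
    (h : D.col p = D.col q) (hr : D.rank cov p = D.rank cov q) : p = q := by
  rcases lt_trichotomy p q with h1 | h1 | h1
  · exact absurd hr (rank_lt_rank h1 hp h).ne
  · exact h1
  · exact absurd hr.symm (rank_lt_rank h1 hq h.symm).ne

theorem excessClass_eq_zero {cov : ℕ → ℕ} {j : ℕ} :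
    D.excessClass cov j = 0 ↔ ∀ p < j, ¬ D.Excess cov p := by
  induction j with
  | zero => simp [excessClass]
  | succ j ih =>
    rw [excessClass]
    split_ifs with h
    · simp only [false_iff, not_forall]
      exact ⟨j, by omega, by simpa using h⟩
    · rw [ih]
      constructor
      · intro h1 p hp
        rcases Nat.lt_succ_iff_lt_or_eq.1 hp with h2 | rfl
        exacts [h1 p h2, h]
      · exact fun h1 p hp => h1 p (by omega)

theorem exists_of_excessClass_ne_zero {cov : ℕ → ℕ} {j : ℕ} (h : D.excessClass cov j ≠ 0) :
    ∃ p < j, D.Excess cov p ∧ D.excessClass cov j = D.col p + 1 := by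
  induction j with
  | zero => simp [excessClass] at h
  | succ j ih =>
    rw [excessClass] at h ⊢
    split_ifs at h ⊢ with h1
    · exact ⟨j, by omega, h1, rfl⟩
    · obtain ⟨p, hp, h2⟩ := ih h
      exact ⟨p, by omega, h2⟩

/-- If no point is in excess then the uncovered points respect the outlier bounds. -/
theorem card_uncovered_le {cov : ℕ → ℕ} {j : ℕ} (h : ∀ p < j, ¬ D.Excess cov p) (c : ℕ) :
    ((Finset.range j).filter (fun q => cov q = 0 ∧ D.col q = c)).card ≤ D.bnd c := by
  induction j with
  | zero => simp
  | succ j ih =>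
    rw [Finset.range_add_one, Finset.filter_insert]
    split_ifs with h1
    · rw [Finset.card_insert_of_notMem (by simp)]
      have h2 := h j (by omega)
      rw [Excess, not_and, not_le] at h2
      have := h2 h1.1
      rw [rank, h1.2] at this
      omega
    · exact ih fun p hp => h p (by omega)

/-- The scan keeps the last match, but ranks are injective on the uncovered points of a class, so
there is only one match. -/
theorem pick_eq {cov : ℕ → ℕ} {v q j : ℕ} (hq : cov q = 0) (hv : D.col q + 1 = v) (hj : q < j) :
    D.pick cov v (D.rank cov q) j = q := by
  induction j with
  | zero => omega
  | succ j ih =>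
    rw [pick]
    split_ifs with h
    · exact rank_inj h.1 hq (by omega) h.2.2
    · refine ih (lt_of_le_of_ne (by omega) ?_)
      rintro rfl
      exact h ⟨hq, hv, rfl⟩

/-- If no point has the requested number, the default `0` is still a point. A meaningless decision
therefore adds a useless but legal ball. -/
theorem pick_lt {cov : ℕ → ℕ} {v a j : ℕ} (hj : 0 < j) : D.pick cov v a j < j := by
  induction j with
  | zero => omega
  | succ j ih =>
    rw [pick]
    split_ifs with h
    · omega
    · rcases Nat.eq_zero_or_pos j with rfl | h1
      · simp [pick]
      · have := ih h1; omega

theorem hitRadius_nonneg {cov : ℕ → ℕ} {p : ℕ} {r : ℝ} (j : ℕ) : 0 ≤ D.hitRadius cov p r j := by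
  induction j with
  | zero => simp [hitRadius]
  | succ j ih =>
    rw [hitRadius]
    split_ifs
    exacts [le_max_of_le_left ih, ih]

theorem le_hitRadius {cov : ℕ → ℕ} {p : ℕ} {r : ℝ} {q j : ℕ} (hq : q < j)
    (h : D.Hit cov p r q) : D.d p q ≤ D.hitRadius cov p r j := by
  induction j with
  | zero => omega
  | succ j ih =>
    rw [hitRadius]
    rcases Nat.lt_succ_iff_lt_or_eq.1 hq with h2 | rfl
    · split_ifs
      exacts [le_max_of_le_left (ih h2), ih h2]
    · rw [if_pos h]
      exact le_max_right _ _

theorem hitRadius_le {cov : ℕ → ℕ} {p : ℕ} {r : ℝ} (hr : 0 ≤ r) (j : ℕ) :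
    D.hitRadius cov p r j ≤ r := by
  induction j with
  | zero => simpa [hitRadius] using hr
  | succ j ih =>
    rw [hitRadius]
    split_ifs with h
    exacts [max_le ih h.2, ih]

/-- Makes the cost of a cover comparable to a single distance; the packing argument for the scales
rests on this. -/
theorem hitRadius_attained {cov : ℕ → ℕ} {p : ℕ} {r : ℝ} (j : ℕ) :
    D.hitRadius cov p r j = 0 ∨ ∃ q < j, D.hitRadius cov p r j = D.d p q := by
  induction j with
  | zero => simp [hitRadius]
  | succ j ih =>
    have ih' : D.hitRadius cov p r j = 0 ∨ ∃ q < j + 1, D.hitRadius cov p r j = D.d p q :=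
      ih.imp_right fun ⟨q, hq, h⟩ => ⟨q, by omega, h⟩
    rw [hitRadius]
    split_ifs with h
    · rcases max_choice (D.hitRadius cov p r j) (D.d p j) with h1 | h1 <;> rw [h1]
      · exact ih'
      · exact Or.inr ⟨j, by omega, rfl⟩
    · exact ih'

/-! ### Soundness -/

/-- `C` is a partial clustering with at most `l` balls of radius at most `r`. -/
structure Sound (D : Data) (C : Cover) (l : ℕ) (r : ℝ) : Prop where
  cov_le : ∀ q, C.cov q ≤ 1
  cov_tail : ∀ q, D.n ≤ q → C.cov q = 0
  asg_tail : ∀ q, D.n ≤ q → C.asg q = 0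
  isC_tail : ∀ q, D.n ≤ q → C.isC q = 0
  isC_le : ∀ q, C.isC q ≤ 1
  card_le : ((Finset.range D.n).filter (fun q => C.isC q = 1)).card ≤ l
  asg_unc : ∀ q < D.n, C.cov q = 0 → C.asg q = q
  asg_cov : ∀ q < D.n, C.cov q = 1 → C.asg q < D.n ∧ C.isC (C.asg q) = 1 ∧
    D.d (C.asg q) q ≤ r
  cost_le : C.cost ≤ l * r
  radius : ∃ ρ : ℕ → ℝ, (∀ c, 0 ≤ ρ c) ∧
    (∀ q < D.n, C.cov q = 1 → D.d (C.asg q) q ≤ ρ (C.asg q)) ∧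
    ∑ c ∈ Finset.range D.n, ρ c ≤ C.cost
  scale : ∃ x < D.n, ∃ y < D.n, D.d x y ≤ C.cost ∧ C.cost ≤ l * D.d x y

theorem Sound.start (hD : D.Good) (r : ℝ) : Sound D D.start 0 r where
  cov_le := by simp [Data.start]
  cov_tail := by simp [Data.start]
  asg_tail := fun q hq => by simp [Data.start, hq]
  isC_tail := by simp [Data.start]
  isC_le := by simp [Data.start]
  card_le := by simp [Data.start]
  asg_unc := fun q hq _ => by simp [Data.start, hq]
  asg_cov := by simp [Data.start]
  cost_le := by simp [Data.start]
  radius := ⟨fun _ => 0, by simp, by simp [Data.start], by simp [Data.start]⟩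
  scale := by
    have := hD.one_le_k.trans hD.k_le_n
    exact ⟨0, by omega, 0, by omega, by simp [Data.start, hD.self]⟩

theorem Sound.mono {C : Cover} {l l' : ℕ} {r : ℝ} (h : Sound D C l r) (hl : l ≤ l') (hr : 0 ≤ r)
    (hD : D.Good) : Sound D C l' r where
  __ := h
  card_le := h.card_le.trans hl
  cost_le := h.cost_le.trans (by gcongr)
  scale := by
    obtain ⟨x, hx, y, hy, h1, h2⟩ := h.scale
    refine ⟨x, hx, y, hy, h1, h2.trans ?_⟩
    have := hD.nonneg x y
    gcongr

theorem Sound.addBall {C : Cover} {l : ℕ} {r r' : ℝ} (h : Sound D C l r) (hD : D.Good)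
    {p : ℕ} (hp : p < D.n) (hr' : 0 ≤ r') (hr : r' ≤ r) :
    Sound D (D.addBall C p r') (l + 1) r where
  cov_le := fun q => by
    simp only [Data.addBall]; split_ifs; exacts [le_rfl, h.cov_le q]
  cov_tail := fun q hq => by
    simp only [Data.addBall]; rw [if_neg (by omega)]; exact h.cov_tail q hq
  asg_tail := fun q hq => by
    simp only [Data.addBall]; rw [if_neg (by omega)]; exact h.asg_tail q hq
  isC_tail := fun q hq => by
    simp only [Data.addBall]; rw [Function.update_of_ne (by omega)]; exact h.isC_tail q hq
  isC_le := fun q => by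
    simp only [Data.addBall, Function.update_apply]; split_ifs; exacts [le_rfl, h.isC_le q]
  card_le := by
    refine (Finset.card_le_card (t := insert p ((Finset.range D.n).filter (fun q => C.isC q = 1)))
      ?_).trans ((Finset.card_insert_le _ _).trans (Nat.succ_le_succ h.card_le))
    intro q hq
    simp only [Data.addBall, Finset.mem_filter, Finset.mem_range, Function.update_apply,
      Finset.mem_insert] at hq ⊢
    by_cases hqp : q = p
    · exact Or.inl hqp
    · exact Or.inr ⟨hq.1, by simpa [hqp] using hq.2⟩
  asg_unc := fun q hq hc => by
    simp only [Data.addBall] at hc ⊢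
    split_ifs at hc ⊢
    exact h.asg_unc q hq hc
  asg_cov := fun q hq hc => by
    simp only [Data.addBall] at hc ⊢
    split_ifs at hc ⊢ with h1
    · exact ⟨hp, by simp, h1.2.2.trans hr⟩
    · obtain ⟨h2, h3, h4⟩ := h.asg_cov q hq hc
      refine ⟨h2, ?_, h4⟩
      rw [Function.update_apply]
      split_ifs
      exacts [rfl, h3]
  cost_le := by
    simp only [Data.addBall]
    have h1 := h.cost_le
    have h2 := (hitRadius_le (D := D) (cov := C.cov) (p := p) hr' D.n).trans hr
    push_cast
    linarith
  radius := by
    obtain ⟨ρ, h0, h1, h2⟩ := h.radius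
    have hn := hitRadius_nonneg (D := D) (cov := C.cov) (p := p) (r := r') D.n
    -- The same point may become a center twice (for instance the default `0`), so the new radius is
    -- added to the old value instead of replacing it.
    refine ⟨fun c => ρ c + if c = p then D.hitRadius C.cov p r' D.n else 0, ?_, ?_, ?_⟩
    · intro c
      have := h0 c
      dsimp only
      split_ifs <;> linarith
    · intro q hq hc
      simp only [Data.addBall] at hc ⊢
      split_ifs at hc ⊢ with h3 h4 h4
      · exact le_add_of_nonneg_of_le (h0 p) (le_hitRadius h3.1 h3.2)
      · exact absurd rfl h4
      · have := h1 q hq hc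
        rw [h4] at this ⊢
        linarith
      · simpa using h1 q hq hc
    · rw [Finset.sum_add_distrib, Finset.sum_ite_eq', if_pos (by simpa using hp)]
      simpa [Data.addBall] using h2
  scale := by
    obtain ⟨x, hx, y, hy, h1, h2⟩ := h.scale
    have h0 : 0 ≤ C.cost := (hD.nonneg x y).trans h1
    have hn := hitRadius_nonneg (D := D) (cov := C.cov) (p := p) (r := r') D.n
    have key : ∃ x' < D.n, ∃ y' < D.n, D.hitRadius C.cov p r' D.n = D.d x' y' := by
      rcases hitRadius_attained (D := D) (cov := C.cov) (p := p) (r := r') D.n with h3 | ⟨q, hq, h3⟩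
      · exact ⟨p, hp, p, hp, by rw [h3, hD.self]⟩
      · exact ⟨p, hp, q, hq, h3⟩
    obtain ⟨x', hx', y', hy', h3⟩ := key
    simp only [Data.addBall, h3] at hn ⊢
    push_cast
    -- The larger of the two distances serves as witness: the old cost is at most `l` times it and
    -- the new radius at most once.
    rcases le_total (D.d x y) (D.d x' y') with h4 | h4
    · refine ⟨x', hx', y', hy', by linarith, ?_⟩
      have : (l : ℝ) * D.d x y ≤ l * D.d x' y' := by gcongr
      linarith
    · exact ⟨x, hx, y, hy, by linarith, by linarith⟩

theorem Sound.run (hD : D.Good) {rad : ℕ → ℝ} {r : ℝ} {δ : ℕ → ℕ} {l : ℕ}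
    (h0 : ∀ i < l, 0 ≤ rad (δ (i + i + 1))) (hr : ∀ i < l, rad (δ (i + i + 1)) ≤ r)
    (hr0 : 0 ≤ r) : Sound D (D.run rad δ l) l r := by
  induction l with
  | zero => exact .start hD r
  | succ l ih =>
    have ih := ih (fun i hi => h0 i (by omega)) (fun i hi => hr i (by omega))
    rw [Data.run, Data.step]
    split_ifs with h
    · exact ih.mono (by omega) hr0 hD
    · have := hD.one_le_k.trans hD.k_le_n
      exact ih.addBall hD (pick_lt (by omega)) (h0 l (by omega)) (hr l (by omega))

theorem run_congr {rad : ℕ → ℝ} {δ δ' : ℕ → ℕ} {l : ℕ} (h : ∀ i < l + l, δ i = δ' i) :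
    D.run rad δ l = D.run rad δ' l := by
  induction l with
  | zero => rfl
  | succ l ih =>
    rw [Data.run, Data.run, ih fun i hi => h i (by omega), h (l + l) (by omega),
      h (l + l + 1) (by omega)]

/-! ### Completeness -/

/-- A clustering with outliers to compare with. -/
structure Clustering (D : Data) : Type where
  C : Finset ℕ
  out : Finset ℕ
  asg : ℕ → ℕ
  ρ : ℕ → ℝ
  card_le : C.card ≤ D.k
  lt_n : ∀ c ∈ C, c < D.n
  out_le : ∀ c, (out.filter (fun q => D.col q = c)).card ≤ D.bnd c
  asg_mem : ∀ q < D.n, q ∉ out → asg q ∈ C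
  dist_le : ∀ q < D.n, q ∉ out → D.d q (asg q) ≤ ρ (asg q)
  ρ_nonneg : ∀ c ∈ C, 0 ≤ ρ c

/-- The sum of the radii. -/
def Clustering.cost (S : Clustering D) : ℝ := ∑ c ∈ S.C, S.ρ c

/-- In a violated class one of the first points is not an outlier of `S`. -/
theorem exists_pick (S : Clustering D) {C : Cover} (h : D.viol C ≠ 0) {M : ℕ}
    (hM : ∀ p < D.n, D.bnd (D.col p) < M) :
    ∃ a < M, D.center C a ∉ S.out ∧ D.center C a < D.n ∧ C.cov (D.center C a) = 0 := by
  obtain ⟨p, hp, h1, h2⟩ := exists_of_excessClass_ne_zero h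
  set U := (Finset.range D.n).filter (fun q => C.cov q = 0 ∧ D.col q = D.col p) with hU
  -- Otherwise the excess point `p` and the uncovered points of its class before it would be too
  -- many outliers of `S` in one class.
  have hex : ∃ q, q ∈ U ∧ q ∉ S.out := by
    by_contra hcon
    push Not at hcon
    have h3 : insert p ((Finset.range p).filter (fun q => C.cov q = 0 ∧ D.col q = D.col p)) ⊆
        S.out.filter (fun q => D.col q = D.col p) := by
      intro q hq
      rw [Finset.mem_insert, Finset.mem_filter, Finset.mem_range] at hq
      have hqU : q ∈ U := by
        rw [hU, Finset.mem_filter, Finset.mem_range]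
        rcases hq with rfl | hq
        exacts [⟨hp, h1.1, rfl⟩, ⟨by omega, hq.2⟩]
      exact Finset.mem_filter.2 ⟨hcon q hqU, (Finset.mem_filter.1 hqU).2.2⟩
    have h4 := (Finset.card_le_card h3).trans (S.out_le (D.col p))
    rw [Finset.card_insert_of_notMem (by simp)] at h4
    have := h1.2
    rw [rank] at this
    omega
  classical
  obtain ⟨hq1, hq2⟩ := Nat.find_spec hex
  have hmin := fun m (hm : m < Nat.find hex) => Nat.find_min hex hm
  set q := Nat.find hex
  rw [hU, Finset.mem_filter, Finset.mem_range] at hq1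
  -- By minimality of `q`, all uncovered points of the class before `q` are outliers of `S`, so the
  -- outlier bound limits their number.
  have hrank : D.rank C.cov q ≤ D.bnd (D.col p) := by
    refine (Finset.card_le_card ?_).trans (S.out_le (D.col p))
    intro x hx
    rw [Finset.mem_filter, Finset.mem_range] at hx
    have h5 := hmin x hx.1
    push Not at h5
    rw [Finset.mem_filter]
    have h6 : D.col x = D.col p := hx.2.2.trans hq1.2.2
    exact ⟨h5 (by rw [hU, Finset.mem_filter, Finset.mem_range]; exact ⟨by omega, hx.2.1, h6⟩), h6⟩
  have hpick : D.center C (D.rank C.cov q) = q :=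
    pick_eq hq1.2.1 (by rw [viol, h2, hq1.2.2]) hq1.1
  exact ⟨D.rank C.cov q, hrank.trans_lt (hM p hp), by rw [hpick]; exact ⟨hq2, hq1.1, hq1.2.1⟩⟩

/-- A geometric sequence of guesses approximates every radius. -/
theorem exists_guess {R x : ℝ} {G : ℕ} (hG : 0 < G) (hR : 0 ≤ R) (hx : 0 ≤ x) (hxR : x ≤ R) :
    ∃ g < G, x ≤ R * (2 / 7) ^ g ∧
      2 * (R * (2 / 7) ^ g) ≤ 7 * x + 2 * (R * (2 / 7) ^ (G - 1)) := by
  -- Take the last guess that is at least `x`: unless it ends the sequence, the next one is below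
  -- `x`, so this one is below `(7/2)x`.
  have key : ∃ g < G, x ≤ R * (2 / 7) ^ g ∧ (g = G - 1 ∨ R * (2 / 7) ^ (g + 1) < x) := by
    induction G with
    | zero => omega
    | succ G ih =>
      rcases Nat.eq_zero_or_pos G with rfl | h
      · exact ⟨0, by omega, by simpa using hxR, by simp⟩
      · by_cases h1 : x ≤ R * (2 / 7) ^ G
        · exact ⟨G, by omega, h1, by simp⟩
        · obtain ⟨g, hg, h2, h3⟩ := ih h
          refine ⟨g, by omega, h2, Or.inr ?_⟩
          rcases h3 with h3 | h3
          · rw [show g + 1 = G by omega]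
            exact not_le.1 h1
          · exact h3
  obtain ⟨g, hg, h1, h2⟩ := key
  refine ⟨g, hg, h1, ?_⟩
  have h3 : 0 ≤ R * (2 / 7) ^ (G - 1) := by positivity
  rcases h2 with rfl | h2
  · linarith
  · rw [pow_succ] at h2
    linarith

/-- The number of values of the digit `i`: even digits choose a point, odd ones a radius. -/
def lim (M G i : ℕ) : ℕ := if i % 2 = 0 then M else G

/-- If the radii of `S` are at most `R` then some sequence of decisions leads to a solution whose
cost is close to `7 * S.cost`. -/
theorem exists_run (hD : D.Good) (S : Clustering D) {R : ℝ} (hR0 : 0 ≤ R)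
    (hR : ∀ c ∈ S.C, S.ρ c ≤ R) {M G : ℕ} (hG : 0 < G) (hM : ∀ p < D.n, D.bnd (D.col p) < M)
    (rad : ℕ → ℝ) (hrad : ∀ g < G, rad g = 2 * (R * (2 / 7) ^ g)) {a : ℕ}
    (ha : D.viol D.start ≠ 0 → D.center D.start a ∉ S.out) :
    ∃ δ : ℕ → ℕ, δ 0 = a ∧ (∀ i, 1 ≤ i → δ i < lim M G i) ∧ D.viol (D.run rad δ D.k) = 0 ∧
      (D.run rad δ D.k).cost ≤ 7 * S.cost + D.k * (2 * (R * (2 / 7) ^ (G - 1))) := by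
  have hn : 0 < D.n := hD.one_le_k.trans hD.k_le_n
  have hM0 : 0 < M := (Nat.zero_le _).trans_lt (hM 0 hn)
  set η := 2 * (R * (2 / 7) ^ (G - 1)) with hη
  have hη0 : 0 ≤ η := by positivity
  -- `A` collects the centers of `S` whose clusters are already covered completely. Each effective
  -- round adds one of them, which pays for the new ball.
  have key : ∀ l, ∃ (δ : ℕ → ℕ) (A : Finset ℕ), A ⊆ S.C ∧ δ 0 = a ∧
      (∀ i, 1 ≤ i → δ i < lim M G i) ∧ (D.viol (D.run rad δ l) = 0 ∨ A.card = l) ∧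
      (∀ q < D.n, q ∉ S.out → S.asg q ∈ A → (D.run rad δ l).cov q ≠ 0) ∧
      (D.run rad δ l).cost ≤ ∑ c ∈ A, (7 * S.ρ c + η) := by
    intro l
    induction l with
    | zero =>
      refine ⟨fun i => if i = 0 then a else 0, ∅, by simp, by simp, ?_, by simp, by simp, ?_⟩
      · intro i hi
        dsimp only
        rw [if_neg (by omega), lim]
        split_ifs
        exacts [hM0, hG]
      · simp [Data.run, Data.start]
    | succ l ih =>
      obtain ⟨δ, A, hA, h0, hlim, hcard, hcov, hcost⟩ := ih
      by_cases hv : D.viol (D.run rad δ l) = 0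
      · refine ⟨δ, A, hA, h0, hlim, ?_⟩
        have hstep : D.run rad δ (l + 1) = D.run rad δ l := by rw [Data.run, Data.step, if_pos hv]
        rw [hstep]
        exact ⟨Or.inl hv, hcov, hcost⟩
      have hcard := hcard.resolve_left hv
      have hpick : ∃ b, (l = 0 → b = a) ∧ (l ≠ 0 → b < M) ∧
          D.center (D.run rad δ l) b ∉ S.out ∧ D.center (D.run rad δ l) b < D.n ∧
          (D.run rad δ l).cov (D.center (D.run rad δ l) b) = 0 := by
        -- The first point is prescribed, so there the hypothesis `ha` replaces the free choice.
        by_cases hl : l = 0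
        · subst hl
          exact ⟨a, fun _ => rfl, by simp, ha hv, pick_lt hn, rfl⟩
        · obtain ⟨b, hb, h⟩ := exists_pick S hv hM
          exact ⟨b, by simp [hl], fun _ => hb, h⟩
      obtain ⟨b, hb0, hbM, hb1, hb2, hb3⟩ := hpick
      set p := D.center (D.run rad δ l) b with hp
      have hc := S.asg_mem p hb2 hb1
      have hcA : S.asg p ∉ A := fun h => hcov p hb2 hb1 h hb3
      obtain ⟨g, hg, hg1, hg2⟩ := exists_guess hG hR0 (S.ρ_nonneg _ hc) (hR _ hc)
      let δ' : ℕ → ℕ := fun i => if i = l + l then b else if i = l + l + 1 then g else δ i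
      have hrun : D.run rad δ' l = D.run rad δ l := run_congr fun i hi => by
        simp only [δ']; rw [if_neg (by omega), if_neg (by omega)]
      have hstep : D.run rad δ' (l + 1) = D.addBall (D.run rad δ l) p (rad g) := by
        rw [Data.run, hrun, Data.step, if_neg hv]
        simp [δ', hp]
      refine ⟨δ', insert (S.asg p) A, Finset.insert_subset hc hA, ?_, ?_, Or.inr ?_, ?_, ?_⟩
      · simp only [δ']
        rw [if_neg (c := 0 = l + l + 1) (by omega)]
        split_ifs with hl
        exacts [hb0 (by omega), h0]
      · intro i hi
        simp only [δ']
        split_ifs with h1 h2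
        · rw [lim, if_pos (by omega)]; exact hbM (by omega)
        · rw [lim, if_neg (by omega)]; exact hg
        · exact hlim i hi
      · rw [Finset.card_insert_of_notMem hcA, hcard]
      · intro q hq hqo hqA
        rw [hstep]
        simp only [Data.addBall]
        split_ifs with h1
        · exact one_ne_zero
        · rcases Finset.mem_insert.1 hqA with h2 | h2
          · intro hc0
            -- Both `p` and `q` are within the radius of their common center in `S`, hence within
            -- twice the guess of each other.
            refine h1 ⟨hq, hc0, ?_⟩
            have h3 := hD.triangle p (S.asg p) q hb2 (S.lt_n _ hc) hq
            have h4 := S.dist_le p hb2 hb1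
            have h5 := S.dist_le q hq hqo
            rw [h2, hD.symm] at h5
            rw [hrad g hg]
            linarith
          · exact hcov q hq hqo h2
      · rw [hstep, Finset.sum_insert hcA]
        have h1 := hitRadius_le (D := D) (cov := (D.run rad δ l).cov) (p := p) (r := rad g)
          (by rw [hrad g hg]; positivity) D.n
        rw [hrad g hg] at h1
        simp only [Data.addBall]
        rw [hrad g hg]
        linarith
  obtain ⟨δ, A, hA, h0, hlim, hcard, hcov, hcost⟩ := key D.k
  refine ⟨δ, h0, hlim, ?_, ?_⟩
  · by_contra hv
    -- A violated class after `k` rounds would mean that every cluster of `S` is covered, while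
    -- `exists_pick` still yields an uncovered non-outlier.
    have hAC : A = S.C := Finset.eq_of_subset_of_card_le hA
      (S.card_le.trans (hcard.resolve_left hv).ge)
    obtain ⟨b, -, h1, h2, h3⟩ := exists_pick S hv hM
    exact hcov _ h2 h1 (hAC ▸ S.asg_mem _ h2 h1) h3
  · refine hcost.trans ?_
    have h1 : ∑ c ∈ A, (7 * S.ρ c + η) ≤ ∑ c ∈ S.C, (7 * S.ρ c + η) :=
      Finset.sum_le_sum_of_subset_of_nonneg hA fun c hc _ => by
        have := S.ρ_nonneg c hc; positivity
    refine h1.trans ?_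
    rw [Finset.sum_add_distrib, ← Finset.mul_sum, Finset.sum_const, nsmul_eq_mul, Clustering.cost]
    have h2 : (S.C.card : ℝ) ≤ D.k := by exact_mod_cast S.card_le
    gcongr

end Data
end ColorfulRadii

namespace ColorfulRadii
namespace Data
variable {D : Data}

/-! ### The number of scales -/

/-- A set that respects the outlier bounds has at most `m` elements. -/
theorem card_le_sum_bnd {ω : ℕ} (hcol : ∀ p < D.n, D.col p < ω) {A : Finset ℕ}
    (hA : ∀ q ∈ A, q < D.n) (h : ∀ c, (A.filter (fun q => D.col q = c)).card ≤ D.bnd c) :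
    A.card ≤ ∑ c ∈ Finset.range ω, D.bnd c := by
  rw [Finset.card_eq_sum_card_fiberwise (f := D.col) (t := Finset.range ω)
    (fun q hq => by simpa using hcol q (hA q hq))]
  exact Finset.sum_le_sum fun c _ => h c

/-- Points at mutual distance more than `2r` are in different balls of radius `r`. -/
theorem Sound.card_separated_le (hD : D.Good) {ω : ℕ} (hcol : ∀ p < D.n, D.col p < ω) {C : Cover}
    {r : ℝ} (h : Sound D C D.k r) (hv : D.viol C = 0) {S : Finset ℕ} (hS : ∀ x ∈ S, x < D.n)
    (hsep : ∀ x ∈ S, ∀ y ∈ S, x ≠ y → 2 * r < D.d x y) :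
    S.card ≤ D.k + ∑ c ∈ Finset.range ω, D.bnd c := by
  -- Covered points of `S` have distinct centers by separation; the uncovered ones obey the outlier
  -- bounds since no class is violated.
  rw [← Finset.card_filter_add_card_filter_not (s := S) (fun q => C.cov q = 1)]
  refine Nat.add_le_add ((Finset.card_le_card_of_injOn C.asg ?_ ?_).trans h.card_le)
    (card_le_sum_bnd hcol (fun q hq => hS q (Finset.mem_filter.1 hq).1) fun c => ?_)
  · intro q hq
    obtain ⟨hq, hc⟩ := Finset.mem_filter.1 hq
    obtain ⟨h1, h2, -⟩ := h.asg_cov q (hS q hq) hc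
    simpa using ⟨h1, h2⟩
  · intro x hx y hy hxy
    obtain ⟨hx, hcx⟩ := Finset.mem_filter.1 hx
    obtain ⟨hy, hcy⟩ := Finset.mem_filter.1 hy
    by_contra hne
    obtain ⟨h1, -, h2⟩ := h.asg_cov x (hS x hx) hcx
    obtain ⟨-, -, h3⟩ := h.asg_cov y (hS y hy) hcy
    have h4 := hD.triangle x (C.asg x) y (hS x hx) h1 (hS y hy)
    have h5 := hsep x hx y hy hne
    rw [hD.symm] at h2
    rw [← hxy] at h3
    linarith
  · refine (Finset.card_le_card ?_).trans (card_uncovered_le (excessClass_eq_zero.1 hv) c)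
    intro q hq
    simp only [Finset.mem_filter, Finset.mem_range] at hq ⊢
    have := h.cov_le q
    exact ⟨hS q hq.1.1, by have := hq.1.2; omega, hq.2⟩

/-- A potential for the number `u` of times the scale `R` was lowered. -/
def Scale (D : Data) (m u : ℕ) (R : ℝ) : Prop :=
  ∃ (e f : ℕ) (Y : ℝ) (S : Finset ℕ), u ≤ (D.k + 5) * e + f ∧ f ≤ D.k + 4 ∧ e ≤ D.k + m ∧
    e + 1 ≤ S.card ∧ (∀ x ∈ S, x < D.n) ∧ 0 < Y ∧
    (∀ x ∈ S, ∀ y ∈ S, x ≠ y → Y ≤ D.k * D.d x y) ∧ R * 2 ^ f ≤ Y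

theorem Scale.le {m u : ℕ} {R : ℝ} (h : Scale D m u R) : u ≤ (D.k + 5) * (D.k + m + 1) := by
  obtain ⟨e, f, Y, S, h1, h2, h3, -⟩ := h
  nlinarith

theorem Scale.zero (hD : D.Good) {m : ℕ} {R : ℝ} (hR : 0 < R) : Scale D m 0 R := by
  have := hD.one_le_k.trans hD.k_le_n
  exact ⟨0, 0, R, {0}, by omega, by omega, by omega, by simp, by simp; omega, hR, by simp, by simp⟩

theorem sq_le_two_pow (k : ℕ) : k ^ 2 ≤ 2 ^ (k + 1) := by
  induction k with
  | zero => simp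
  | succ k ih =>
    rcases Nat.lt_or_ge k 3 with h | h
    · interval_cases k <;> norm_num
    · rw [pow_succ 2]
      nlinarith

/-- In the potential, `S` is a set of more than `e` points at mutual distance at least `Y/k`, and
`f` counts halvings of `R` since `S` last grew. After `k + 4` halvings the scale is so far below `Y`
that the pair `x, y`, at a distance comparable to the best cost `Y'`, can be added to `S` at the
loss of at most one old point. So each new point of `S` pays for `k + 5` lowerings. -/
theorem Scale.succ (hD : D.Good) {ω : ℕ} (hcol : ∀ p < D.n, D.col p < ω) {u : ℕ} {R R' Y' : ℝ}
    (h : Scale D (∑ c ∈ Finset.range ω, D.bnd c) u R) (hR : 0 < R)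
    {C : Cover} (hC : Sound D C D.k (2 * R)) (hv : D.viol C = 0)
    (hY' : 0 < Y') (hYR : Y' ≤ D.k * (2 * R)) {x y : ℕ} (hx : x < D.n) (hy : y < D.n)
    (hxy : D.d x y ≤ Y') (hxy' : Y' ≤ D.k * D.d x y) (hR1 : R' ≤ Y') (hR2 : R' ≤ R / 2) :
    Scale D (∑ c ∈ Finset.range ω, D.bnd c) (u + 1) R' := by
  obtain ⟨e, f, Y, S, h1, h2, h3, h4, h5, h6, h7, h8⟩ := h
  rcases Nat.lt_or_ge f (D.k + 4) with hf | hf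
  · refine ⟨e, f + 1, Y, S, by omega, hf, h3, h4, h5, h6, h7, le_trans ?_ h8⟩
    rw [pow_succ]
    have : (0 : ℝ) < 2 ^ f := by positivity
    nlinarith
  obtain rfl : f = D.k + 4 := le_antisymm h2 hf
  have hk : (1 : ℝ) ≤ D.k := by exact_mod_cast hD.one_le_k
  -- This is where `k + 4` comes from: `Y' ≤ 2kR` and `8k²R ≤ Y` give `4kY' ≤ Y`.
  have hpow : 8 * (D.k : ℝ) ^ 2 ≤ 2 ^ (D.k + 4) := by
    have := sq_le_two_pow D.k
    have h9 : (D.k : ℝ) ^ 2 ≤ 2 ^ (D.k + 1) := by exact_mod_cast this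
    rw [show D.k + 4 = D.k + 1 + 3 by ring, pow_add]
    linarith
  have hRY : R * (8 * (D.k : ℝ) ^ 2) ≤ Y := (mul_le_mul_of_nonneg_left hpow hR.le).trans h8
  have hYY : 4 * D.k * Y' ≤ Y := by
    have : 4 * D.k * Y' ≤ 4 * D.k * (D.k * (2 * R)) := by gcongr
    nlinarith
  have hxney : x ≠ y := by
    rintro rfl
    rw [hD.self, mul_zero] at hxy'
    linarith
  -- Distances in `S` exceed `4R`, twice the radius `2R` of the balls of `C`. This keeps `e + 1`
  -- below the permitted maximum.
  have hpack : S.card ≤ D.k + ∑ c ∈ Finset.range ω, D.bnd c := by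
    refine hC.card_separated_le hD hcol hv h5 fun z hz w hw hzw => ?_
    have h9 := h7 z hz w hw hzw
    have h10 : (D.k : ℝ) * (4 * R) < D.k * D.d z w := by nlinarith
    have := lt_of_mul_lt_mul_left h10 (by linarith)
    linarith
  classical
  -- Two points within less than `Y/(2k)` of `x` would be too close to each other, so at most one is
  -- discarded. The remaining ones are far from `x`, and also from `y`, because `d x y ≤ Y'` is
  -- small.
  set S₀ := S.filter (fun z => Y ≤ 2 * D.k * D.d z x) with hS₀
  have hnear : ∀ z ∈ S₀, Y' ≤ D.k * D.d z x ∧ Y' ≤ D.k * D.d z y := by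
    intro z hz
    obtain ⟨hz, h9⟩ := Finset.mem_filter.1 hz
    have h10 := hD.triangle z y x (h5 z hz) hy hx
    rw [hD.symm y x] at h10
    have h11 : (D.k : ℝ) * D.d z x ≤ D.k * (D.d z y + Y') := by gcongr; linarith
    constructor <;> nlinarith
  have hcard : S.card ≤ S₀.card + 1 := by
    rw [← Finset.card_filter_add_card_filter_not (s := S) (fun z => Y ≤ 2 * D.k * D.d z x)]
    refine Nat.add_le_add_left (Finset.card_le_one.2 fun z hz w hw => ?_) _
    obtain ⟨hz, h9⟩ := Finset.mem_filter.1 hz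
    obtain ⟨hw, h10⟩ := Finset.mem_filter.1 hw
    by_contra hne
    have h11 := h7 z hz w hw hne
    have h12 := hD.triangle z x w (h5 z hz) hx (h5 w hw)
    rw [hD.symm x w] at h12
    nlinarith
  have hne : ∀ z ∈ S₀, z ≠ x ∧ z ≠ y := by
    intro z hz
    obtain ⟨h9, h10⟩ := hnear z hz
    constructor
    · rintro rfl; rw [hD.self, mul_zero] at h9; linarith
    · rintro rfl; rw [hD.self, mul_zero] at h10; linarith
  refine ⟨e + 1, 0, Y', insert x (insert y S₀), by nlinarith, by omega, by omega, ?_, ?_, hY', ?_,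
    by simpa using hR1⟩
  · rw [Finset.card_insert_of_notMem, Finset.card_insert_of_notMem]
    · omega
    · exact fun hz => (hne y hz).2 rfl
    · rw [Finset.mem_insert, not_or]
      exact ⟨hxney, fun hz => (hne x hz).1 rfl⟩
  · intro z hz
    rw [Finset.mem_insert, Finset.mem_insert] at hz
    rcases hz with rfl | rfl | hz
    exacts [hx, hy, h5 z (Finset.mem_filter.1 hz).1]
  · intro z hz w hw hzw
    rw [Finset.mem_insert, Finset.mem_insert] at hz hw
    rcases hz with rfl | rfl | hz <;> rcases hw with rfl | rfl | hw
    · exact absurd rfl hzw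
    · exact hxy'
    · rw [hD.symm]; exact (hnear w hw).1
    · rw [hD.symm]; exact hxy'
    · exact absurd rfl hzw
    · rw [hD.symm]; exact (hnear w hw).2
    · exact (hnear z hz).1
    · exact (hnear z hz).2
    · have h9 := h7 z (Finset.mem_filter.1 hz).1 w (Finset.mem_filter.1 hw).1 hzw
      nlinarith

/-! ### Mixed radix counting -/

/-- The weight of the digit `i`, where the digits are numbered from `1`. -/
def weight (B : ℕ → ℕ) (i : ℕ) : ℕ := ∏ j ∈ Finset.Ico 1 i, B j

/-- The value of the digits below `i`. -/
def value (B δ : ℕ → ℕ) (i : ℕ) : ℕ := ∑ j ∈ Finset.Ico 1 i, δ j * weight B j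

theorem weight_succ (B : ℕ → ℕ) {i : ℕ} (hi : 1 ≤ i) : weight B (i + 1) = weight B i * B i := by
  rw [weight, Finset.prod_Ico_succ_top hi, weight]

theorem value_succ (B δ : ℕ → ℕ) {i : ℕ} (hi : 1 ≤ i) :
    value B δ (i + 1) = value B δ i + δ i * weight B i := by
  rw [value, Finset.sum_Ico_succ_top hi, value]

theorem value_lt {B δ : ℕ → ℕ} {i : ℕ} (hi : 1 ≤ i) (h : ∀ j, 1 ≤ j → j < i → δ j < B j) :
    value B δ i < weight B i := by
  induction i, hi using Nat.le_induction with
  | base => simp [value, weight]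
  | succ i hi ih =>
    rw [value_succ _ _ hi, weight_succ _ hi]
    have h1 := ih fun j h1 h2 => h j h1 (by omega)
    have h2 := h i hi (by omega)
    nlinarith

/-- Identifies a sequence of decisions by its number, so that counting upwards meets each one. -/
theorem value_inj {B δ δ' : ℕ → ℕ} {i : ℕ} (hi : 1 ≤ i) (h : ∀ j, 1 ≤ j → j < i → δ j < B j)
    (h' : ∀ j, 1 ≤ j → j < i → δ' j < B j) (he : value B δ i = value B δ' i) :
    ∀ j, 1 ≤ j → j < i → δ j = δ' j := by
  induction i, hi using Nat.le_induction with
  | base => intro j h1 h2; omega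
  | succ i hi ih =>
    rw [value_succ _ _ hi, value_succ _ _ hi] at he
    have h1 := value_lt hi fun j h1 h2 => h j h1 (by omega)
    have h2 := value_lt hi fun j h1 h2 => h' j h1 (by omega)
    have h3 : δ i = δ' i := by
      rcases lt_trichotomy (δ i) (δ' i) with h3 | h3 | h3
      · nlinarith
      · exact h3
      · nlinarith
    have h4 := ih (fun j h1 h2 => h j h1 (by omega)) (fun j h1 h2 => h' j h1 (by omega))
      (by rw [h3] at he; omega)
    intro j hj1 hj2
    rcases Nat.lt_succ_iff_lt_or_eq.1 hj2 with h5 | rfl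
    exacts [h4 j hj1 h5, h3]

theorem value_of_maximal {B δ : ℕ → ℕ} {i : ℕ} (hi : 1 ≤ i)
    (h : ∀ j, 1 ≤ j → j < i → δ j + 1 = B j) : value B δ i + 1 = weight B i := by
  induction i, hi using Nat.le_induction with
  | base => simp [value, weight]
  | succ i hi ih =>
    rw [value_succ _ _ hi, weight_succ _ hi, ← h i hi (by omega),
      ← ih fun j h1 h2 => h j h1 (by omega)]
    ring

/-- Clearing the maximal digits below `i` and incrementing the digit `i` adds one. -/
theorem value_increment {B δ δ' : ℕ → ℕ} {i K : ℕ} (hi : 1 ≤ i) (hK : i < K)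
    (h : ∀ j, 1 ≤ j → j < i → δ j + 1 = B j) (h0 : ∀ j, 1 ≤ j → j < i → δ' j = 0)
    (h1 : δ' i = δ i + 1) (h2 : ∀ j, i < j → δ' j = δ j) :
    value B δ' K = value B δ K + 1 := by
  induction K, hK using Nat.le_induction with
  | base =>
    rw [Nat.succ_eq_add_one, value_succ _ _ hi, value_succ _ _ hi, h1]
    have h3 := value_of_maximal hi h
    have h4 : value B δ' i = 0 := by
      refine Finset.sum_eq_zero fun j hj => ?_
      rw [Finset.mem_Ico] at hj
      rw [h0 j hj.1 hj.2, zero_mul]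
    rw [h4, add_mul, one_mul, ← h3]
    ring
  | succ K hK ih =>
    have hK' : i < K := hK
    rw [value_succ _ _ (by omega), value_succ _ _ (by omega), ih, h2 K hK']
    ring

/-- Digit `0` is prescribed, so the digits from `1` to `2k - 1` are `k - 1` points and `k` radii.
The saved factor `M` is what later pays for the number of searches. -/
theorem weight_lim (M G : ℕ) {k : ℕ} (hk : 1 ≤ k) :
    weight (lim M G) (k + k) = M ^ (k - 1) * G ^ k := by
  induction k, hk using Nat.le_induction with
  | base => simp [weight, lim]
  | succ k hk ih =>
    rw [show k + 1 + (k + 1) = k + k + 1 + 1 by ring, weight_succ _ (by omega),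
      weight_succ _ (by omega), ih, lim, lim, if_pos (by omega), if_neg (by omega)]
    obtain ⟨k, rfl⟩ : ∃ j, k = j + 1 := ⟨k - 1, by omega⟩
    simp only [Nat.add_sub_cancel]
    ring

end Data
end ColorfulRadii

namespace ColorfulRadii
open RealRAM

/-! ### The program

Arrays of natural numbers: `6`, `7`, `8` hold the current partial clustering, `9` ranks,
`10` counters, `11` the decisions and `12` their numbers of values. Scalars: `13`, `14`, `17`
loop variables, `15` the violated class, `16` the new center, `18` success, `19` the end of an
enumeration, `20` and `21` the numbers of choices for a point and a radius, `22` a position.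
Arrays of real numbers: `1` the largest radius guessed, `2` the best cost, `3` the current cost,
`4` and `6` radii, `5` multipliers, `7` a power. -/

/-- The number of points. -/
abbrev nE : NatExpr := .get 0 (.const 0)

/-- The number of centers. -/
abbrev kE : NatExpr := .get 0 (.const 1)

/-- The loop variable of a scan over the points. -/
abbrev iE : NatExpr := .var 13

/-- Start with an empty partial clustering. -/
def resetP : Program :=
  .seq (.forLoop 13 nE (.seq (.setNat 6 iE (.const 0)) (.seq (.setNat 7 iE iE)
    (.setNat 8 iE (.const 0))))) (.setReal 3 (.const 0) (.ofNat (.const 0)))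

/-- Count one uncovered point. -/
def countP : Program :=
  .cond (.natLe (.get 6 iE) (.const 0))
    (.seq (.setNat 9 iE (.get 10 (.get 1 iE)))
      (.seq (.setNat 10 (.get 1 iE) (.add (.get 9 iE) (.const 1)))
        (.cond (.natLe (.get 2 (.get 1 iE)) (.get 9 iE))
          (.setNat 15 (.const 0) (.add (.get 1 iE) (.const 1))) .skip))) .skip

/-- Find a violated class. -/
def scanP : Program :=
  .seq (.forLoop 13 nE (.setNat 10 (.get 1 iE) (.const 0)))
    (.seq (.setNat 15 (.const 0) (.const 0)) (.forLoop 13 nE countP))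

/-- Find the next center. -/
def pickP : Program :=
  .seq (.setNat 16 (.const 0) (.const 0)) (.forLoop 13 nE
    (.cond (.and (.natLe (.get 6 iE) (.const 0)) (.and
        (.natEq (.add (.get 1 iE) (.const 1)) (.var 15))
        (.natEq (.get 9 iE) (.get 11 (.add (.var 14) (.var 14))))))
      (.setNat 16 (.const 0) iE) .skip))

/-- Add the ball around the next center. -/
def ballP : Program :=
  .seq (.setReal 6 (.const 0) (.mul (.var 1)
      (.get 5 (.get 11 (.add (.add (.var 14) (.var 14)) (.const 1))))))
    (.seq (.setReal 4 (.const 0) (.ofNat (.const 0))) (.seq (.forLoop 13 nE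
      (.cond (.and (.natLe (.get 6 iE) (.const 0)) (.realLe (.table (.var 16) iE) (.var 6)))
        (.seq (.setNat 6 iE (.const 1)) (.seq (.setNat 7 iE (.var 16))
          (.cond (.realLe (.var 4) (.table (.var 16) iE))
            (.setReal 4 (.const 0) (.table (.var 16) iE)) .skip))) .skip))
      (.seq (.setNat 8 (.var 16) (.const 1))
        (.setReal 3 (.const 0) (.add (.var 3) (.var 4))))))

/-- One branching step. -/
def levelP : Program :=
  .seq scanP (.cond (.natLe (.var 15) (.const 0)) .skip (.seq pickP ballP))

/-- Store the current clustering. -/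
def recordP : Program :=
  .seq (.forLoop 13 nE (.seq (.setNat 3 iE (.get 8 iE)) (.seq
    (.setNat 4 iE (.sub (.const 1) (.get 6 iE))) (.setNat 5 iE (.get 7 iE)))))
    (.setReal 2 (.const 0) (.var 3))

/-- Follow the decisions and store the result if it is a solution better than the best one. -/
def tryP : Program :=
  .seq resetP (.seq (.forLoop 14 kE levelP) (.seq scanP
    (.cond (.natLe (.var 15) (.const 0)) (.seq (.setNat 18 (.const 0) (.const 1))
      (.cond (.realLt (.var 3) (.var 2)) recordP .skip)) .skip)))

/-- The memory holds the data `D`. -/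
structure Env (D : Data) (s : State) : Prop where
  n_eq : s.nat 0 0 = D.n
  k_eq : s.nat 0 1 = D.k
  col_eq : s.nat 1 = D.col
  bnd_eq : s.nat 2 = D.bnd

variable {D : Data} {s s' : State} {p : Program}

theorem Env.frame (h : Env D s) (hf : Frame p s s') (h0 : p.writesNat 0 = false)
    (h1 : p.writesNat 1 = false) (h2 : p.writesNat 2 = false) : Env D s' where
  n_eq := by rw [hf.1 0 h0, h.n_eq]
  k_eq := by rw [hf.1 0 h0, h.k_eq]
  col_eq := by rw [hf.1 1 h1, h.col_eq]
  bnd_eq := by rw [hf.1 2 h2, h.bnd_eq]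

/-- The working arrays of the current clustering vanish outside of the points. -/
structure Tail (D : Data) (s : State) : Prop where
  cov : ∀ q, D.n ≤ q → s.nat 6 q = 0
  asg : ∀ q, D.n ≤ q → s.nat 7 q = 0
  isC : ∀ q, D.n ≤ q → s.nat 8 q = 0

/-- The memory holds the partial clustering `C`. -/
structure Holds (s : State) (C : Cover) : Prop where
  cov : s.nat 6 = C.cov
  asg : s.nat 7 = C.asg
  isC : s.nat 8 = C.isC
  cost : s.real 3 0 = C.cost

theorem Holds.congr {C : Cover} (h : Holds s C) (h6 : s'.nat 6 = s.nat 6)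
    (h7 : s'.nat 7 = s.nat 7) (h8 : s'.nat 8 = s.nat 8) (h3 : s'.real 3 = s.real 3) :
    Holds s' C :=
  ⟨h6.trans h.cov, h7.trans h.asg, h8.trans h.isC, by rw [h3, h.cost]⟩

theorem resetP_spec (hs : Env D s) (ht : Tail D s) :
    WP D.d resetP (D.n * 40 + 20) (fun s' => Holds s' D.start) s := by
  refine (WP.seq ((WP.forFrame (τ := 20) (fun j s' => s'.nat 6 = (fun q => if q < j then 0 else s.nat 6 q) ∧
    s'.nat 7 = (fun q => if q < j then q else s.nat 7 q) ∧
    s'.nat 8 = (fun q => if q < j then 0 else s.nat 8 q)) D.n ?_ rfl ?_ ?_).mono le_rfl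
      fun s' h => WP.of_exec (τ := 5) rfl (by decide) ?_)).mono ?_ fun _ h => h
  · intro s' hf
    simp only [NatExpr.eval]
    rw [hf.1 0 rfl, hs.n_eq]
  · simp [State.storeNat_nat_ne]
  · intro j s' hj hf hi h
    refine WP.of_exec rfl (by decide) ?_
    obtain ⟨h6, h7, h8⟩ := h
    simp only [Program.exec, NatExpr.eval, hi, State.storeNat_nat_self, ne_eq, Nat.reduceEqDiff, not_false_eq_true, State.storeNat_nat_ne]
    refine ⟨?_, ?_, ?_⟩
    · rw [h6, update_ite_lt _ _ _ rfl]
    · rw [h7, update_ite_lt _ _ _ rfl]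
    · rw [h8, update_ite_lt _ _ _ rfl]
  · obtain ⟨⟨h6, h7, h8⟩, -⟩ := h
    refine ⟨?_, ?_, ?_, ?_⟩
    · simp only [Program.exec, State.storeReal_nat, h6, Data.start]
      funext q; split_ifs with h; exacts [rfl, ht.cov q (by omega)]
    · simp only [Program.exec, State.storeReal_nat, h7, Data.start]
      funext q; split_ifs with h; exacts [rfl, ht.asg q (by omega)]
    · simp only [Program.exec, State.storeReal_nat, h8, Data.start]
      funext q; split_ifs with h; exacts [rfl, ht.isC q (by omega)]
    · simp [Program.exec, RealExpr.eval, NatExpr.eval, Data.start]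
  · simp only [NatExpr.steps]; omega

/-- The ranks and the violated class are known. -/
structure Scanned (D : Data) (s : State) (C : Cover) : Prop where
  holds : Holds s C
  rank : ∀ q < D.n, C.cov q = 0 → s.nat 9 q = D.rank C.cov q
  viol : s.nat 15 0 = D.viol C

/-- One counter per class holds the number of uncovered points seen so far, which is the rank of the
next one. Thus a single linear pass finds all ranks and a violated class. -/
theorem countP_spec {C : Cover} {j : ℕ} (hs : Env D s) (hC : Holds s C) (hi : s.nat 13 0 = j)
    (hj : j < D.n)
    (h10 : ∀ q < D.n, s.nat 10 (D.col q) =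
      ((Finset.range j).filter (fun x => C.cov x = 0 ∧ D.col x = D.col q)).card)
    (h9 : ∀ q < j, C.cov q = 0 → s.nat 9 q = D.rank C.cov q)
    (h15 : s.nat 15 0 = D.excessClass C.cov j) :
    WP D.d countP 60 (fun s' => (∀ q < D.n, s'.nat 10 (D.col q) =
      ((Finset.range (j + 1)).filter (fun x => C.cov x = 0 ∧ D.col x = D.col q)).card) ∧
      (∀ q < j + 1, C.cov q = 0 → s'.nat 9 q = D.rank C.cov q) ∧
      s'.nat 15 0 = D.excessClass C.cov (j + 1)) s := by
  refine WP.of_exec rfl (by decide) ?_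
  have hr : s.nat 10 (D.col j) = D.rank C.cov j := h10 j hj
  simp only [countP, Program.exec, Test.Holds, NatExpr.eval, hi, hC.cov, hs.col_eq, hs.bnd_eq,
    State.storeNat_nat_self, ne_eq, Nat.reduceEqDiff, not_false_eq_true,
    State.storeNat_nat_ne, Function.update_self, hr, Nat.le_zero]
  by_cases hc : C.cov j = 0
  · rw [if_pos hc]
    have key10 : ∀ q < D.n, Function.update (s.nat 10) (D.col j) (D.rank C.cov j + 1) (D.col q) =
        ((Finset.range (j + 1)).filter (fun x => C.cov x = 0 ∧ D.col x = D.col q)).card := by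
      intro q hq
      rw [Finset.range_add_one, Finset.filter_insert, Function.update_apply]
      by_cases hcol : D.col q = D.col j
      · rw [if_pos hcol, if_pos ⟨hc, hcol.symm⟩, Finset.card_insert_of_notMem (by simp), hcol]
        rfl
      · rw [if_neg hcol, if_neg (fun h => hcol h.2.symm), h10 q hq]
    have key9 : ∀ q < j + 1, C.cov q = 0 →
        Function.update (s.nat 9) j (D.rank C.cov j) q = D.rank C.cov q := by
      intro q hq hcq
      rw [Function.update_apply]
      split_ifs with h
      · rw [h]
      · exact h9 q (by omega) hcq
    by_cases hb : D.bnd (D.col j) ≤ D.rank C.cov j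
    · rw [if_pos hb]
      simp only [State.storeNat_nat_self, ne_eq, Nat.reduceEqDiff,
        not_false_eq_true, State.storeNat_nat_ne, Function.update_self]
      exact ⟨key10, key9, by rw [Data.excessClass, if_pos ⟨hc, hb⟩]⟩
    · rw [if_neg hb]
      simp only [State.storeNat_nat_self, ne_eq, Nat.reduceEqDiff,
        not_false_eq_true, State.storeNat_nat_ne]
      exact ⟨key10, key9, by rw [Data.excessClass, if_neg fun h => hb h.2, h15]⟩
  · rw [if_neg hc]
    refine ⟨fun q hq => ?_, fun q hq hcq => ?_, ?_⟩
    · rw [Finset.range_add_one, Finset.filter_insert, if_neg (fun h => hc h.1), h10 q hq]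
    · rcases Nat.lt_succ_iff_lt_or_eq.1 hq with h | rfl
      exacts [h9 q h hcq, absurd hcq hc]
    · rw [Data.excessClass, if_neg fun h => hc h.1, h15]

theorem scanP_spec {C : Cover} (hs : Env D s) (hC : Holds s C) :
    WP D.d scanP (D.n * 120 + 30) (fun s' => Scanned D s' C) s := by
  refine (WP.seq ((WP.forFrame (τ := 10) (fun j s' => ∀ q < j, s'.nat 10 (D.col q) = 0)
    D.n ?_ rfl (by simp) ?_).mono le_rfl fun s₁ h₁ => WP.seq ((WP.of_exec (τ := 3) rfl (by decide)
      (Q := fun s' => s'.nat 15 0 = 0 ∧ s'.nat 10 = s₁.nat 10) ?_).frame.mono le_rfl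
        fun s₂ h₂ => ((WP.forFrame (τ := 60) (fun j s' =>
    (∀ q < D.n, s'.nat 10 (D.col q) =
      ((Finset.range j).filter (fun x => C.cov x = 0 ∧ D.col x = D.col q)).card) ∧
      (∀ q < j, C.cov q = 0 → s'.nat 9 q = D.rank C.cov q) ∧
      s'.nat 15 0 = D.excessClass C.cov j) D.n ?_ rfl ?_ ?_).mono le_rfl fun s₃ h₃ => ?_)))).mono
        ?_ fun _ h => h
  · intro s' hf
    simp only [NatExpr.eval]
    rw [hf.1 0 rfl, hs.n_eq]
  · intro j s' hj hf hi h
    refine WP.of_exec rfl (by decide) ?_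
    simp only [Program.exec, NatExpr.eval, hi, State.storeNat_nat_self, ne_eq,
      Nat.reduceEqDiff, not_false_eq_true, State.storeNat_nat_ne,
      (hs.frame hf rfl rfl rfl).col_eq]
    intro q hq
    rw [Function.update_apply]
    split_ifs with h1
    · rfl
    · refine h q (lt_of_le_of_ne (by omega) ?_)
      rintro rfl
      exact h1 rfl
  · simp [Program.exec, NatExpr.eval, State.storeNat_nat_ne]
  · intro s' hf
    simp only [NatExpr.eval]
    rw [hf.1 0 rfl, h₂.2.1 0 rfl, h₁.2.1 0 rfl, hs.n_eq]
  · simp only [ne_eq, Nat.reduceEqDiff, not_false_eq_true, State.storeNat_nat_ne]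
    refine ⟨fun q hq => ?_, by simp, by rw [h₂.1.1]; rfl⟩
    rw [h₂.1.2, h₁.1 q hq]
    simp
  · intro j s' hj hf hi h
    have hs' := ((hs.frame h₁.2 rfl rfl rfl).frame h₂.2 rfl rfl rfl).frame hf rfl rfl rfl
    have hC' : Holds s' C := hC.congr
      (by rw [hf.1 6 rfl, h₂.2.1 6 rfl, h₁.2.1 6 rfl]) (by rw [hf.1 7 rfl, h₂.2.1 7 rfl, h₁.2.1 7 rfl])
      (by rw [hf.1 8 rfl, h₂.2.1 8 rfl, h₁.2.1 8 rfl]) (by rw [hf.2 3 rfl, h₂.2.2 3 rfl, h₁.2.2 3 rfl])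
    refine (countP_spec hs' hC' hi hj h.1 h.2.1 h.2.2).mono le_rfl fun s'' h'' => ?_
    simpa only [State.storeNat_nat_self, ne_eq, Nat.reduceEqDiff,
      not_false_eq_true, State.storeNat_nat_ne] using h''
  · refine ⟨hC.congr ?_ ?_ ?_ ?_, h₃.1.2.1, h₃.1.2.2⟩
    · rw [h₃.2.1 6 rfl, h₂.2.1 6 rfl, h₁.2.1 6 rfl]
    · rw [h₃.2.1 7 rfl, h₂.2.1 7 rfl, h₁.2.1 7 rfl]
    · rw [h₃.2.1 8 rfl, h₂.2.1 8 rfl, h₁.2.1 8 rfl]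
    · rw [h₃.2.2 3 rfl, h₂.2.2 3 rfl, h₁.2.2 3 rfl]
  · simp only [NatExpr.steps]; omega

theorem pickP_spec {C : Cover} {l a : ℕ} (hs : Env D s) (hC : Scanned D s C) (hl : s.nat 14 0 = l)
    (ha : s.nat 11 (l + l) = a) :
    WP D.d pickP (D.n * 80 + 30) (fun s' => s'.nat 16 0 = D.center C a) s := by
  refine (WP.seq ((WP.of_exec (τ := 3) rfl (by decide)
      (Q := fun s' => s'.nat 16 0 = 0) ?_).frame.mono le_rfl fun s₁ h₁ => ((WP.forFrame (τ := 60)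
      (fun j s' => s'.nat 16 0 = D.pick C.cov (D.viol C) a j) D.n ?_ rfl ?_ ?_).mono le_rfl
      fun s₂ h₂ => h₂.1))).mono ?_ fun _ h => h
  · simp [Program.exec, NatExpr.eval]
  · intro s' hf
    simp only [NatExpr.eval]
    rw [hf.1 0 rfl, h₁.2.1 0 rfl, hs.n_eq]
  · simpa only [ne_eq, Nat.reduceEqDiff, not_false_eq_true,
      State.storeNat_nat_ne, Data.pick] using h₁.1
  · intro j s' hj hf hi h
    refine WP.of_exec rfl (by decide) ?_
    have e6 : s'.nat 6 = C.cov := by rw [hf.1 6 rfl, h₁.2.1 6 rfl, hC.holds.cov]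
    have e1 : s'.nat 1 = D.col := by rw [hf.1 1 rfl, h₁.2.1 1 rfl, hs.col_eq]
    have e9 : s'.nat 9 = s.nat 9 := by rw [hf.1 9 rfl, h₁.2.1 9 rfl]
    have e11 : s'.nat 11 = s.nat 11 := by rw [hf.1 11 rfl, h₁.2.1 11 rfl]
    have e14 : s'.nat 14 = s.nat 14 := by rw [hf.1 14 rfl, h₁.2.1 14 rfl]
    have e15 : s'.nat 15 = s.nat 15 := by rw [hf.1 15 rfl, h₁.2.1 15 rfl]
    simp only [Program.exec, Test.Holds, NatExpr.eval, hi, e6, e1, e9, e11, e14, e15, hl, ha,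
      hC.viol, Nat.le_zero, ← Nat.le_antisymm_iff]
    rw [Data.pick]
    by_cases hc : C.cov j = 0
    · rw [hC.rank j hj hc]
      split_ifs with h1
      · simp [State.storeNat_nat_ne]
      · simpa [State.storeNat_nat_ne] using h
    · rw [if_neg (fun h => hc h.1), if_neg (fun h => hc h.1)]
      simpa [State.storeNat_nat_ne] using h
  · simp only [NatExpr.steps]; omega

end ColorfulRadii

/-! ### Correctness of one branching step and of one full sequence of decisions. -/

namespace ColorfulRadii
open RealRAM

variable {D : Data} {s s' : State} {p : Program}

open scoped Classical in
theorem ballP_spec {C : Cover} {l x : ℕ} {r : ℝ} (hs : Env D s) (hC : Holds s C)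
    (hl : s.nat 14 0 = l) (hx : s.nat 16 0 = x)
    (hr : s.real 1 0 * s.real 5 (s.nat 11 (l + l + 1)) = r) :
    WP D.d ballP (D.n * 80 + 60) (fun s' => Holds s' (D.addBall C x r)) s := by
  refine (WP.seq ((WP.of_exec (τ := 15) rfl (by decide)
      (Q := fun s' => s'.real 6 0 = r) ?_).frame.mono le_rfl fun s₁ h₁ =>
    WP.seq ((WP.of_exec (τ := 5) rfl (by decide)
      (Q := fun s' => s'.real 4 0 = 0) ?_).frame.mono le_rfl fun s₂ h₂ =>
    WP.seq ((WP.forFrame (τ := 60) (fun j s' =>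
      (∀ q, s'.nat 6 q = if q < j ∧ D.Hit C.cov x r q then 1 else C.cov q) ∧
      (∀ q, s'.nat 7 q = if q < j ∧ D.Hit C.cov x r q then x else C.asg q) ∧
      s'.real 4 0 = D.hitRadius C.cov x r j) D.n ?_ rfl ?_ ?_).mono le_rfl fun s₃ h₃ =>
    WP.of_exec (τ := 15) rfl (by decide) ?_)))).mono ?_ fun _ h => h
  · simp [Program.exec, RealExpr.eval, NatExpr.eval, hl, hr]
  · simp [Program.exec, RealExpr.eval, NatExpr.eval]
  · intro s' hf
    simp only [NatExpr.eval]
    rw [hf.1 0 rfl, h₂.2.1 0 rfl, h₁.2.1 0 rfl, hs.n_eq]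
  · simp only [ne_eq, Nat.reduceEqDiff, not_false_eq_true, State.storeNat_nat_ne]
    rw [h₂.2.1 6 rfl, h₁.2.1 6 rfl, h₂.2.1 7 rfl, h₁.2.1 7 rfl, hC.cov, hC.asg]
    exact ⟨by simp, by simp, h₂.1⟩
  · intro j s' hj hf hi h
    refine WP.of_exec rfl (by decide) ?_
    have e16 : s'.nat 16 0 = x := by rw [hf.1 16 rfl, h₂.2.1 16 rfl, h₁.2.1 16 rfl, hx]
    have e6 : s'.real 6 0 = r := by rw [hf.2 6 rfl, h₂.2.2 6 rfl, h₁.1]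
    obtain ⟨h6, h7, h4⟩ := h
    have h6j : s'.nat 6 j = C.cov j := by rw [h6]; simp
    simp only [Program.exec, Test.Holds, NatExpr.eval, RealExpr.eval, hi, e16, e6, h6j, h4,
      Nat.le_zero, ne_eq, Nat.reduceEqDiff, not_false_eq_true, State.storeNat_nat_ne,
      State.storeNat_real]
    -- `Hit` refers to the cover before the ball is added; the loop overwrites coverage, but only of
    -- points that it has already passed.
    have hsucc : ∀ q, (q < j + 1 ∧ D.Hit C.cov x r q) ↔
        (q = j ∧ D.Hit C.cov x r j) ∨ (q < j ∧ D.Hit C.cov x r q) := by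
      intro q
      constructor
      · rintro ⟨h1, h2⟩
        rcases Nat.lt_succ_iff_lt_or_eq.1 h1 with h3 | rfl
        exacts [Or.inr ⟨h3, h2⟩, Or.inl ⟨rfl, h2⟩]
      · rintro (⟨rfl, h⟩ | ⟨h1, h2⟩)
        exacts [⟨by omega, h⟩, ⟨by omega, h2⟩]
    rw [Data.hitRadius]
    by_cases hh : D.Hit C.cov x r j
    · have key6 : ∀ q, Function.update (s'.nat 6) j 1 q =
          if q < j + 1 ∧ D.Hit C.cov x r q then 1 else C.cov q := by
        intro q
        simp only [Function.update_apply, hsucc]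
        by_cases hq : q = j
        · simp [hq, hh]
        · simp [hq, h6]
      have key7 : ∀ q, Function.update (s'.nat 7) j x q =
          if q < j + 1 ∧ D.Hit C.cov x r q then x else C.asg q := by
        intro q
        simp only [Function.update_apply, hsucc]
        by_cases hq : q = j
        · simp [hq, hh]
        · simp [hq, h7]
      rw [if_pos hh, if_pos (c := C.cov j = 0 ∧ D.d x j ≤ r) hh]
      split_ifs with h5
      · rw [max_eq_right h5]
        simp only [ne_eq, Nat.reduceEqDiff, not_false_eq_true, State.storeNat_nat_ne,
          State.storeNat_nat_self, State.storeNat_real, State.storeReal_nat,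
          State.storeReal_real_self, Function.update_self]
        exact ⟨key6, key7, trivial⟩
      · rw [max_eq_left (not_le.1 h5).le]
        simp only [ne_eq, Nat.reduceEqDiff, not_false_eq_true, State.storeNat_nat_ne,
          State.storeNat_nat_self, State.storeNat_real]
        exact ⟨key6, key7, h4⟩
    · have key : ∀ q, (q < j + 1 ∧ D.Hit C.cov x r q) ↔ (q < j ∧ D.Hit C.cov x r q) := by
        intro q
        rw [hsucc]
        simp [hh]
      rw [if_neg hh, if_neg (c := C.cov j = 0 ∧ D.d x j ≤ r) hh]
      simp only [key]
      exact ⟨h6, h7, h4⟩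
  · have e16 : s₃.nat 16 0 = x := by rw [h₃.2.1 16 rfl, h₂.2.1 16 rfl, h₁.2.1 16 rfl, hx]
    have e8 : s₃.nat 8 = C.isC := by rw [h₃.2.1 8 rfl, h₂.2.1 8 rfl, h₁.2.1 8 rfl, hC.isC]
    have e3 : s₃.real 3 0 = C.cost := by rw [h₃.2.2 3 rfl, h₂.2.2 3 rfl, h₁.2.2 3 rfl, hC.cost]
    obtain ⟨⟨h6, h7, h4⟩, -⟩ := h₃
    constructor
    · simp only [Program.exec, NatExpr.eval, State.storeReal_nat, ne_eq, Nat.reduceEqDiff,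
        not_false_eq_true, State.storeNat_nat_ne]
      funext q
      rw [h6, Data.addBall]
    · simp only [Program.exec, NatExpr.eval, State.storeReal_nat, ne_eq, Nat.reduceEqDiff,
        not_false_eq_true, State.storeNat_nat_ne]
      funext q
      rw [h7, Data.addBall]
    · simp only [Program.exec, NatExpr.eval, State.storeReal_nat, State.storeNat_nat_self, e16, e8,
        Data.addBall]
    · simp only [Program.exec, NatExpr.eval, RealExpr.eval, State.storeReal_real_self,
        Function.update_self, State.storeNat_real, e3, h4, Data.addBall]
  · simp only [NatExpr.steps]; omega

theorem levelP_spec {C : Cover} {l : ℕ} (hs : Env D s) (hC : Holds s C) (hl : s.nat 14 0 = l) :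
    WP D.d levelP (D.n * 280 + 130) (fun s' => Holds s' (D.step C (s.nat 11 (l + l))
      (s.real 1 0 * s.real 5 (s.nat 11 (l + l + 1))))) s := by
  refine (WP.seq ((scanP_spec hs hC).frame.mono le_rfl fun s₁ h₁ => WP.cond
    (τ := D.n * 160 + 90) (fun hb => WP.of_exec rfl ?_ ?_) fun hb => ?_)).mono ?_ fun _ h => h
  · simp [Program.maxSteps]
  · simp only [Test.Holds, NatExpr.eval, h₁.1.viol, Nat.le_zero] at hb
    rw [Data.step, if_pos hb]
    exact h₁.1.holds
  · simp only [Test.Holds, NatExpr.eval, h₁.1.viol, Nat.le_zero] at hb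
    have hs₁ : Env D s₁ := hs.frame h₁.2 rfl rfl rfl
    have hl₁ : s₁.nat 14 0 = l := by rw [h₁.2.1 14 rfl, hl]
    rw [Data.step, if_neg hb]
    refine (WP.seq ((pickP_spec hs₁ h₁.1 hl₁ rfl).frame.mono le_rfl fun s₂ h₂ =>
      (ballP_spec (hs₁.frame h₂.2 rfl rfl rfl) (h₁.1.holds.congr (h₂.2.1 6 rfl) (h₂.2.1 7 rfl)
        (h₂.2.1 8 rfl) (h₂.2.2 3 rfl)) (by rw [h₂.2.1 14 rfl, hl₁]) h₂.1 rfl).mono le_rfl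
          fun s₃ h₃ => ?_)).mono (by omega) fun _ h => h
    rw [h₂.2.1 11 rfl, h₁.2.1 11 rfl, h₂.2.2 1 rfl, h₁.2.2 1 rfl, h₂.2.2 5 rfl,
      h₁.2.2 5 rfl] at h₃
    exact h₃
  · simp only [Test.steps, NatExpr.steps]; omega

theorem recordP_spec (hs : Env D s) :
    WP D.d recordP (D.n * 50 + 20) (fun s' => (∀ q < D.n, s'.nat 3 q = s.nat 8 q ∧
      s'.nat 4 q = 1 - s.nat 6 q ∧ s'.nat 5 q = s.nat 7 q) ∧ s'.real 2 0 = s.real 3 0) s := by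
  refine (WP.seq ((WP.forFrame (τ := 30) (fun j s' => ∀ q < j, s'.nat 3 q = s.nat 8 q ∧
      s'.nat 4 q = 1 - s.nat 6 q ∧ s'.nat 5 q = s.nat 7 q) D.n ?_ rfl (by simp) ?_).mono le_rfl
      fun s₁ h₁ => WP.of_exec (τ := 5) rfl (by decide) ?_)).mono ?_ fun _ h => h
  · intro s' hf
    simp only [NatExpr.eval]
    rw [hf.1 0 rfl, hs.n_eq]
  · intro j s' hj hf hi h
    refine WP.of_exec rfl (by decide) ?_
    simp only [Program.exec, NatExpr.eval, hi, ne_eq, Nat.reduceEqDiff, not_false_eq_true,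
      State.storeNat_nat_ne, State.storeNat_nat_self]
    rw [hf.1 8 rfl, hf.1 6 rfl, hf.1 7 rfl]
    intro q hq
    rcases Nat.lt_succ_iff_lt_or_eq.1 hq with h1 | rfl
    · rw [Function.update_of_ne h1.ne, Function.update_of_ne h1.ne, Function.update_of_ne h1.ne]
      exact h q h1
    · simp
  · refine ⟨h₁.1, ?_⟩
    simp [Program.exec, RealExpr.eval, NatExpr.eval, h₁.2.2 3 rfl]
  · simp only [NatExpr.steps]; omega

/-- The output arrays hold a solution, up to missing centers. -/
structure Solved (D : Data) (s : State) : Prop where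
  card_le : ((Finset.range D.n).filter (fun q => s.nat 3 q = 1)).card ≤ D.k
  out_le : ∀ c, ((Finset.range D.n).filter (fun q => s.nat 4 q = 1 ∧ D.col q = c)).card ≤ D.bnd c
  asg_out : ∀ q < D.n, s.nat 4 q = 1 → s.nat 5 q = q
  asg_mem : ∀ q < D.n, s.nat 4 q ≠ 1 → s.nat 5 q < D.n ∧ s.nat 3 (s.nat 5 q) = 1
  radius : ∃ ρ : ℕ → ℝ, (∀ c, 0 ≤ ρ c) ∧
    (∀ q < D.n, s.nat 4 q ≠ 1 → D.d (s.nat 5 q) q ≤ ρ (s.nat 5 q)) ∧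
    ∑ c ∈ Finset.range D.n, ρ c ≤ s.real 2 0
  scale : ∃ x < D.n, ∃ y < D.n, D.d x y ≤ s.real 2 0 ∧ s.real 2 0 ≤ D.k * D.d x y

theorem Solved.congr (h : Solved D s) (h3 : s'.nat 3 = s.nat 3) (h4 : s'.nat 4 = s.nat 4)
    (h5 : s'.nat 5 = s.nat 5) (h2 : s'.real 2 = s.real 2) : Solved D s' := by
  constructor
  · rw [h3]; exact h.card_le
  · rw [h4]; exact h.out_le
  · rw [h4, h5]; exact h.asg_out
  · rw [h3, h4, h5]; exact h.asg_mem
  · rw [h2, h4, h5]; exact h.radius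
  · rw [h2]; exact h.scale

/-- The uncovered points become the outliers; this is legal because no class is in excess. -/
theorem Solved.of_sound {C : Cover} {r : ℝ} (hC : D.Sound C D.k r) (hv : D.viol C = 0)
    (h : ∀ q < D.n, s.nat 3 q = C.isC q ∧ s.nat 4 q = 1 - C.cov q ∧ s.nat 5 q = C.asg q)
    (hb : s.real 2 0 = C.cost) : Solved D s := by
  have hcov : ∀ q < D.n, s.nat 4 q ≠ 1 → C.cov q = 1 := by
    intro q hq h4
    rw [(h q hq).2.1] at h4
    have := hC.cov_le q
    omega
  constructor
  · refine le_of_eq_of_le (congrArg _ (Finset.filter_congr fun q hq => ?_)) hC.card_le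
    rw [(h q (by simpa using hq)).1]
  · intro c
    refine (Finset.card_le_card fun q hq => ?_).trans
      (Data.card_uncovered_le (Data.excessClass_eq_zero.1 hv) c)
    simp only [Finset.mem_filter, Finset.mem_range] at hq ⊢
    refine ⟨hq.1, ?_, hq.2.2⟩
    have := hq.2.1
    rw [(h q hq.1).2.1] at this
    omega
  · intro q hq h4
    rw [(h q hq).2.1] at h4
    rw [(h q hq).2.2, hC.asg_unc q hq (by omega)]
  · intro q hq h4
    obtain ⟨h1, h2, -⟩ := hC.asg_cov q hq (hcov q hq h4)
    rw [(h q hq).2.2, (h _ h1).1]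
    exact ⟨h1, h2⟩
  · obtain ⟨ρ, h0, h1, h2⟩ := hC.radius
    refine ⟨ρ, h0, fun q hq h4 => ?_, h2.trans hb.ge⟩
    rw [(h q hq).2.2]
    exact h1 q hq (hcov q hq h4)
  · rw [hb]
    exact hC.scale

/-- The outcome of following the decisions in memory. -/
abbrev outcome (D : Data) (s : State) : Cover :=
  D.run (fun g => s.real 1 0 * s.real 5 g) (s.nat 11) D.k

/-- The flag in array `18` is set whenever the decisions end in a solution, even if it does not beat
the stored one: lowering the scale needs existence, not improvement. -/
theorem tryP_spec {r : ℝ} (hD : D.Good) (hs : Env D s) (ht : Tail D s) (hS : Solved D s)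
    (hr : D.Sound (outcome D s) D.k r) :
    WP D.d tryP (D.n * D.k * 900) (fun s' => Tail D s' ∧ Solved D s' ∧
      s'.real 2 0 ≤ s.real 2 0 ∧
      (D.viol (outcome D s) = 0 → s'.nat 18 0 = 1 ∧ s'.real 2 0 ≤ (outcome D s).cost) ∧
      (D.viol (outcome D s) ≠ 0 → s'.nat 18 0 = s.nat 18 0)) s := by
  refine (WP.seq ((resetP_spec hs ht).frame.mono le_rfl fun s₁ h₁ =>
    WP.seq ((WP.forFrame (τ := D.n * 280 + 130) (fun j s' => Holds s' (D.run (fun g => s.real 1 0 * s.real 5 g)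
      (s.nat 11) j)) D.k ?_ rfl ?_ ?_).mono le_rfl fun s₂ h₂ =>
    WP.seq ((scanP_spec (C := outcome D s) ?_ h₂.1).frame.mono le_rfl fun s₃ h₃ => WP.cond
    (τ := D.n * 50 + 40) (fun hb => ?_) fun hb => WP.of_exec rfl ?_ ?_)))).mono ?_ fun _ h => h
  · intro s' hf
    simp only [NatExpr.eval]
    rw [hf.1 0 rfl, h₁.2.1 0 rfl, hs.k_eq]
  · exact h₁.1.congr (State.storeNat_nat_ne _ _ _ _ (by decide))
      (State.storeNat_nat_ne _ _ _ _ (by decide)) (State.storeNat_nat_ne _ _ _ _ (by decide)) rfl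
  · intro j s' hj hf hi h
    refine (levelP_spec ((hs.frame h₁.2 rfl rfl rfl).frame hf rfl rfl rfl) h hi).mono le_rfl
      fun s'' h'' => ?_
    rw [hf.1 11 rfl, h₁.2.1 11 rfl, hf.2 1 rfl, h₁.2.2 1 rfl, hf.2 5 rfl, h₁.2.2 5 rfl] at h''
    exact h''.congr (State.storeNat_nat_ne _ _ _ _ (by decide))
      (State.storeNat_nat_ne _ _ _ _ (by decide)) (State.storeNat_nat_ne _ _ _ _ (by decide)) rfl
  · exact (hs.frame h₁.2 rfl rfl rfl).frame h₂.2 rfl rfl rfl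
  rotate_right
  · simp only [Test.steps, NatExpr.steps]
    have h1 := hD.one_le_k
    have h2 := hD.one_le_k.trans hD.k_le_n
    have h3 : D.n ≤ D.n * D.k := Nat.le_mul_of_pos_right _ h1
    have h4 : D.k ≤ D.n * D.k := Nat.le_mul_of_pos_left _ h2
    have h5 : D.k * (D.n * 280 + 130 + (1 + 1 + 11)) = D.n * D.k * 280 + D.k * 143 := by ring
    omega
  all_goals
    have hs₃ : Env D s₃ :=
      ((hs.frame h₁.2 rfl rfl rfl).frame h₂.2 rfl rfl rfl).frame h₃.2 rfl rfl rfl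
    have e3 : s₃.nat 3 = s.nat 3 := by rw [h₃.2.1 3 rfl, h₂.2.1 3 rfl, h₁.2.1 3 rfl]
    have e4 : s₃.nat 4 = s.nat 4 := by rw [h₃.2.1 4 rfl, h₂.2.1 4 rfl, h₁.2.1 4 rfl]
    have e5 : s₃.nat 5 = s.nat 5 := by rw [h₃.2.1 5 rfl, h₂.2.1 5 rfl, h₁.2.1 5 rfl]
    have e18 : s₃.nat 18 = s.nat 18 := by rw [h₃.2.1 18 rfl, h₂.2.1 18 rfl, h₁.2.1 18 rfl]
    have e2 : s₃.real 2 = s.real 2 := by rw [h₃.2.2 2 rfl, h₂.2.2 2 rfl, h₁.2.2 2 rfl]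
    have htail : ∀ s' : State, s'.nat 6 = s₃.nat 6 → s'.nat 7 = s₃.nat 7 → s'.nat 8 = s₃.nat 8 →
        Tail D s' := fun s' h6 h7 h8 => by
      refine ⟨?_, ?_, ?_⟩
      · rw [h6, h₃.1.holds.cov]; exact hr.cov_tail
      · rw [h7, h₃.1.holds.asg]; exact hr.asg_tail
      · rw [h8, h₃.1.holds.isC]; exact hr.isC_tail
    simp only [Test.Holds, NatExpr.eval, h₃.1.viol, Nat.le_zero] at hb
  · refine (WP.seq ((WP.of_exec (τ := 3) rfl (by decide)
      (Q := fun s' => s' = s₃.storeNat 18 0 1) rfl).mono le_rfl fun s₄ h₄ => WP.cond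
      (τ := D.n * 50 + 20) (fun hc => ?_) fun hc => WP.of_exec rfl ?_ ?_)).mono
        (by simp only [Test.steps, RealExpr.steps, NatExpr.steps]; omega) fun _ h => h
    · have hs₄ : Env D s₄ := by
        rw [h₄]
        constructor <;> simp only [ne_eq, Nat.reduceEqDiff, not_false_eq_true,
          State.storeNat_nat_ne, OfNat.zero_ne_ofNat, OfNat.one_ne_ofNat]
        exacts [hs₃.n_eq, hs₃.k_eq, hs₃.col_eq, hs₃.bnd_eq]
      refine (recordP_spec hs₄).frame.mono le_rfl fun s₅ h₅ => ?_
      have e6 : s₄.nat 6 = s₃.nat 6 := by rw [h₄, State.storeNat_nat_ne _ _ _ _ (by decide)]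
      have e7 : s₄.nat 7 = s₃.nat 7 := by rw [h₄, State.storeNat_nat_ne _ _ _ _ (by decide)]
      have e8 : s₄.nat 8 = s₃.nat 8 := by rw [h₄, State.storeNat_nat_ne _ _ _ _ (by decide)]
      have ecost : s₅.real 2 0 = (outcome D s).cost := by
        rw [h₅.1.2, h₄, State.storeNat_real, h₃.1.holds.cost]
      refine ⟨htail _ ?_ ?_ ?_, Solved.of_sound hr hb ?_ ecost, ?_, fun _ => ⟨?_, ecost.le⟩,
        fun h => absurd hb h⟩
      · rw [h₅.2.1 6 rfl, e6]
      · rw [h₅.2.1 7 rfl, e7]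
      · rw [h₅.2.1 8 rfl, e8]
      · rw [← h₃.1.holds.cov, ← h₃.1.holds.isC, ← h₃.1.holds.asg, ← e6, ← e7, ← e8]
        exact h₅.1.1
      · rw [ecost]
        simp only [Test.Holds, RealExpr.eval, NatExpr.eval, h₄, State.storeNat_real, e2,
          h₃.1.holds.cost, not_le] at hc
        exact hc.le
      · rw [h₅.2.1 18 rfl, h₄]; simp
    · simp [Program.maxSteps]
    · rw [Program.exec, h₄]
      refine ⟨htail _ ?_ ?_ ?_, hS.congr ?_ ?_ ?_ ?_, ?_, fun _ => ⟨?_, ?_⟩,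
        fun h => absurd hb h⟩
      · rw [State.storeNat_nat_ne _ _ _ _ (by decide)]
      · rw [State.storeNat_nat_ne _ _ _ _ (by decide)]
      · rw [State.storeNat_nat_ne _ _ _ _ (by decide)]
      · rw [State.storeNat_nat_ne _ _ _ _ (by decide), e3]
      · rw [State.storeNat_nat_ne _ _ _ _ (by decide), e4]
      · rw [State.storeNat_nat_ne _ _ _ _ (by decide), e5]
      · rw [State.storeNat_real, e2]
      · rw [State.storeNat_real, e2]
      · simp
      · simp only [Test.Holds, RealExpr.eval, NatExpr.eval, h₄, State.storeNat_real,
          h₃.1.holds.cost, not_le, not_lt] at hc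
        exact hc
  · simp [Program.maxSteps]
  · exact ⟨htail _ rfl rfl rfl, hS.congr e3 e4 e5 e2, by rw [Program.exec, e2],
      fun h => absurd h hb, fun _ => by rw [Program.exec, e18]⟩

end ColorfulRadii

/-! ### Enumeration of all decisions with a prescribed first point. -/

namespace ColorfulRadii
open RealRAM

variable {D : Data} {s s' : State} {p : Program}

/-- The current digit position. -/
abbrev posE : NatExpr := .var 22

/-- Pass to the next sequence of decisions. -/
def incP : Program :=
  .seq (.setNat 22 (.const 0) (.const 1)) (.seq (.loop (.and (.natLt posE (.add kE kE))
      (.natLe (.get 12 posE) (.add (.get 11 posE) (.const 1))))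
    (.seq (.setNat 11 posE (.const 0)) (.setNat 22 (.const 0) (.add posE (.const 1)))))
    (.cond (.natLe (.add kE kE) posE) (.setNat 19 (.const 0) (.const 1))
      (.setNat 11 posE (.add (.get 11 posE) (.const 1)))))

/-- Try all sequences of decisions with the first one prescribed. -/
def searchP : Program :=
  .seq (.setNat 18 (.const 0) (.const 0)) (.seq (.setNat 19 (.const 0) (.const 0))
    (.loop (.natLe (.var 19) (.const 0)) (.seq tryP incP)))

/-- An increment with carry that starts at position `1`, so the prescribed digit `0` survives. On
overflow all other digits are back at `0`, which leaves the memory ready for the next search. -/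
theorem incP_spec (hD : D.Good) (hs : Env D s) {B : ℕ → ℕ}
    (hB : ∀ i, 1 ≤ i → i < D.k + D.k → s.nat 12 i = B i)
    (hlt : ∀ i, 1 ≤ i → i < D.k + D.k → s.nat 11 i < B i) :
    WP D.d incP (D.k * 200) (fun s' => s'.nat 11 0 = s.nat 11 0 ∧
      ((s'.nat 19 0 = s.nat 19 0 ∧ (∀ i, 1 ≤ i → i < D.k + D.k → s'.nat 11 i < B i) ∧
        Data.value B (s'.nat 11) (D.k + D.k) = Data.value B (s.nat 11) (D.k + D.k) + 1) ∨
      (s'.nat 19 0 = 1 ∧ (∀ i, 1 ≤ i → i < D.k + D.k → s'.nat 11 i = 0) ∧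
        Data.value B (s.nat 11) (D.k + D.k) + 1 = Data.weight B (D.k + D.k)))) s := by
  have hk := hD.one_le_k
  refine (WP.seq ((WP.of_exec (τ := 3) rfl (by decide)
      (Q := fun s' => s'.nat 22 0 = 1) (by simp [Program.exec, NatExpr.eval])).frame.mono le_rfl
      fun s₁ h₁ => WP.seq ((WP.loopFrame (τ := 20) (fun j s' => s'.nat 22 0 = j + 1 ∧
        j + 1 ≤ D.k + D.k ∧
        (∀ i, s'.nat 11 i = if 1 ≤ i ∧ i < j + 1 then 0 else s.nat 11 i) ∧
        ∀ i, 1 ≤ i → i < j + 1 → s.nat 11 i + 1 = B i) (D.k + D.k) ?_ ?_ ?_).mono le_rfl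
      fun s₂ h₂ => WP.cond (τ := 10) (fun hb => WP.of_exec rfl (by decide) ?_)
        fun hb => WP.of_exec rfl (by decide) ?_))).mono ?_ fun _ h => h
  · refine ⟨h₁.1, by omega, fun i => ?_, fun i h h' => by omega⟩
    rw [h₁.2.1 11 rfl, if_neg (by omega)]
  · rintro j s' hf ⟨h22, hj, -⟩ hb
    simp only [Test.Holds, NatExpr.eval, h22] at hb
    rw [hf.1 0 rfl, h₁.2.1 0 rfl, hs.k_eq] at hb
    omega
  · rintro j s' hf ⟨h22, hj, h11, hmax⟩ hb
    refine WP.of_exec rfl (by decide) ?_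
    simp only [Test.Holds, NatExpr.eval, h22] at hb
    rw [hf.1 0 rfl, h₁.2.1 0 rfl, hs.k_eq, hf.1 12 rfl, h₁.2.1 12 rfl, h11 (j + 1),
      if_neg (by omega), hB _ (by omega) (by omega)] at hb
    have hl := hlt (j + 1) (by omega) (by omega)
    simp only [Program.exec, NatExpr.eval, h22, ne_eq, Nat.reduceEqDiff, not_false_eq_true,
      State.storeNat_nat_ne, State.storeNat_nat_self, Function.update_self]
    refine ⟨trivial, by omega, fun i => ?_, fun i hi hi' => ?_⟩
    · rw [Function.update_apply, h11]
      by_cases hij : i = j + 1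
      · rw [if_pos hij, if_pos (by omega)]
      · rw [if_neg hij]
        by_cases hlt' : 1 ≤ i ∧ i < j + 1
        · rw [if_pos hlt', if_pos (by omega)]
        · rw [if_neg hlt', if_neg (by omega)]
    · rcases Nat.lt_succ_iff_lt_or_eq.1 hi' with h | rfl
      · exact hmax i hi h
      · omega
  · obtain ⟨j, ⟨h22, hj, h11, hmax⟩, -, hf⟩ := h₂
    simp only [Test.Holds, NatExpr.eval, h22] at hb
    rw [hf.1 0 rfl, h₁.2.1 0 rfl, hs.k_eq] at hb
    have hjk : D.k + D.k = j + 1 := by omega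
    simp only [Program.exec, NatExpr.eval, ne_eq, Nat.reduceEqDiff, not_false_eq_true,
      State.storeNat_nat_ne, State.storeNat_nat_self, Function.update_self]
    refine ⟨by rw [h11]; simp, Or.inr ⟨trivial, fun i hi hi' => ?_, ?_⟩⟩
    · rw [h11, if_pos ⟨hi, by omega⟩]
    · rw [hjk]
      exact Data.value_of_maximal (by omega) hmax
  · obtain ⟨j, ⟨h22, hj, h11, hmax⟩, hb', hf⟩ := h₂
    simp only [Test.Holds, NatExpr.eval, h22] at hb hb'
    rw [hf.1 0 rfl, h₁.2.1 0 rfl, hs.k_eq] at hb hb'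
    have hjk : j + 1 < D.k + D.k := by omega
    have h11j : s₂.nat 11 (j + 1) = s.nat 11 (j + 1) := by rw [h11, if_neg (by omega)]
    rw [hf.1 12 rfl, h₁.2.1 12 rfl, h11j, hB _ (by omega) hjk] at hb'
    have hval : ∀ i, Function.update (s₂.nat 11) (j + 1) (s.nat 11 (j + 1) + 1) i =
        if i = j + 1 then s.nat 11 (j + 1) + 1 else
          if 1 ≤ i ∧ i < j + 1 then 0 else s.nat 11 i := by
      intro i
      rw [Function.update_apply, h11]
    simp only [Program.exec, NatExpr.eval, ne_eq, Nat.reduceEqDiff, not_false_eq_true,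
      State.storeNat_nat_ne, State.storeNat_nat_self, h22, h11j]
    refine ⟨?_, Or.inl ⟨?_, fun i hi hi' => ?_, ?_⟩⟩
    · rw [hval, if_neg (by omega), if_neg (by omega)]
    · rw [hf.1 19 rfl, h₁.2.1 19 rfl]
    · rw [hval]
      split_ifs with h1 h2
      · rw [h1]; omega
      · exact (Nat.zero_le _).trans_lt (hlt i hi hi')
      · exact hlt i hi hi'
    · refine Data.value_increment (i := j + 1) (by omega) hjk hmax (fun i hi hi' => ?_) ?_
        fun i hi => ?_
      · rw [hval, if_neg (by omega), if_pos ⟨hi, hi'⟩]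
      · rw [hval, if_pos rfl]
      · rw [hval, if_neg (by omega), if_neg (by omega)]
  · simp only [Test.steps, NatExpr.steps]
    omega

/-- The memory is prepared for a search. -/
structure Ready (D : Data) (M G : ℕ) (s : State) : Prop where
  env : Env D s
  tail : Tail D s
  solved : Solved D s
  lim_eq : ∀ i, 1 ≤ i → i < D.k + D.k → s.nat 12 i = Data.lim M G i
  digit : ∀ i, 1 ≤ i → i < D.k + D.k → s.nat 11 i = 0
  mult : ∀ g < G, s.real 5 g = 2 * (2 / 7) ^ g
  nonneg : 0 ≤ s.real 1 0

/-- The number of sequences of decisions with the first one prescribed. -/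
abbrev searchSize (D : Data) (M G : ℕ) : ℕ := M ^ (D.k - 1) * G ^ D.k

/-- The result of a search with the decision `a` prescribed and radii at most `R`. -/
structure Searched (D : Data) (M G : ℕ) (a : ℕ) (R : ℝ) (s s' : State) : Prop where
  ready : Ready D M G s'
  radius_eq : s'.real 1 0 = R
  first_eq : s'.nat 11 0 = a
  best_le : s'.real 2 0 ≤ s.real 2 0
  success : s'.nat 18 0 = 1 → ∃ C, D.Sound C D.k (2 * R) ∧ D.viol C = 0 ∧ s'.real 2 0 ≤ C.cost
  complete : ∀ S : D.Clustering, (∀ c ∈ S.C, S.ρ c ≤ R) →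
    (D.viol D.start ≠ 0 → D.center D.start a ∉ S.out) →
    s'.nat 18 0 = 1 ∧ s'.real 2 0 ≤ 7 * S.cost + D.k * (2 * (R * (2 / 7) ^ (G - 1)))

/-- The invariant says that all valid sequences numbered below the current one have been tried.
Completeness is then `exists_run` applied to the sequence it provides. -/
theorem searchP_spec {M G a : ℕ} {R : ℝ} (hD : D.Good) (hs : Ready D M G s) (hG : 0 < G)
    (hM : ∀ p < D.n, D.bnd (D.col p) < M) (ha : s.nat 11 0 = a) (hR : s.real 1 0 = R) :
    WP D.d searchP (searchSize D M G * (D.n * D.k * 1110) + 20) (Searched D M G a R s) s := by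
  have hk := hD.one_le_k
  have hn : 0 < D.n := hk.trans hD.k_le_n
  have hM0 : 0 < M := (Nat.zero_le _).trans_lt (hM 0 hn)
  have hlim : ∀ i, 0 < Data.lim M G i := fun i => by
    rw [Data.lim]; split_ifs <;> assumption
  set rad : ℕ → ℝ := fun g => R * s.real 5 g with hrad
  have hrad' : ∀ g < G, rad g = 2 * (R * (2 / 7) ^ g) := fun g hg => by
    rw [hrad]; dsimp only; rw [hs.mult g hg]; ring
  have hR0 : 0 ≤ R := hR ▸ hs.nonneg
  let Valid : (ℕ → ℕ) → Prop := fun δ => ∀ i, 1 ≤ i → i < D.k + D.k → δ i < Data.lim M G i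
  have hsound : ∀ δ, Valid δ → D.Sound (D.run rad δ D.k) D.k (2 * R) := by
    intro δ hδ
    have hg : ∀ i < D.k, δ (i + i + 1) < G := fun i hi => by
      have := hδ (i + i + 1) (by omega) (by omega)
      rwa [Data.lim, if_neg (by omega)] at this
    refine .run hD (fun i hi => ?_) (fun i hi => ?_) (by positivity)
    · rw [hrad' _ (hg i hi)]; positivity
    · rw [hrad' _ (hg i hi)]
      have : (2 / 7 : ℝ) ^ δ (i + i + 1) ≤ 1 := pow_le_one₀ (by norm_num) (by norm_num)
      nlinarith
  let Val : (ℕ → ℕ) → ℕ := fun δ => Data.value (Data.lim M G) δ (D.k + D.k)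
  let Done : (ℕ → ℕ) → State → Prop := fun δ s' => D.viol (D.run rad δ D.k) = 0 →
    s'.nat 18 0 = 1 ∧ s'.real 2 0 ≤ (D.run rad δ D.k).cost
  let Inv : ℕ → State → Prop := fun v s' => Tail D s' ∧ Solved D s' ∧ s'.real 2 0 ≤ s.real 2 0 ∧
    s'.nat 11 0 = a ∧
    (s'.nat 18 0 = 1 → ∃ C, D.Sound C D.k (2 * R) ∧ D.viol C = 0 ∧ s'.real 2 0 ≤ C.cost) ∧
    ((s'.nat 19 0 = 0 ∧ Valid (s'.nat 11) ∧ Val (s'.nat 11) = v ∧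
      ∀ δ, δ 0 = a → Valid δ → Val δ < v → Done δ s') ∨
    (s'.nat 19 0 = 1 ∧ (∀ i, 1 ≤ i → i < D.k + D.k → s'.nat 11 i = 0) ∧
      ∀ δ, δ 0 = a → Valid δ → Done δ s'))
  refine (WP.seq ((WP.of_exec (τ := 3) rfl (by decide)
      (Q := fun s' => s'.nat 18 0 = 0) (by simp [Program.exec, NatExpr.eval])).frame.mono le_rfl
      fun s₁ h₁ => WP.seq ((WP.of_exec (τ := 3) rfl (by decide)
      (Q := fun s' => s'.nat 19 0 = 0) (by simp [Program.exec, NatExpr.eval])).frame.mono le_rfl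
      fun s₂ h₂ => ((WP.loopFrame (τ := D.n * D.k * 900 + D.k * 200) Inv (searchSize D M G)
        ?_ ?_ ?_).mono le_rfl fun s₃ h₃ => ?_)))).mono ?_ fun _ h => h
  · have e : ∀ b, b ≠ 18 → b ≠ 19 → s₂.nat b = s.nat b := fun b hb hb' => by
      rw [h₂.2.1 b (by simpa [Program.writesNat] using hb'),
        h₁.2.1 b (by simpa [Program.writesNat] using hb)]
    have er : ∀ b, s₂.real b = s.real b := fun b => by rw [h₂.2.2 b rfl, h₁.2.2 b rfl]
    refine ⟨⟨?_, ?_, ?_⟩, hs.solved.congr (e 3 (by decide) (by decide)) (e 4 (by decide) (by decide))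
      (e 5 (by decide) (by decide)) (er 2), by rw [er], by rw [e 11 (by decide) (by decide), ha],
      ?_, Or.inl ⟨h₂.1, ?_, ?_, fun δ _ _ h => absurd h (Nat.not_lt_zero _)⟩⟩
    · rw [e 6 (by decide) (by decide)]; exact hs.tail.cov
    · rw [e 7 (by decide) (by decide)]; exact hs.tail.asg
    · rw [e 8 (by decide) (by decide)]; exact hs.tail.isC
    · rw [h₂.2.1 18 rfl, h₁.1]; simp
    · intro i hi hi'
      rw [e 11 (by decide) (by decide), hs.digit i hi hi']
      exact hlim i
    · refine Finset.sum_eq_zero fun i hi => ?_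
      rw [Finset.mem_Ico] at hi
      rw [e 11 (by decide) (by decide), hs.digit i hi.1 hi.2, zero_mul]
  · rintro v s' - ⟨-, -, -, -, -, h⟩ hb
    simp only [Test.Holds, NatExpr.eval] at hb
    rcases h with ⟨-, hv, rfl, -⟩ | h
    · rw [searchSize, ← Data.weight_lim M G hk]
      exact Data.value_lt (by omega) hv
    · omega
  · rintro v s' hf ⟨htail, hsol, hbest, h0, hsuc, h⟩ hb
    simp only [Test.Holds, NatExpr.eval] at hb
    obtain ⟨h19, hv, hval, hdone⟩ := h.resolve_right fun h => by omega
    have henv : Env D s' := ((hs.env.frame h₁.2 rfl rfl rfl).frame h₂.2 rfl rfl rfl).frame hf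
      rfl rfl rfl
    have e12 : s'.nat 12 = s.nat 12 := by rw [hf.1 12 rfl, h₂.2.1 12 rfl, h₁.2.1 12 rfl]
    have e1 : s'.real 1 0 = R := by rw [hf.2 1 rfl, h₂.2.2 1 rfl, h₁.2.2 1 rfl, hR]
    have e5 : s'.real 5 = s.real 5 := by rw [hf.2 5 rfl, h₂.2.2 5 rfl, h₁.2.2 5 rfl]
    have hout : outcome D s' = D.run rad (s'.nat 11) D.k := by rw [outcome, e1, e5]
    refine WP.seq ((tryP_spec hD henv htail hsol (hout ▸ hsound _ hv)).frame.mono le_rfl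
      fun s₃ h₃ => (incP_spec hD (henv.frame h₃.2 rfl rfl rfl) (B := Data.lim M G) ?_ ?_).frame.mono
        le_rfl fun s₄ h₄ => ?_)
    · intro i hi hi'
      rw [h₃.2.1 12 rfl, e12, hs.lim_eq i hi hi']
    · rw [h₃.2.1 11 rfl]
      exact hv
    · obtain ⟨⟨htail₃, hsol₃, hbest₃, hs0, hs1⟩, hf₃⟩ := h₃
      rw [hout] at hs0 hs1
      obtain ⟨⟨h40, h4⟩, hf₄⟩ := h₄
      rw [hf₃.1 11 rfl] at h40 h4
      rw [hf₃.1 19 rfl] at h4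
      have e18 : s₄.nat 18 = s₃.nat 18 := hf₄.1 18 rfl
      have e2 : s₄.real 2 = s₃.real 2 := hf₄.2 2 rfl
      have hnew : ∀ δ, δ 0 = a → Valid δ → Val δ < v + 1 → Done δ s₄ := by
        intro δ hδ0 hδ hlt hviol
        rw [e18, e2]
        rcases Nat.lt_succ_iff_lt_or_eq.1 hlt with h5 | h5
        · obtain ⟨h6, h7⟩ := hdone δ hδ0 hδ h5 hviol
          refine ⟨?_, hbest₃.trans h7⟩
          by_cases h8 : D.viol (D.run rad (s'.nat 11) D.k) = 0
          · exact (hs0 h8).1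
          · rw [hs1 h8, h6]
        · have heq : D.run rad δ D.k = D.run rad (s'.nat 11) D.k := Data.run_congr fun i hi => by
            rcases Nat.eq_zero_or_pos i with rfl | hi0
            · rw [hδ0, h0]
            · exact Data.value_inj (by omega) hδ hv (h5.trans hval.symm) i hi0 hi
          rw [heq] at hviol ⊢
          exact hs0 hviol
      refine ⟨⟨?_, ?_, ?_⟩, hsol₃.congr (hf₄.1 3 rfl) (hf₄.1 4 rfl) (hf₄.1 5 rfl) e2,
        by rw [e2]; exact hbest₃.trans hbest, by rw [h40, h0], ?_, ?_⟩
      · rw [hf₄.1 6 rfl]; exact htail₃.cov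
      · rw [hf₄.1 7 rfl]; exact htail₃.asg
      · rw [hf₄.1 8 rfl]; exact htail₃.isC
      · rw [e18, e2]
        intro h5
        by_cases h8 : D.viol (D.run rad (s'.nat 11) D.k) = 0
        · exact ⟨_, hsound _ hv, h8, (hs0 h8).2⟩
        · obtain ⟨C, hC, hCv, hCb⟩ := hsuc (by rw [← hs1 h8, h5])
          exact ⟨C, hC, hCv, hbest₃.trans hCb⟩
      · rcases h4 with ⟨h5, h6, h7⟩ | ⟨h5, h6, h7⟩
        · exact Or.inl ⟨by rw [h5, h19], h6, by rw [← hval]; exact h7, hnew⟩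
        · refine Or.inr ⟨h5, h6, fun δ hδ0 hδ => hnew δ hδ0 hδ ?_⟩
          have h9 : Val δ < Data.weight (Data.lim M G) (D.k + D.k) := Data.value_lt (by omega) hδ
          rw [← h7] at h9
          rw [← hval]
          exact h9
  · obtain ⟨v, ⟨htail, hsol, hbest, h0, hsuc, h⟩, hb, hf⟩ := h₃
    simp only [Test.Holds, NatExpr.eval] at hb
    obtain ⟨-, hdig, hdone⟩ := h.resolve_left fun h => by omega
    have e1 : s₃.real 1 0 = R := by rw [hf.2 1 rfl, h₂.2.2 1 rfl, h₁.2.2 1 rfl, hR]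
    refine ⟨⟨((hs.env.frame h₁.2 rfl rfl rfl).frame h₂.2 rfl rfl rfl).frame hf rfl rfl rfl, htail,
      hsol, ?_, hdig, ?_, e1 ▸ hR0⟩, e1, h0, hbest, hsuc, fun S hS hSa => ?_⟩
    · rw [hf.1 12 rfl, h₂.2.1 12 rfl, h₁.2.1 12 rfl]
      exact hs.lim_eq
    · rw [hf.2 5 rfl, h₂.2.2 5 rfl, h₁.2.2 5 rfl]
      exact hs.mult
    · obtain ⟨δ, hδ0, hδ, hv, hc⟩ := Data.exists_run hD S hR0 hS hG hM rad hrad' hSa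
      obtain ⟨h1, h2⟩ := hdone δ hδ0 (fun i hi _ => hδ i hi) hv
      exact ⟨h1, h2.trans hc⟩
  · simp only [Test.steps, NatExpr.steps]
    have h3 : D.k ≤ D.n * D.k := Nat.le_mul_of_pos_left _ hn
    have h4 : 1 ≤ D.n * D.k := hk.trans h3
    have h5 : searchSize D M G * (D.n * D.k * 900 + D.k * 200 + (1 + 1 + 1 + 1 + 1)) ≤
        searchSize D M G * (D.n * D.k * 1110) := Nat.mul_le_mul_left _ (by omega)
    omega

end ColorfulRadii

/-! ### Finding the right scale for the largest radius. -/

namespace ColorfulRadii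
open RealRAM

variable {D : Data} {s s' : State} {p : Program}

/-- Lower the largest radius until no search succeeds. -/
def lowerP : Program :=
  .loop (.natLt (.var 11) (.var 20)) (.seq searchP
    (.cond (.and (.natEq (.var 18) (.const 1)) (.realLt (.ofNat (.const 0)) (.var 2)))
      (.cond (.realLe (.var 2) (.div (.var 1) (.ofNat (.const 2))))
        (.setReal 1 (.const 0) (.var 2))
        (.setReal 1 (.const 0) (.div (.var 1) (.ofNat (.const 2)))))
      (.setNat 11 (.const 0) (.add (.var 11) (.const 1)))))

/-- Raise the largest radius until it exceeds the best cost. -/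
def raiseP : Program :=
  .loop (.and (.realLt (.ofNat (.const 0)) (.var 2)) (.realLe (.var 1) (.add (.var 2) (.var 2))))
    (.seq (.forLoop 11 (.var 20) searchP) (.setReal 1 (.const 0) (.add (.var 1) (.var 1))))

theorem Ready.congr {M G : ℕ} (h : Ready D M G s) (hn : ∀ a, a ≠ 11 → s'.nat a = s.nat a)
    (hd : ∀ i, 1 ≤ i → s'.nat 11 i = s.nat 11 i) (h2 : s'.real 2 = s.real 2)
    (h5 : s'.real 5 = s.real 5) (h1 : 0 ≤ s'.real 1 0) : Ready D M G s' where
  env := ⟨by rw [hn 0 (by decide), h.env.n_eq], by rw [hn 0 (by decide), h.env.k_eq],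
    by rw [hn 1 (by decide), h.env.col_eq], by rw [hn 2 (by decide), h.env.bnd_eq]⟩
  tail := ⟨by rw [hn 6 (by decide)]; exact h.tail.cov, by rw [hn 7 (by decide)]; exact h.tail.asg,
    by rw [hn 8 (by decide)]; exact h.tail.isC⟩
  solved := h.solved.congr (hn 3 (by decide)) (hn 4 (by decide)) (hn 5 (by decide)) h2
  lim_eq := by rw [hn 12 (by decide)]; exact h.lim_eq
  digit := fun i hi hi' => by rw [hd i hi, h.digit i hi hi']
  mult := by rw [h5]; exact h.mult
  nonneg := h1

theorem Data.Clustering.le_cost (S : D.Clustering) {c : ℕ} (hc : c ∈ S.C) : S.ρ c ≤ S.cost :=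
  Finset.single_le_sum (f := S.ρ) S.ρ_nonneg hc

theorem Data.Clustering.cost_nonneg (S : D.Clustering) : 0 ≤ S.cost := Finset.sum_nonneg S.ρ_nonneg

/-- The outcome of `lowerP`. -/
structure Lowered (D : Data) (M G : ℕ) (s' : State) : Prop where
  ready : Ready D M G s'
  M_eq : s'.nat 20 0 = M
  best_le : s'.real 2 0 ≤ 4 * D.k * s'.real 1 0
  lt_radius : ∀ S : D.Clustering, S.cost < s'.real 2 0 → ∃ c ∈ S.C, s'.real 1 0 < S.ρ c

/-- The invariant of `lowerP` after `j` searches. -/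
def LowerInv (D : Data) (M G m j : ℕ) (s : State) : Prop :=
  Ready D M G s ∧ s.real 2 0 ≤ 4 * D.k * s.real 1 0 ∧ s.nat 11 0 ≤ M ∧
    (∃ u, j = s.nat 11 0 + u ∧ u ≤ (D.k + 5) * (D.k + m + 1) ∧
      (0 < s.real 1 0 → D.Scale m u (s.real 1 0))) ∧
    ∀ S : D.Clustering, S.cost < s.real 2 0 → ∀ a < s.nat 11 0,
      (D.viol D.start ≠ 0 → D.center D.start a ∉ S.out) → ∃ c ∈ S.C, s.real 1 0 < S.ρ c

/-- Each search either advances the prescribed first point, at most `M` times, or lowers the radius,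
which the potential `Scale` bounds. A discarded first point stays discarded, since lowering the
radius only weakens the claim made about it. -/
theorem lowerP_spec {M G ω : ℕ} (hD : D.Good) (hs : Ready D M G s) (hG : 0 < G)
    (hM : ∀ p < D.n, D.bnd (D.col p) < M) (hcol : ∀ p < D.n, D.col p < ω)
    (ha : s.nat 11 0 = 0) (hM' : s.nat 20 0 = M) (hb : s.real 2 0 = s.real 1 0) :
    WP D.d lowerP ((M + (D.k + 5) * (D.k + ∑ c ∈ Finset.range ω, D.bnd c + 1)) *
      (searchSize D M G * (D.n * D.k * 1110) + 100) + 10) (Lowered D M G) s := by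
  set m := ∑ c ∈ Finset.range ω, D.bnd c with hm
  have hk : (1 : ℝ) ≤ D.k := by exact_mod_cast hD.one_le_k
  have hn : 0 < D.n := hD.one_le_k.trans hD.k_le_n
  have hM0 : 0 < M := (Nat.zero_le _).trans_lt (hM 0 hn)
  refine (WP.loopFrame (τ := searchSize D M G * (D.n * D.k * 1110) + 90)
    (LowerInv D M G m)
    (M + (D.k + 5) * (D.k + m + 1)) ?_ ?_ ?_).mono ?_ ?_
  · refine ⟨hs, ?_, by omega, ⟨0, by omega, Nat.zero_le _, fun h => .zero hD h⟩, ?_⟩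
    · have := hs.nonneg
      rw [hb]
      nlinarith
    · intro S _ a h
      omega
  · rintro j s' hf ⟨-, -, -, ⟨u, hj, hu, -⟩, -⟩ hc
    simp only [Test.Holds, NatExpr.eval, hf.1 20 rfl, hM'] at hc
    omega
  · rintro j s' hf ⟨hr, hbest, haM, ⟨u, hj, hu, hsc⟩, hlt⟩ hc
    simp only [Test.Holds, NatExpr.eval, hf.1 20 rfl, hM'] at hc
    refine (WP.seq (τ' := 70) ((searchP_spec hD hr hG hM rfl rfl).mono le_rfl fun s₁ h₁ =>
      WP.of_exec rfl (by decide) ?_)).mono (by omega) fun _ h => h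
    have hk0 : (0 : ℝ) ≤ 4 * D.k := by linarith
    simp only [Program.exec, Test.Holds, NatExpr.eval, RealExpr.eval, Nat.cast_zero, not_le,
      ← Nat.le_antisymm_iff, Nat.cast_ofNat]
    by_cases hsuc : s₁.nat 18 0 = 1 ∧ 0 < s₁.real 2 0
    · rw [if_pos hsuc]
      have hR : 0 < s'.real 1 0 := by
        have h2 := hsuc.2.trans_le (h₁.best_le.trans hbest)
        exact pos_of_mul_pos_right h2 hk0
      obtain ⟨C, hC, hCv, hCb⟩ := h₁.success hsuc.1
      have hYR := hCb.trans hC.cost_le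
      obtain ⟨x, hx, y, hy, hxy, hxy'⟩ := h₁.ready.solved.scale
      -- The new radius is the minimum of the best cost and `R/2`; both bounds are needed for the
      -- potential.
      have key : ∀ R', 0 < R' → R' ≤ s₁.real 2 0 → R' ≤ s'.real 1 0 / 2 →
          s₁.real 2 0 ≤ 4 * D.k * R' →
          LowerInv D M G m (j + 1) (s₁.storeReal 1 0 R') := by
        intro R' h0 h1 h2 h3
        have hS := (hsc hR).succ hD hcol hR hC hCv hsuc.2 hYR hx hy hxy hxy' h1 h2
        have e2 : (s₁.storeReal 1 0 R').real 2 = s₁.real 2 :=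
          State.storeReal_real_ne _ _ _ _ (by decide)
        have e1 : (s₁.storeReal 1 0 R').real 1 0 = R' := by simp
        rw [LowerInv, e1, e2, State.storeReal_nat, h₁.first_eq]
        refine ⟨h₁.ready.congr (fun _ _ => rfl) (fun _ _ => rfl) e2
          (State.storeReal_real_ne _ _ _ _ (by decide)) (e1 ▸ h0.le), h3, haM,
          ⟨u + 1, by omega, hS.le, fun _ => hS⟩, fun S hS a ha hSa => ?_⟩
        obtain ⟨c, hc, hcR⟩ := hlt S (hS.trans_le h₁.best_le) a ha hSa
        exact ⟨c, hc, by linarith⟩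
      by_cases hmin : s₁.real 2 0 ≤ s₁.real 1 0 / 2
      · simp only [hmin, ↓reduceIte]
        rw [h₁.radius_eq] at hmin
        exact key _ hsuc.2 le_rfl hmin (by nlinarith [hsuc.2])
      · simp only [hmin, ↓reduceIte]
        rw [h₁.radius_eq] at hmin ⊢
        -- The constant `4k` of the invariant: a solution found at `R` costs at most `2kR =
        -- 4k(R/2)`.
        exact key _ (by linarith) (not_le.1 hmin).le le_rfl (by linarith)
    · rw [if_neg hsuc, h₁.first_eq]
      refine ⟨h₁.ready.congr (fun b hb => State.storeNat_nat_ne _ _ _ _ hb) (fun i hi => ?_) rfl rfl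
        ?_, ?_, ?_, ⟨u, ?_, hu, ?_⟩, fun S hS a ha hSa => ?_⟩
      · rw [State.storeNat_nat_self, Function.update_of_ne (by omega)]
      · rw [State.storeNat_real, h₁.radius_eq]
        exact hr.nonneg
      · rw [State.storeNat_real, h₁.radius_eq]
        exact h₁.best_le.trans hbest
      · rw [State.storeNat_nat_self, Function.update_self]
        omega
      · rw [State.storeNat_nat_self, Function.update_self]
        omega
      · rw [State.storeNat_real, h₁.radius_eq]
        exact hsc
      · rw [State.storeNat_real] at hS ⊢
        rw [State.storeNat_nat_self, Function.update_self] at ha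
        rw [h₁.radius_eq]
        rcases Nat.lt_succ_iff_lt_or_eq.1 ha with h | rfl
        · exact hlt S (hS.trans_le h₁.best_le) a h hSa
        -- If all radii of `S` were at most `R`, the search would have succeeded; and `0 ≤ S.cost <
        -- best` makes the second test true as well.
        · by_contra hcon
          push Not at hcon
          exact hsuc ⟨(h₁.complete S hcon hSa).1, S.cost_nonneg.trans_lt hS⟩
  · generalize searchSize D M G * (D.n * D.k * 1110) = X
    generalize M + (D.k + 5) * (D.k + m + 1) = Y
    simp only [Test.steps, NatExpr.steps]
    exact Nat.add_le_add (Nat.mul_le_mul_left _ (by omega)) (by omega)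
  · rintro s' ⟨j, ⟨hr, hbest, haM, -, hlt⟩, hc, hf⟩
    simp only [Test.Holds, NatExpr.eval, hf.1 20 rfl, hM', not_not] at hc
    refine ⟨hr, by rw [hf.1 20 rfl, hM'], hbest, fun S hS => ?_⟩
    -- All `M` first points have been discarded, and one of them is admissible for `S`.
    by_cases hv : D.viol D.start = 0
    · exact hlt S hS 0 (by omega) fun h => absurd hv h
    · obtain ⟨a, ha, h1, -⟩ := Data.exists_pick S hv hM
      exact hlt S hS a (by omega) fun _ => h1

/-- Every `S` that is not yet approximated has a radius above `R/2`. Either all its radii are at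
most `R`, and then the searches at this scale handle it, or one exceeds `R` and the claim survives
the doubling. -/
theorem raiseP_spec {M G : ℕ} {ε : ℝ} (hD : D.Good) (hs : Lowered D M G s) (hG : 0 < G)
    (hM : ∀ p < D.n, D.bnd (D.col p) < M) (hε : 0 < ε) (hGε : 4 * D.k * (2 / 7) ^ (G - 1) ≤ ε) :
    WP D.d raiseP ((D.k + 3) * (M * (searchSize D M G * (D.n * D.k * 1110) + 40) + 50) + 20)
      (fun s' => Env D s' ∧ Solved D s' ∧
        ∀ S : D.Clustering, s'.real 2 0 ≤ (7 + ε) * S.cost) s := by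
  have hk : (1 : ℝ) ≤ D.k := by exact_mod_cast hD.one_le_k
  refine (WP.loopFrame (τ := M * (searchSize D M G * (D.n * D.k * 1110) + 40) + 25)
    (fun j s' => Ready D M G s' ∧ 2 ^ j * s'.real 2 0 ≤ 4 * D.k * s'.real 1 0 ∧
    ∀ S : D.Clustering, s'.real 2 0 ≤ (7 + ε) * S.cost ∨ ∃ c ∈ S.C, s'.real 1 0 < 2 * S.ρ c)
    (D.k + 3) ⟨hs.ready, by simpa using hs.best_le, fun S => ?_⟩ ?_ ?_).mono ?_ ?_
  · rcases le_or_gt (s.real 2 0) S.cost with h | h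
    · refine Or.inl (h.trans ?_)
      have := S.cost_nonneg
      nlinarith
    · obtain ⟨c, hc, h1⟩ := hs.lt_radius S h
      have := hs.ready.nonneg
      exact Or.inr ⟨c, hc, by linarith⟩
  · rintro j s' - ⟨-, h, -⟩ ⟨hb1, hb2⟩
    simp only [Test.Holds, NatExpr.eval, RealExpr.eval, Nat.cast_zero, not_le] at hb1 hb2
    have h1 : (2 : ℝ) ^ j * s'.real 2 0 ≤ 8 * D.k * s'.real 2 0 := by nlinarith
    have h2 : (2 : ℝ) ^ j ≤ 8 * D.k := le_of_mul_le_mul_right h1 hb1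
    have h3 : 2 ^ j ≤ 8 * D.k := by exact_mod_cast h2
    -- The loop test gives `2^j ≤ 8k < 2^(k+3)`; the crude count `k + 3` of doublings is good
    -- enough.
    have h4 : D.k < 2 ^ D.k := Nat.lt_two_pow_self
    refine (Nat.pow_lt_pow_iff_right (a := 2) (by norm_num)).1 (h3.trans_lt ?_)
    rw [pow_add]
    omega
  · rintro j s' hf ⟨hr, hbest, hS⟩ hb
    have hb' : s'.real 1 0 ≤ s'.real 2 0 + s'.real 2 0 := hb.2
    have hM' : s'.nat 20 0 = M := by rw [hf.1 20 rfl, hs.M_eq]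
    refine (WP.seq (τ' := 15) ((WP.forLoop
      (τ := searchSize D M G * (D.n * D.k * 1110) + 20) (fun a s'' => Ready D M G s'' ∧
        s''.nat 11 0 = a ∧ s''.real 1 0 = s'.real 1 0 ∧ s''.real 2 0 ≤ s'.real 2 0 ∧
        s''.nat 20 0 = M ∧
        ∀ S : D.Clustering, (∀ c ∈ S.C, S.ρ c ≤ s'.real 1 0) → ∀ b < a,
          (D.viol D.start ≠ 0 → D.center D.start b ∉ S.out) →
          s''.real 2 0 ≤ (7 + ε) * S.cost ∨ ∀ c ∈ S.C, 2 * S.ρ c ≤ s'.real 1 0) M ?_ ?_ ?_).mono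
          le_rfl fun s₁ h₁ => WP.of_exec rfl (by decide) ?_)).mono ?_ fun _ h => h
    · refine ⟨hr.congr (fun b hb => State.storeNat_nat_ne _ _ _ _ hb) (fun i hi => ?_) rfl rfl
        hr.nonneg, by simp, rfl, le_rfl, ?_, fun _ _ b hb => absurd hb (Nat.not_lt_zero _)⟩
      · rw [State.storeNat_nat_self, Function.update_of_ne (by omega)]
      · rw [State.storeNat_nat_ne _ _ _ _ (by decide), hM']
    · rintro a s'' ⟨-, h11, -, -, h20, -⟩
      exact ⟨h20, h11⟩
    · rintro a s'' ha ⟨hr'', h11, h1, h2, h20, hall⟩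
      refine (searchP_spec hD hr'' hG hM h11 h1).frame.mono le_rfl fun s₁ ⟨h₁, hf₁⟩ =>
        ⟨h₁.first_eq, h₁.ready.congr (fun b hb => State.storeNat_nat_ne _ _ _ _ hb) (fun i hi => ?_)
          rfl rfl ?_, by simp, h₁.radius_eq, h₁.best_le.trans h2, ?_, fun S hSR b hb hSb => ?_⟩
      · rw [State.storeNat_nat_self, Function.update_of_ne (by omega)]
      · rw [State.storeNat_real]
        exact h₁.ready.nonneg
      · rw [State.storeNat_nat_ne _ _ _ _ (by decide), hf₁.1 20 rfl, h20]
      · rw [State.storeNat_real]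
        rcases Nat.lt_succ_iff_lt_or_eq.1 hb with h | rfl
        · exact (hall S hSR b h hSb).imp_left h₁.best_le.trans
        · rw [or_iff_not_imp_right]
          intro hcon
          push Not at hcon
          obtain ⟨c, hc, hcR⟩ := hcon
          -- The additive error is `R/2 · 4k(2/7)^(G-1) ≤ εR/2`, and `R < 2ρ` turns it into at most
          -- `ε · S.cost`.
          have h3 := (h₁.complete S hSR hSb).2
          have h4 := S.le_cost hc
          have h5 := hr.nonneg
          have h6 : s'.real 1 0 * (4 * D.k * (2 / 7) ^ (G - 1)) ≤ s'.real 1 0 * ε := by gcongr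
          nlinarith
    · obtain ⟨hr₁, -, h1, h2, -, hall⟩ := h₁
      simp only [Program.exec, RealExpr.eval, NatExpr.eval, h1]
      have e2 : (s₁.storeReal 1 0 (s'.real 1 0 + s'.real 1 0)).real 2 = s₁.real 2 :=
          State.storeReal_real_ne _ _ _ _ (by decide)
      have e1 : (s₁.storeReal 1 0 (s'.real 1 0 + s'.real 1 0)).real 1 0 =
          s'.real 1 0 + s'.real 1 0 := by simp
      have hR0 := hr.nonneg
      refine ⟨hr₁.congr (fun _ _ => rfl) (fun _ _ => rfl) e2
          (State.storeReal_real_ne _ _ _ _ (by decide)) (by rw [e1]; positivity), ?_, fun S => ?_⟩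
      · rw [e1, e2, pow_succ]
        have : (2 : ℝ) ^ j * s₁.real 2 0 ≤ 2 ^ j * s'.real 2 0 := by gcongr
        linarith
      · rw [e1, e2]
        rcases hS S with h3 | ⟨c, hc, hcR⟩
        · exact Or.inl (h2.trans h3)
        · by_cases hSR : ∀ c ∈ S.C, S.ρ c ≤ s'.real 1 0
          · have hex : ∃ b < M, D.viol D.start ≠ 0 → D.center D.start b ∉ S.out := by
              by_cases hv : D.viol D.start = 0
              · exact ⟨0, (Nat.zero_le _).trans_lt (hM 0 (hD.one_le_k.trans hD.k_le_n)),
                  fun h => absurd hv h⟩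
              · obtain ⟨b, hb, h, -⟩ := Data.exists_pick S hv hM
                exact ⟨b, hb, fun _ => h⟩
            obtain ⟨b, hb, hSb⟩ := hex
            rcases hall S hSR b hb hSb with h3 | h3
            · exact Or.inl h3
            · exact absurd (h3 c hc) (not_le.2 hcR)
          · push Not at hSR
            obtain ⟨c', hc', h3⟩ := hSR
            exact Or.inr ⟨c', hc', by linarith⟩
    · generalize searchSize D M G * (D.n * D.k * 1110) = X
      simp only [NatExpr.steps]
      have := Nat.mul_le_mul_left M (show X + 20 + (1 + 1 + 11) ≤ X + 40 by omega)
      omega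
  · generalize M * (searchSize D M G * (D.n * D.k * 1110) + 40) = X
    simp only [Test.steps, NatExpr.steps, RealExpr.steps]
    exact Nat.add_le_add (Nat.mul_le_mul_left _ (by omega)) (by omega)
  · rintro s' ⟨j, ⟨hr, -, hS⟩, hb, hf⟩
    refine ⟨hr.env, hr.solved, fun S => ?_⟩
    rcases hS S with h | ⟨c, hc, h⟩
    · exact h
    · have h0 := S.cost_nonneg
      have h1 := S.le_cost hc
      simp only [Test.Holds, NatExpr.eval, RealExpr.eval, Nat.cast_zero, not_le, not_and] at hb
      rcases le_or_gt (s'.real 2 0) 0 with h2 | h2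
      · exact h2.trans (by positivity)
      -- The loop ended with `R` above twice the best cost, so a radius above `R/2` already costs
      -- more than the best solution.
      · have h3 := hb h2
        nlinarith

end ColorfulRadii

/-! ### Preparation of the memory, padding of the centers, and the whole program. -/

namespace ColorfulRadii
open RealRAM

variable {D : Data} {s s' : State} {p : Program}

/-- The largest distance from the point `0`. -/
def spreadP : Program :=
  .forLoop 13 nE (.cond (.realLe (.var 1) (.table (.const 0) iE))
    (.setReal 1 (.const 0) (.table (.const 0) iE)) .skip)

/-- The number of choices for a point. -/
def choicesP : Program :=
  .seq (.setNat 20 (.const 0) (.const 1)) (.forLoop 13 nE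
    (.cond (.natLe (.var 20) (.get 2 (.get 1 iE)))
      (.setNat 20 (.const 0) (.add (.get 2 (.get 1 iE)) (.const 1))) .skip))

/-- The multipliers for the guessed radii. -/
def multP : Program :=
  .seq (.setReal 7 (.const 0) (.ofNat (.const 1))) (.seq
    (.setReal 5 (.const 0) (.ofNat (.const 2))) (.seq (.setNat 21 (.const 0) (.const 1))
    (.loop (.realLt (.var 0) (.mul (.ofNat (.add (.add kE kE) (.add kE kE))) (.var 7)))
      (.seq (.setReal 7 (.const 0) (.mul (.var 7) (.div (.ofNat (.const 2)) (.ofNat (.const 7)))))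
        (.seq (.setReal 5 (.var 21) (.mul (.ofNat (.const 2)) (.var 7)))
          (.setNat 21 (.const 0) (.add (.var 21) (.const 1))))))))

/-- The numbers of values of the decisions. -/
def limitsP : Program :=
  .forLoop 13 kE (.seq (.setNat 12 (.add iE iE) (.var 20))
    (.setNat 12 (.add (.add iE iE) (.const 1)) (.var 21)))

/-- The initial solution with the center `0`. -/
def firstP : Program :=
  .seq (.setReal 2 (.const 0) (.var 1)) (.setNat 3 (.const 0) (.const 1))

/-- Preparation of the memory. -/
def setupP : Program := .seq spreadP (.seq choicesP (.seq multP (.seq limitsP firstP)))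

/-- Add centers until there are `k`. -/
def padP : Program :=
  .seq (.setNat 23 (.const 0) (.const 0)) (.seq
    (.forLoop 13 nE (.cond (.natEq (.get 3 iE) (.const 1))
      (.setNat 23 (.const 0) (.add (.var 23) (.const 1))) .skip))
    (.forLoop 13 nE (.cond (.and (.not (.natEq (.get 3 iE) (.const 1))) (.natLt (.var 23) kE))
      (.seq (.setNat 3 iE (.const 1)) (.setNat 23 (.const 0) (.add (.var 23) (.const 1)))) .skip)))

/-- The whole algorithm. -/
def mainP : Program := .seq setupP (.seq lowerP (.seq raiseP padP))

theorem spreadP_spec (hD : D.Good) (hs : Env D s) (h0 : s.real 1 0 = 0) :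
    WP D.d spreadP (D.n * 33 + 10) (fun s' => (∀ q < D.n, D.d 0 q ≤ s'.real 1 0) ∧
      ∃ x < D.n, s'.real 1 0 = D.d 0 x) s := by
  have hn : 0 < D.n := hD.one_le_k.trans hD.k_le_n
  refine ((WP.forFrame (τ := 20) (fun j s' => (∀ q < j, D.d 0 q ≤ s'.real 1 0) ∧
      ∃ x < D.n, s'.real 1 0 = D.d 0 x) D.n ?_ rfl ?_ ?_).mono ?_ fun s' h => h.1)
  · intro s' hf
    simp only [NatExpr.eval]
    rw [hf.1 0 rfl, hs.n_eq]
  · exact ⟨fun q hq => absurd hq (Nat.not_lt_zero _), 0, hn, by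
      rw [State.storeNat_real, h0, hD.self]⟩
  · rintro j s' hj hf hi ⟨h1, x, hx, h2⟩
    refine WP.of_exec rfl (by decide) ?_
    simp only [Program.exec, Test.Holds, NatExpr.eval, RealExpr.eval, hi, State.storeNat_real]
    split_ifs with h
    · rw [State.storeReal_real_self, Function.update_self]
      refine ⟨fun q hq => ?_, j, hj, rfl⟩
      rcases Nat.lt_succ_iff_lt_or_eq.1 hq with h3 | rfl
      exacts [(h1 q h3).trans h, le_rfl]
    · refine ⟨fun q hq => ?_, x, hx, h2⟩
      rcases Nat.lt_succ_iff_lt_or_eq.1 hq with h3 | rfl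
      exacts [h1 q h3, (not_le.1 h).le]
  · simp only [NatExpr.steps]; omega

theorem choicesP_spec (hs : Env D s) {ω : ℕ} (hcol : ∀ p < D.n, D.col p < ω) :
    WP D.d choicesP (D.n * 43 + 20) (fun s' => (∀ q < D.n, D.bnd (D.col q) < s'.nat 20 0) ∧
      s'.nat 20 0 ≤ (∑ c ∈ Finset.range ω, D.bnd c) + 1) s := by
  refine (WP.seq ((WP.of_exec (τ := 3) rfl (by decide)
      (Q := fun s' => s'.nat 20 0 = 1) (by simp [Program.exec, NatExpr.eval])).frame.mono le_rfl
      fun s₁ h₁ => ((WP.forFrame (τ := 30) (fun j s' => (∀ q < j, D.bnd (D.col q) < s'.nat 20 0) ∧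
      s'.nat 20 0 ≤ (∑ c ∈ Finset.range ω, D.bnd c) + 1) D.n ?_ rfl ?_ ?_).mono le_rfl
        fun s' h => h.1))).mono ?_ fun _ h => h
  · intro s' hf
    simp only [NatExpr.eval]
    rw [hf.1 0 rfl, h₁.2.1 0 rfl, hs.n_eq]
  · rw [State.storeNat_nat_ne _ _ _ _ (by decide), h₁.1]
    exact ⟨fun q hq => absurd hq (Nat.not_lt_zero _), by omega⟩
  · rintro j s' hj hf hi ⟨h1, h2⟩
    refine WP.of_exec rfl (by decide) ?_
    rw [State.storeNat_nat_ne _ _ _ _ (by decide)]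
    simp only [Program.exec, Test.Holds, NatExpr.eval, hi]
    rw [hf.1 1 rfl, h₁.2.1 1 rfl, hs.col_eq, hf.1 2 rfl, h₁.2.1 2 rfl, hs.bnd_eq]
    split_ifs with h
    · rw [State.storeNat_nat_self, Function.update_self]
      refine ⟨fun q hq => ?_, Nat.succ_le_succ ?_⟩
      · rcases Nat.lt_succ_iff_lt_or_eq.1 hq with h3 | rfl
        · have := h1 q h3; omega
        · omega
      · exact Finset.single_le_sum (f := D.bnd) (fun _ _ => Nat.zero_le _)
          (Finset.mem_range.2 (hcol j hj))
    · refine ⟨fun q hq => ?_, h2⟩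
      rcases Nat.lt_succ_iff_lt_or_eq.1 hq with h3 | rfl
      exacts [h1 q h3, not_le.1 h]
  · simp only [NatExpr.steps]; omega

/-- The machine has neither logarithms nor rounding, so the number of guesses is found by repeated
multiplication and comparison with `ε`. -/
theorem multP_spec (hs : Env D s) {ε : ℝ} (h0 : s.real 0 0 = ε) {N : ℕ}
    (hN : 4 * D.k * (2 / 7) ^ N ≤ ε) (hN' : ∀ j < N, ε < 4 * D.k * (2 / 7) ^ j) :
    WP D.d multP (N * 60 + 40) (fun s' => s'.nat 21 0 = N + 1 ∧
      ∀ g < N + 1, s'.real 5 g = 2 * (2 / 7) ^ g) s := by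
  refine (WP.seq ((WP.of_exec (τ := 4) rfl (by decide)
      (Q := fun s' => s'.real 7 0 = 1) (by simp [Program.exec, NatExpr.eval, RealExpr.eval])).frame.mono
      le_rfl fun s₁ h₁ => WP.seq ((WP.of_exec (τ := 4) rfl (by decide)
      (Q := fun s' => s'.real 5 0 = 2) (by simp [Program.exec, NatExpr.eval, RealExpr.eval])).frame.mono
      le_rfl fun s₂ h₂ => WP.seq ((WP.of_exec (τ := 3) rfl (by decide)
      (Q := fun s' => s'.nat 21 0 = 1) (by simp [Program.exec, NatExpr.eval])).frame.mono
      le_rfl fun s₃ h₃ => ((WP.loopFrame (τ := 30) (fun j s' => s'.nat 21 0 = j + 1 ∧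
        s'.real 7 0 = (2 / 7) ^ j ∧ j ≤ N ∧ ∀ g < j + 1, s'.real 5 g = 2 * (2 / 7) ^ g)
        N ?_ ?_ ?_).mono le_rfl ?_))))).mono ?_ fun _ h => h
  · refine ⟨h₃.1, ?_, Nat.zero_le _, fun g hg => ?_⟩
    · rw [h₃.2.2 7 rfl, h₂.2.2 7 rfl, h₁.1, pow_zero]
    · obtain rfl : g = 0 := by omega
      rw [h₃.2.2 5 rfl, h₂.1, pow_zero, mul_one]
  rotate_right
  · simp only [Test.steps, NatExpr.steps, RealExpr.steps]
    omega
  all_goals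
    have key : ∀ s', Frame (.loop (.realLt (.var 0) (.mul (.ofNat (.add (.add kE kE) (.add kE kE)))
        (.var 7))) (.seq (.setReal 7 (.const 0) (.mul (.var 7) (.div (.ofNat (.const 2))
        (.ofNat (.const 7))))) (.seq (.setReal 5 (.var 21) (.mul (.ofNat (.const 2)) (.var 7)))
        (.setNat 21 (.const 0) (.add (.var 21) (.const 1)))))) s₃ s' → ∀ j,
        s'.real 7 0 = (2 / 7) ^ j → ((Test.realLt (.var 0) (.mul (.ofNat (.add (.add kE kE)
        (.add kE kE))) (.var 7))).Holds D.d s' ↔ ε < 4 * D.k * (2 / 7) ^ j) := by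
      intro s' hf j h7
      simp only [Test.Holds, NatExpr.eval, RealExpr.eval, h7, not_le]
      rw [hf.1 0 rfl, h₃.2.1 0 rfl, h₂.2.1 0 rfl, h₁.2.1 0 rfl, hf.2 0 rfl, h₃.2.2 0 rfl,
        h₂.2.2 0 rfl, h₁.2.2 0 rfl, h0, hs.k_eq]
      push_cast
      rw [show (D.k + D.k + (D.k + D.k) : ℝ) = 4 * D.k by ring]
  · rintro j s' hf ⟨-, h7, hj, -⟩ hb
    rw [key s' hf j h7] at hb
    refine lt_of_le_of_ne hj ?_
    rintro rfl
    linarith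
  · rintro j s' hf ⟨h21, h7, hj, h5⟩ hb
    rw [key s' hf j h7] at hb
    have hjN : j < N := by
      refine lt_of_le_of_ne hj ?_
      rintro rfl
      linarith
    refine WP.of_exec rfl (by decide) ?_
    simp only [Program.exec, NatExpr.eval, RealExpr.eval, ne_eq, Nat.reduceEqDiff,
      not_false_eq_true, State.storeReal_real_ne, State.storeReal_real_self, State.storeReal_nat,
      State.storeNat_nat_self, State.storeNat_real, Function.update_self, h21, h7]
    refine ⟨trivial, ?_, hjN, fun g hg => ?_⟩
    · rw [pow_succ]; norm_num
    · rw [Function.update_apply]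
      split_ifs with h
      · rw [h, pow_succ]; norm_num
      · exact h5 g (by omega)
  · rintro s' ⟨j, ⟨h21, h7, hj, h5⟩, hb, hf⟩
    rw [key s' hf j h7] at hb
    obtain rfl : j = N := by
      by_contra hne
      exact hb (hN' j (by omega))
    exact ⟨h21, h5⟩

theorem limitsP_spec (hs : Env D s) {M G : ℕ} (hM : s.nat 20 0 = M) (hG : s.nat 21 0 = G) :
    WP D.d limitsP (D.k * 50 + 10) (fun s' =>
      ∀ i, 1 ≤ i → i < D.k + D.k → s'.nat 12 i = Data.lim M G i) s := by
  refine ((WP.forFrame (τ := 30) (fun j s' => ∀ i < j + j, s'.nat 12 i = Data.lim M G i) D.k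
    ?_ rfl ?_ ?_).mono ?_ fun s' h i _ hi => h.1 i hi)
  · intro s' hf
    simp only [NatExpr.eval]
    rw [hf.1 0 rfl, hs.k_eq]
  · exact fun i hi => absurd hi (Nat.not_lt_zero _)
  · intro j s' hj hf hi h
    refine WP.of_exec rfl (by decide) ?_
    have e20 : s'.nat 20 0 = M := by rw [hf.1 20 rfl, hM]
    have e21 : s'.nat 21 0 = G := by rw [hf.1 21 rfl, hG]
    simp only [Program.exec, NatExpr.eval, hi, ne_eq, Nat.reduceEqDiff, not_false_eq_true,
      State.storeNat_nat_ne, State.storeNat_nat_self, e20, e21]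
    intro i hi'
    rw [Function.update_apply, Function.update_apply, Data.lim]
    split_ifs with h1 h2 h3 h4 h5
    · omega
    · rfl
    · rfl
    · omega
    · rw [h i (by omega), Data.lim, if_pos h5]
    · rw [h i (by omega), Data.lim, if_neg h5]
  · simp only [NatExpr.steps]; omega

/-- The initial memory. -/
structure Initial (D : Data) (ε : ℝ) (s : State) : Prop where
  env : Env D s
  nat_zero : ∀ a, 3 ≤ a → ∀ i, s.nat a i = 0
  real_zero : s.real 1 0 = 0
  eps : s.real 0 0 = ε

/-- The zero memory already encodes that there are no outliers and that every point is assigned to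
the point `0`. Only the mark of this center and the cost, which is also the first radius `R`, have
to be written. -/
theorem setupP_spec (hD : D.Good) {ε : ℝ} (hs : Initial D ε s) {ω : ℕ}
    (hcol : ∀ p < D.n, D.col p < ω) {N : ℕ}
    (hN : 4 * D.k * (2 / 7) ^ N ≤ ε) (hN' : ∀ j < N, ε < 4 * D.k * (2 / 7) ^ j) :
    WP D.d setupP (D.n * 90 + N * 60 + D.k * 50 + 100) (fun s' => ∃ M, s'.nat 20 0 = M ∧
      (∀ q < D.n, D.bnd (D.col q) < M) ∧ M ≤ (∑ c ∈ Finset.range ω, D.bnd c) + 1 ∧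
      Ready D M (N + 1) s' ∧ s'.nat 11 0 = 0 ∧ s'.real 2 0 = s'.real 1 0) s := by
  have hn : 0 < D.n := hD.one_le_k.trans hD.k_le_n
  have hk : (1 : ℝ) ≤ D.k := by exact_mod_cast hD.one_le_k
  refine (WP.seq ((spreadP_spec hD hs.env hs.real_zero).frame.mono le_rfl fun s₁ h₁ =>
    have hs₁ := hs.env.frame h₁.2 rfl rfl rfl
    WP.seq ((choicesP_spec hs₁ hcol).frame.mono le_rfl fun s₂ h₂ =>
    have hs₂ := hs₁.frame h₂.2 rfl rfl rfl
    WP.seq ((multP_spec hs₂ (by rw [h₂.2.2 0 rfl, h₁.2.2 0 rfl, hs.eps]) hN hN').frame.mono le_rfl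
      fun s₃ h₃ =>
    have hs₃ := hs₂.frame h₃.2 rfl rfl rfl
    WP.seq ((limitsP_spec hs₃ (M := s₂.nat 20 0) ?_ h₃.1.1).frame.mono le_rfl fun s₄ h₄ =>
    ((WP.of_exec (τ := 8) rfl (by decide) (Q := fun s' => s'.real 2 0 = s₄.real 1 0 ∧
      s'.nat 3 = Function.update (s₄.nat 3) 0 1) ?_).frame.mono le_rfl fun s₅ h₅ =>
        ?_)))))).mono ?_ fun _ h => h
  · rw [h₃.2.1 20 rfl]
  · simp [firstP, Program.exec, NatExpr.eval, RealExpr.eval]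
  · have hs₅ := (hs₃.frame h₄.2 rfl rfl rfl).frame h₅.2 rfl rfl rfl
    have e20 : s₅.nat 20 = s₂.nat 20 := by rw [h₅.2.1 20 rfl, h₄.2.1 20 rfl, h₃.2.1 20 rfl]
    have e1 : s₄.real 1 = s₁.real 1 := by rw [h₄.2.2 1 rfl, h₃.2.2 1 rfl, h₂.2.2 1 rfl]
    have e1' : s₅.real 1 = s₁.real 1 := by rw [h₅.2.2 1 rfl, e1]
    have ez : ∀ a, 3 ≤ a → setupP.writesNat a = false → ∀ i, s₅.nat a i = 0 := by
      intro a ha hw i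
      simp only [setupP, firstP, Program.writesNat, Bool.or_eq_false_iff, Bool.false_or] at hw
      rw [h₅.2.1 a (by simpa [firstP, Program.writesNat] using hw.2.2.2.2), h₄.2.1 a hw.2.2.2.1,
        h₃.2.1 a hw.2.2.1, h₂.2.1 a hw.2.1, h₁.2.1 a hw.1, hs.nat_zero a ha]
    have e3 : s₅.nat 3 = Function.update (fun _ => 0) 0 1 := by
      rw [h₅.1.2, h₄.2.1 3 rfl, h₃.2.1 3 rfl, h₂.2.1 3 rfl, h₁.2.1 3 rfl]
      congr 1
      funext i
      exact hs.nat_zero 3 (by omega) i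
    obtain ⟨x, hx, hxR⟩ := h₁.1.2
    have hR0 : 0 ≤ s₁.real 1 0 := hxR ▸ hD.nonneg _ _
    refine ⟨_, rfl, by rw [e20]; exact h₂.1.1, by rw [e20]; exact h₂.1.2, ⟨hs₅, ⟨?_, ?_, ?_⟩,
      ⟨?_, ?_, ?_, ?_, ?_, ?_⟩, ?_, ?_, ?_, ?_⟩, ez 11 (by omega) rfl 0, by rw [h₅.1.1, e1, e1']⟩
    · exact fun q _ => ez 6 (by omega) rfl q
    · exact fun q _ => ez 7 (by omega) rfl q
    · exact fun q _ => ez 8 (by omega) rfl q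
    · refine (Finset.card_le_card (t := {0}) fun q hq => ?_).trans
        ((Finset.card_singleton 0).trans_le hD.one_le_k)
      have h := (Finset.mem_filter.1 hq).2
      rw [e3, Function.update_apply] at h
      by_contra hq0
      rw [if_neg (by simpa using hq0)] at h
      exact zero_ne_one h
    · intro c
      rw [Finset.filter_false_of_mem]
      · simp
      · rintro q - ⟨h, -⟩
        rw [ez 4 (by omega) rfl q] at h
        exact zero_ne_one h
    · intro q hq h
      rw [ez 4 (by omega) rfl q] at h
      exact absurd h zero_ne_one
    · intro q hq h
      rw [ez 5 (by omega) rfl q, e3]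
      exact ⟨hn, by simp⟩
    · refine ⟨fun c => if c = 0 then s₁.real 1 0 else 0, fun c => ?_, fun q hq h => ?_, ?_⟩
      · dsimp only; split_ifs; exacts [hR0, le_rfl]
      · rw [ez 5 (by omega) rfl q]
        exact h₁.1.1 q hq
      · rw [Finset.sum_ite_eq', if_pos (by simpa using hn), h₅.1.1, e1]
    · refine ⟨0, hn, x, hx, ?_⟩
      rw [h₅.1.1, e1, hxR]
      have := hD.nonneg 0 x
      exact ⟨le_rfl, by nlinarith⟩
    · rw [h₅.2.1 12 rfl, e20]
      exact h₄.1
    · exact fun i _ _ => ez 11 (by omega) rfl i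
    · rw [h₅.2.2 5 rfl, h₄.2.2 5 rfl]
      exact h₃.1.2
    · rw [e1']; exact hR0
  · omega

/-- The second pass leaves a point unmarked only if there are `k` centers; if it marks all points,
then `k ≤ n` forces equality. -/
theorem padP_spec (hD : D.Good) (hs : Env D s)
    (hc : ((Finset.range D.n).filter (fun q => s.nat 3 q = 1)).card ≤ D.k) :
    WP D.d padP (D.n * 120 + 40) (fun s' =>
      ((Finset.range D.n).filter (fun q => s'.nat 3 q = 1)).card = D.k ∧
      ∀ q, s.nat 3 q = 1 → s'.nat 3 q = 1) s := by
  refine (WP.seq ((WP.of_exec (τ := 3) rfl (by decide)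
      (Q := fun s' => s'.nat 23 0 = 0) (by simp [Program.exec, NatExpr.eval])).frame.mono le_rfl
      fun s₁ h₁ => WP.seq ((WP.forFrame (τ := 30) (fun j s' => s'.nat 23 0 =
        ((Finset.range j).filter (fun q => s.nat 3 q = 1)).card) D.n ?_ rfl ?_ ?_).mono le_rfl
      fun s₂ h₂ => ((WP.forFrame (τ := 50) (fun j s' => s'.nat 23 0 =
        ((Finset.range D.n).filter (fun q => s'.nat 3 q = 1)).card ∧ s'.nat 23 0 ≤ D.k ∧
        (∀ q, s.nat 3 q = 1 → s'.nat 3 q = 1) ∧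
        ((∀ q < j, s'.nat 3 q = 1) ∨ s'.nat 23 0 = D.k)) D.n ?_ rfl ?_ ?_).mono le_rfl
      fun s₃ h₃ => ?_)))).mono ?_ fun _ h => h
  · intro s' hf
    simp only [NatExpr.eval]
    rw [hf.1 0 rfl, h₁.2.1 0 rfl, hs.n_eq]
  · rw [State.storeNat_nat_ne _ _ _ _ (by decide), h₁.1]
    simp
  · intro j s' hj hf hi h
    refine WP.of_exec rfl (by decide) ?_
    rw [State.storeNat_nat_ne _ _ _ _ (by decide), Finset.range_add_one, Finset.filter_insert]
    simp only [Program.exec, Test.Holds, NatExpr.eval, hi, ← Nat.le_antisymm_iff]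
    rw [hf.1 3 rfl, h₁.2.1 3 rfl]
    split_ifs with h3
    · rw [Finset.card_insert_of_notMem (by simp)]
      simp [h]
    · exact h
  · intro s' hf
    simp only [NatExpr.eval]
    rw [hf.1 0 rfl, h₂.2.1 0 rfl, h₁.2.1 0 rfl, hs.n_eq]
  · rw [State.storeNat_nat_ne _ _ _ _ (by decide), State.storeNat_nat_ne _ _ _ _ (by decide),
      h₂.1, h₂.2.1 3 rfl, h₁.2.1 3 rfl]
    exact ⟨rfl, hc, fun _ h => h, Or.inl fun q hq => absurd hq (Nat.not_lt_zero _)⟩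
  · rintro j s' hj hf hi ⟨h23, hle, hsub, hor⟩
    refine WP.of_exec rfl (by decide) ?_
    have ek : s'.nat 0 1 = D.k := by rw [hf.1 0 rfl, h₂.2.1 0 rfl, h₁.2.1 0 rfl, hs.k_eq]
    simp only [Program.exec, Test.Holds, NatExpr.eval, hi, ← Nat.le_antisymm_iff, ek, not_le]
    rw [State.storeNat_nat_ne _ _ _ _ (by decide), State.storeNat_nat_ne _ _ _ _ (by decide)]
    split_ifs with h
    · simp only [ne_eq, Nat.reduceEqDiff, not_false_eq_true, State.storeNat_nat_ne,
        State.storeNat_nat_self, Function.update_self]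
      have hcard : (Finset.range D.n).filter (fun q => Function.update (s'.nat 3) j 1 q = 1) =
          insert j ((Finset.range D.n).filter (fun q => s'.nat 3 q = 1)) := by
        ext q
        rw [Finset.mem_filter, Finset.mem_insert, Finset.mem_filter, Finset.mem_range,
          Function.update_apply]
        by_cases hq : q = j
        · simp [hq, hj]
        · simp [hq]
      refine ⟨?_, h.2, fun q hq => ?_, ?_⟩
      · rw [hcard, Finset.card_insert_of_notMem (by simp [h.1]), h23]
      · rw [Function.update_apply]
        split_ifs
        exacts [rfl, hsub q hq]
      · refine hor.imp (fun h4 q hq => ?_) fun h4 => by omega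
        rw [Function.update_apply]
        split_ifs with h5
        · rfl
        · exact h4 q (by omega)
    · refine ⟨h23, hle, hsub, ?_⟩
      rcases hor with h4 | h4
      · by_cases h5 : s'.nat 3 j = 1
        · refine Or.inl fun q hq => ?_
          rcases Nat.lt_succ_iff_lt_or_eq.1 hq with h6 | rfl
          exacts [h4 q h6, h5]
        · exact Or.inr (le_antisymm hle (not_lt.1 fun h6 => h ⟨h5, h6⟩))
      · exact Or.inr h4
  · obtain ⟨⟨h23, hle, hsub, hor⟩, -⟩ := h₃
    refine ⟨?_, hsub⟩
    rcases hor with h | h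
    · rw [Finset.filter_true_of_mem fun q hq => h q (by simpa using hq), Finset.card_range] at h23 ⊢
      have := hD.k_le_n
      omega
    · rw [← h23, h]
  · simp only [NatExpr.steps]; omega

/-- The number of steps of the algorithm, where `m` is the total number of outliers and `G` the
number of guesses for a radius. -/
def totalTime (n k m M G : ℕ) : ℕ :=
  n * 90 + G * 60 + k * 50 + 100 +
    (((M + (k + 5) * (k + m + 1)) * (M ^ (k - 1) * G ^ k * (n * k * 1110) + 100) + 10) +
    (((k + 3) * (M * (M ^ (k - 1) * G ^ k * (n * k * 1110) + 40) + 50) + 20) + (n * 120 + 40)))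

theorem mainP_spec (hD : D.Good) {ε : ℝ} (hε : 0 < ε) (hs : Initial D ε s) {ω : ℕ}
    (hcol : ∀ p < D.n, D.col p < ω) {N : ℕ}
    (hN : 4 * D.k * (2 / 7) ^ N ≤ ε) (hN' : ∀ j < N, ε < 4 * D.k * (2 / 7) ^ j) :
    WP D.d mainP (totalTime D.n D.k (∑ c ∈ Finset.range ω, D.bnd c)
        ((∑ c ∈ Finset.range ω, D.bnd c) + 1) (N + 1))
      (fun s' => Solved D s' ∧ (∀ S : D.Clustering, s'.real 2 0 ≤ (7 + ε) * S.cost) ∧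
        ((Finset.range D.n).filter (fun q => s'.nat 3 q = 1)).card = D.k) s := by
  set m := ∑ c ∈ Finset.range ω, D.bnd c with hm
  refine (WP.seq ((setupP_spec hD hs hcol hN hN').mono (τ' := D.n * 90 + (N + 1) * 60 + D.k * 50 + 100)
    (by omega) fun s₁ h₁ => ?_)).mono le_rfl fun _ h => h
  obtain ⟨M, h20, hM, hMm, hr, h11, hb⟩ := h₁
  refine WP.seq ((lowerP_spec hD hr (Nat.succ_pos N) hM hcol h11 h20 hb).mono ?_ fun s₂ h₂ =>
    WP.seq ((raiseP_spec hD h₂ (Nat.succ_pos N) hM hε hN).mono ?_ fun s₃ h₃ =>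
      (padP_spec hD h₃.1 h₃.2.1.card_le).frame.mono le_rfl fun s₄ h₄ => ⟨?_, ?_, h₄.1.1⟩))
  · rw [← hm, searchSize]
    gcongr
  · rw [searchSize]
    gcongr
  · obtain ⟨h5, h6, h7, h8, h9, h10⟩ := h₃.2.1
    have e4 : s₄.nat 4 = s₃.nat 4 := h₄.2.1 4 rfl
    have e5 : s₄.nat 5 = s₃.nat 5 := h₄.2.1 5 rfl
    have e2 : s₄.real 2 = s₃.real 2 := h₄.2.2 2 rfl
    rw [← e4] at h6 h7 h8 h9
    rw [← e5] at h7 h8 h9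
    rw [← e2] at h9 h10
    exact ⟨h₄.1.1.le, h6, h7, fun q hq h => ⟨(h8 q hq h).1, h₄.1.2 _ (h8 q hq h).2⟩, h9, h10⟩
  · rw [h₄.2.2 2 rfl]
    exact h₃.2.2

end ColorfulRadii

namespace ColorfulRadii
open RealRAM

/-! ### The running time -/

/-- One search contributes `(k+m)^(k-1) G^k · nk`, and the number of searches is `O(k(k+m))`; this
supplies the missing factor `k + m`. All other terms are dominated. -/
theorem totalTime_le {n k m G : ℕ} (hn : 1 ≤ n) (hk : 1 ≤ k) (hG : 1 ≤ G) :
    totalTime n k m (m + 1) G ≤ 22000 * (n * (k + m) ^ k * (k ^ 2 * G ^ k)) := by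
  obtain ⟨k', rfl⟩ : ∃ k', k = k' + 1 := ⟨k - 1, by omega⟩
  simp only [totalTime, Nat.add_sub_cancel]
  set k := k' + 1 with hk'
  set K := k + m with hK
  have hKpos : 0 < K := by omega
  set V := K ^ k' * G ^ k with hV
  have hV1 : 1 ≤ V := Nat.mul_pos (pow_pos hKpos _) (pow_pos hG _)
  have hMV : (m + 1) ^ k' * G ^ k ≤ V :=
    Nat.mul_le_mul_right _ (Nat.pow_le_pow_left (by omega) _)
  have hGV : G ≤ V := by
    calc G = 1 * G ^ 1 := by ring
      _ ≤ K ^ k' * G ^ k := Nat.mul_le_mul (pow_pos hKpos _) (Nat.pow_le_pow_right hG hk)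
  have hW : n * K ^ k * (k ^ 2 * G ^ k) = k * K * (V * (n * k)) := by
    rw [hV, hk', pow_succ K]; ring
  rw [hW]
  have hnk : 1 ≤ n * k := Nat.mul_pos hn hk
  set Z := V * (n * k) with hZ
  have hZ1 : 1 ≤ Z := Nat.mul_pos hV1 hnk
  have hMZ : (m + 1) ^ k' * G ^ k * (n * k * 1110) ≤ Z * 1110 := by
    calc (m + 1) ^ k' * G ^ k * (n * k * 1110) ≤ V * (n * k * 1110) := Nat.mul_le_mul_right _ hMV
      _ = Z * 1110 := by rw [hZ]; ring
  have hkK : 1 ≤ k * K := Nat.mul_pos hk hKpos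
  set W := k * K * Z with hWdef
  have hZW : Z ≤ W := Nat.le_mul_of_pos_left _ hkK
  have hn' : n ≤ Z := (Nat.le_mul_of_pos_right n hk).trans (Nat.le_mul_of_pos_left _ hV1)
  have hk2 : k ≤ Z := (Nat.le_mul_of_pos_left k hn).trans (Nat.le_mul_of_pos_left _ hV1)
  have hG2 : G ≤ Z := hGV.trans (Nat.le_mul_of_pos_right _ hnk)
  have hA : m + 1 + (k + 5) * (K + 1) ≤ 13 * (k * K) := by nlinarith
  have h1 : (m + 1 + (k + 5) * (K + 1)) * ((m + 1) ^ k' * G ^ k * (n * k * 1110) + 100) ≤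
      15730 * W := by
    calc _ ≤ 13 * (k * K) * (Z * 1210) := Nat.mul_le_mul hA (by omega)
      _ = 15730 * W := by rw [hWdef]; ring
  have hB : (m + 1) * ((m + 1) ^ k' * G ^ k * (n * k * 1110) + 40) + 50 ≤ K * Z * 1200 := by
    have h2 : (m + 1) * ((m + 1) ^ k' * G ^ k * (n * k * 1110) + 40) ≤ K * (Z * 1150) :=
      Nat.mul_le_mul (by omega) (by omega)
    have h3 : 1 ≤ K * Z := Nat.mul_pos hKpos hZ1
    have h4 : K * (Z * 1150) = K * Z * 1150 := by ring
    omega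
  have h2 : (k + 3) * ((m + 1) * ((m + 1) ^ k' * G ^ k * (n * k * 1110) + 40) + 50) ≤
      4800 * W := by
    calc _ ≤ 4 * k * (K * Z * 1200) := Nat.mul_le_mul (by omega) hB
      _ = 4800 * W := by rw [hWdef]; ring
  omega

/-- The ratio of the guesses exceeds `e` by a definite factor; that gives a coefficient `5/6 < 1` in
front of the logarithm. -/
theorem six_fifths_le_log : (6 / 5 : ℝ) ≤ Real.log (7 / 2) := by
  rw [Real.le_log_iff_exp_le (by norm_num)]
  have h1 : Real.exp (6 / 5) ^ 5 = Real.exp 1 ^ 6 := by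
    rw [← Real.exp_nat_mul, ← Real.exp_nat_mul]; norm_num
  have h2 : Real.exp 1 ^ 6 ≤ (7 / 2) ^ 5 := by
    calc Real.exp 1 ^ 6 ≤ 2.7182818286 ^ 6 :=
          pow_le_pow_left₀ (Real.exp_pos 1).le Real.exp_one_lt_d9.le 6
      _ ≤ (7 / 2) ^ 5 := by norm_num
  exact le_of_pow_le_pow_left₀ (by norm_num) (by norm_num) (h1 ▸ h2)

theorem log_four_le : Real.log 4 ≤ 7 / 5 := by
  rw [show (4 : ℝ) = 2 ^ 2 by norm_num, Real.log_pow]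
  have := Real.log_two_lt_d9
  push_cast
  linarith

/-- The number of guesses for a radius is less than the logarithm, up to an additive constant. -/
theorem guesses_le {k N : ℕ} {ε : ℝ} (hk : 1 ≤ k) (hε : 0 < ε)
    (hN : ∀ j < N, ε < 4 * k * (2 / 7) ^ j) :
    ((N + 1 : ℕ) : ℝ) ≤ 5 / 6 * Real.log (max 2 (max (k : ℝ) ((k : ℝ) / ε))) + 4 := by
  set L := Real.log (max 2 (max (k : ℝ) ((k : ℝ) / ε))) with hL
  have hL0 : 0 ≤ L := Real.log_nonneg (le_max_of_le_left (by norm_num))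
  rcases Nat.eq_zero_or_pos N with rfl | hN0
  · norm_num; linarith
  obtain ⟨j, rfl⟩ : ∃ j, N = j + 1 := ⟨N - 1, by omega⟩
  have hkpos : (0 : ℝ) < k := by exact_mod_cast hk
  have h1 : (7 / 2 : ℝ) ^ j ≤ 4 * (k / ε) := by
    have h2 := hN j (by omega)
    have h3 : (7 / 2 : ℝ) ^ j * (2 / 7) ^ j = 1 := by rw [← mul_pow]; norm_num
    rw [← mul_div_assoc, le_div_iff₀ hε]
    have h4 : (0 : ℝ) < (7 / 2) ^ j := by positivity
    nlinarith
  have h2 : j * Real.log (7 / 2) ≤ Real.log 4 + L := by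
    rw [← Real.log_pow]
    calc Real.log ((7 / 2) ^ j) ≤ Real.log (4 * (k / ε)) := Real.log_le_log (by positivity) h1
      _ = Real.log 4 + Real.log (k / ε) := Real.log_mul (by norm_num) (by positivity)
      _ ≤ Real.log 4 + L := by
        gcongr
        exact Real.log_le_log (by positivity) (le_max_of_le_right (le_max_right _ _))
  have h3 : (j : ℝ) * (6 / 5) ≤ j * Real.log (7 / 2) := by
    gcongr; exact six_fifths_le_log
  have h4 := log_four_le
  push_cast
  linarith

/-- Additive constants and polynomial factors are absorbed by the base of the logarithm. -/
theorem exists_const_guesses : ∃ c : ℝ, 0 < c ∧ ∀ (k N : ℕ) (ε : ℝ), 1 ≤ k → 0 < ε →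
    (∀ j < N, ε < 4 * k * (2 / 7) ^ j) → (k : ℝ) ^ 2 * ((N + 1 : ℕ) : ℝ) ^ k ≤
      c * Real.log (max 2 (max (k : ℝ) ((k : ℝ) / ε))) ^ k := by
  -- For large `L` the gain `(11/12)^k` absorbs `k²`.
  obtain ⟨c₁, hc₁⟩ := (tendsto_pow_const_mul_const_pow_of_abs_lt_one 2
    (r := (11 / 12 : ℝ)) (by rw [abs_lt]; norm_num)).bddAbove_range
  obtain ⟨K, hK⟩ := exists_nat_gt (Real.exp 48)
  refine ⟨max c₁ ((K : ℝ) ^ 2 * 7 ^ K), lt_max_of_lt_right ?_, fun k N ε hk hε hN => ?_⟩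
  · have : (0 : ℝ) < K := (Real.exp_pos _).trans hK
    positivity
  have hG := guesses_le hk hε hN
  set L := Real.log (max 2 (max (k : ℝ) ((k : ℝ) / ε))) with hL
  have hL2 : 69 / 100 ≤ L := by
    have h1 := Real.log_two_gt_d9
    have h2 : Real.log 2 ≤ L := Real.log_le_log (by norm_num) (le_max_left _ _)
    linarith
  have hL0 : 0 < L := by linarith
  rcases le_or_gt 48 L with h48 | h48
  -- The threshold 48 makes the additive constant `4` at most `L/12`. Below it `k < exp 48` is
  -- bounded, and any constant factor will do.
  · have h1 : ((N + 1 : ℕ) : ℝ) ≤ 11 / 12 * L := by linarith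
    calc (k : ℝ) ^ 2 * ((N + 1 : ℕ) : ℝ) ^ k ≤ (k : ℝ) ^ 2 * (11 / 12 * L) ^ k := by gcongr
      _ = (k : ℝ) ^ 2 * (11 / 12) ^ k * L ^ k := by rw [mul_pow]; ring
      _ ≤ max c₁ ((K : ℝ) ^ 2 * 7 ^ K) * L ^ k := by
        gcongr
        exact le_max_of_le_left (hc₁ ⟨k, rfl⟩)
  · have h1 : ((N + 1 : ℕ) : ℝ) ≤ 7 * L := by linarith
    have hkK : k ≤ K := by
      have h2 : (0 : ℝ) < k := by exact_mod_cast hk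
      have h3 : Real.log k ≤ L :=
        Real.log_le_log h2 (le_max_of_le_right (le_max_left _ _))
      have h4 : (k : ℝ) < Real.exp 48 := (Real.log_lt_iff_lt_exp h2).1 (h3.trans_lt h48)
      exact_mod_cast (h4.trans hK).le
    calc (k : ℝ) ^ 2 * ((N + 1 : ℕ) : ℝ) ^ k ≤ (k : ℝ) ^ 2 * (7 * L) ^ k := by gcongr
      _ = (k : ℝ) ^ 2 * 7 ^ k * L ^ k := by rw [mul_pow]; ring
      _ ≤ (K : ℝ) ^ 2 * 7 ^ K * L ^ k := by
        gcongr
        norm_num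
      _ ≤ max c₁ ((K : ℝ) ^ 2 * 7 ^ K) * L ^ k := by
        gcongr
        exact le_max_right _ _

/-! ### The instance -/

variable (I : Instance)

/-- The data of an instance. -/
def Instance.data : Data where
  n := I.n
  k := I.k
  col i := if h : i < I.n then (I.color ⟨i, h⟩ : ℕ) else 0
  bnd i := if h : i < I.ω then I.outlierBound ⟨i, h⟩ else 0
  d := I.distTable

variable {I}

theorem distTable_eq (p q : Fin I.n) : I.distTable p q = I.d p q := by
  simp [Instance.distTable]

theorem data_good : I.data.Good where
  self i := by
    simp only [Instance.data, Instance.distTable, Instance.d]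
    split_ifs <;> simp
  symm i j := by
    simp only [Instance.data, Instance.distTable, Instance.d]
    by_cases h : i < I.n ∧ j < I.n
    · rw [dif_pos h, dif_pos h.symm, @nndist_comm _ I.metric.toPseudoMetricSpace]
    · rw [dif_neg h, dif_neg fun h' => h h'.symm]
  nonneg i j := by
    simp only [Instance.data, Instance.distTable]
    split_ifs <;> simp
  triangle i j l hi hj hl := by
    have h := @nndist_triangle _ I.metric.toPseudoMetricSpace ⟨i, hi⟩ ⟨j, hj⟩ ⟨l, hl⟩
    have h1 := distTable_eq (I := I) ⟨i, hi⟩ ⟨j, hj⟩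
    have h2 := distTable_eq (I := I) ⟨j, hj⟩ ⟨l, hl⟩
    have h3 := distTable_eq (I := I) ⟨i, hi⟩ ⟨l, hl⟩
    simp only [Instance.data] at h1 h2 h3 ⊢
    rw [h1, h2, h3]
    exact_mod_cast h
  one_le_k := I.one_le_k
  k_le_n := I.k_le_n

theorem data_initial (ε : ℝ) : Initial I.data ε (I.input ε) where
  env := ⟨rfl, rfl, rfl, rfl⟩
  nat_zero a ha i := by
    obtain ⟨a, rfl⟩ : ∃ b, a = b + 3 := ⟨a - 3, by omega⟩
    rfl
  real_zero := rfl
  eps := rfl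

theorem data_col (p : Fin I.n) : I.data.col p = I.color p := by simp [Instance.data]

theorem data_col_lt (p : ℕ) (hp : p < I.data.n) : I.data.col p < I.ω := by
  have := data_col (I := I) ⟨p, hp⟩
  simp only at this
  rw [this]
  exact (I.color _).2

theorem sum_data_bnd : ∑ c ∈ Finset.range I.ω, I.data.bnd c = I.m := by
  rw [Instance.m, Finset.sum_range]
  simp [Instance.data]

theorem d_le_radius (S : Solution I.n) (p : Fin I.n) : I.d p (S.assign p) ≤ I.radius S (S.assign p) :=
  Finset.le_sup (f := fun q => I.d q (S.assign p)) (by simp)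

/-- A feasible solution, indexed by natural numbers. -/
def clustering {S : Solution I.n} (hS : I.IsFeasible S) : I.data.Clustering where
  C := S.centers.map Fin.valEmbedding
  out := S.outliers.map Fin.valEmbedding
  asg q := if h : q < I.n then S.assign ⟨q, h⟩ else 0
  ρ c := if h : c < I.n then I.radius S ⟨c, h⟩ else 0
  card_le := by rw [Finset.card_map, hS.card_centers]; exact le_rfl
  lt_n c hc := by
    obtain ⟨c, -, rfl⟩ := Finset.mem_map.1 hc
    exact c.2
  out_le c := by
    by_cases hc : c < I.ω
    · refine le_trans ?_ ((hS.card_outliers ⟨c, hc⟩).trans_eq (by simp [Instance.data, hc]))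
      rw [Finset.filter_map, Finset.card_map]
      refine Finset.card_le_card fun p hp => ?_
      simp only [Finset.mem_filter, Function.comp, Fin.valEmbedding_apply, data_col] at hp ⊢
      exact ⟨hp.1, Fin.ext hp.2⟩
    · rw [Finset.filter_false_of_mem]
      · simp
      · rintro q hq rfl
        obtain ⟨q, -, rfl⟩ := Finset.mem_map.1 hq
        exact hc (data_col_lt _ q.2)
  asg_mem q hq hqo := by
    have hq : q < I.n := hq
    rw [dif_pos hq]
    refine Finset.mem_map_of_mem Fin.valEmbedding (hS.assign_center _ fun h => hqo ?_)
    exact Finset.mem_map_of_mem Fin.valEmbedding h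
  dist_le q hq hqo := by
    have hq : q < I.n := hq
    have h := d_le_radius S ⟨q, hq⟩
    rw [dif_pos hq, dif_pos (S.assign ⟨q, hq⟩).2]
    exact (distTable_eq ⟨q, hq⟩ (S.assign ⟨q, hq⟩)).trans_le (by exact_mod_cast h)
  ρ_nonneg c _ := by split_ifs <;> simp

theorem clustering_cost {S : Solution I.n} (hS : I.IsFeasible S) :
    (clustering hS).cost = I.cost S := by
  simp [Data.Clustering.cost, clustering, Instance.cost]

/-- The solution in the output arrays. -/
def output {s : State} (h : Solved I.data s) : Solution I.n where
  centers := Finset.univ.filter fun p => s.nat 3 p = 1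
  outliers := Finset.univ.filter fun p => s.nat 4 p = 1
  assign p := ⟨s.nat 5 p, by
    by_cases h4 : s.nat 4 p = 1
    · rw [h.asg_out p p.2 h4]; exact p.2
    · exact (h.asg_mem p p.2 h4).1⟩

theorem card_filter_fin (P : ℕ → Prop) [DecidablePred P] (n : ℕ) :
    ((Finset.univ : Finset (Fin n)).filter (fun p : Fin n => P p)).card =
      ((Finset.range n).filter P).card := by
  rw [← Finset.card_map Fin.valEmbedding]
  congr 1
  ext q
  simp only [Finset.mem_map, Finset.mem_filter, Finset.mem_univ, true_and, Fin.valEmbedding_apply,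
    Finset.mem_range]
  constructor
  · rintro ⟨p, hp, rfl⟩
    exact ⟨p.2, hp⟩
  · rintro ⟨hq, hP⟩
    exact ⟨⟨q, hq⟩, hP, rfl⟩

theorem output_feasible {s : State} (h : Solved I.data s)
    (hk : ((Finset.range I.data.n).filter (fun q => s.nat 3 q = 1)).card = I.data.k) :
    I.IsFeasible (output h) where
  card_centers := (card_filter_fin (fun q => s.nat 3 q = 1) I.n).trans hk
  card_outliers i := by
    have h1 := h.out_le i
    have h2 : I.data.bnd i = I.outlierBound i := by simp [Instance.data]
    rw [h2] at h1
    refine le_trans (le_of_eq ?_) h1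
    refine (congrArg Finset.card (Finset.ext fun p => ?_)).trans
      (card_filter_fin (fun q => s.nat 4 q = 1 ∧ I.data.col q = i) I.n)
    simp only [output, Finset.mem_filter, Finset.mem_univ, true_and]
    rw [data_col, Fin.val_inj]
  assign_outlier p hp := Fin.ext (h.asg_out p p.2 (by simpa [output] using hp))
  assign_center p hp := by
    have h1 : s.nat 4 p ≠ 1 := by simpa [output] using hp
    simpa [output] using (h.asg_mem p p.2 h1).2

/-- The bounds `ρ` are summed over all points, so the padded centers cost nothing extra. An outlier
that happens to be a center is assigned to itself at distance `0`. -/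
theorem output_cost_le {s : State} (h : Solved I.data s) : I.cost (output h) ≤ s.real 2 0 := by
  obtain ⟨ρ, h0, h1, h2⟩ := h.radius
  refine le_trans ?_ h2
  have h3 : ∀ c : Fin I.n, (I.radius (output h) c : ℝ) ≤ ρ c := by
    intro c
    have h4 : I.radius (output h) c ≤ ⟨ρ c, h0 c⟩ := by
      refine Finset.sup_le fun p hp => ?_
      obtain rfl : (output h).assign p = c := by simpa using hp
      change (I.d p ((output h).assign p) : ℝ) ≤ ρ (s.nat 5 p)
      by_cases hp4 : s.nat 4 p = 1
      · have h5 : (output h).assign p = p := Fin.ext (h.asg_out p p.2 hp4)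
        rw [h5, ← distTable_eq]
        exact (data_good.self p).trans_le (h0 _)
      · rw [← distTable_eq]
        exact (data_good.symm _ _).trans_le (h1 p p.2 hp4)
    exact_mod_cast h4
  calc I.cost (output h) ≤ ∑ c : Fin I.n, (I.radius (output h) c : ℝ) :=
        Finset.sum_le_univ_sum_of_nonneg fun c => NNReal.coe_nonneg _
    _ ≤ ∑ c : Fin I.n, ρ c := Finset.sum_le_sum fun c _ => h3 c
    _ = ∑ c ∈ Finset.range I.data.n, ρ c := Fin.sum_univ_eq_sum_range ρ I.n

theorem exists_guesses {k : ℕ} {ε : ℝ} (hε : 0 < ε) : ∃ N : ℕ, 4 * (k : ℝ) * (2 / 7) ^ N ≤ ε ∧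
    ∀ j < N, ε < 4 * (k : ℝ) * (2 / 7) ^ j := by
  classical
  have h : ∃ N : ℕ, 4 * (k : ℝ) * (2 / 7) ^ N ≤ ε := by
    obtain ⟨N, hN⟩ := exists_pow_lt_of_lt_one (x := ε / (4 * k + 1)) (y := (2 / 7 : ℝ))
      (by positivity) (by norm_num)
    rw [lt_div_iff₀ (by positivity)] at hN
    have : (0 : ℝ) < (2 / 7) ^ N := by positivity
    exact ⟨N, by nlinarith⟩
  exact ⟨Nat.find h, Nat.find_spec h, fun j hj => not_le.1 (Nat.find_min h hj)⟩

end ColorfulRadii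
end

/-! ### Assembly of correctness and running time. -/

theorem mainTheorem3 :
    ∃ (A : RealRAM.Program) (c : ℝ), ∀ (I : ColorfulRadii.Instance) (ε : ℝ), 0 < ε →
      ∃ (t : ℕ) (s : RealRAM.State) (S : ColorfulRadii.Solution I.n),
        RealRAM.Run I.distTable A (I.input ε) t s ∧
        ColorfulRadii.IsOutput s S ∧
        I.IsApprox (7 + ε) S ∧
        (t : ℝ) ≤ c * ((I.n : ℝ) ^ (I.ω ^ 2) *
          (((I.k : ℝ) + (I.m : ℝ)) *
            Real.log (max 2 (max (I.k : ℝ) ((I.k : ℝ) / ε)))) ^ I.k) := by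
  open ColorfulRadii in
  obtain ⟨c, hc, hguess⟩ := exists_const_guesses
  refine ⟨mainP, 22000 * c, fun I ε hε => ?_⟩
  obtain ⟨N, hN, hN'⟩ := exists_guesses (k := I.k) hε
  obtain ⟨t, s, hrun, ht, hs, hopt, hcard⟩ :=
    mainP_spec data_good hε (data_initial (I := I) ε) data_col_lt hN hN'
  refine ⟨t, s, output hs, hrun, fun p => ⟨?_, ?_, rfl⟩, ⟨output_feasible hs hcard,
    fun S' hS' => ?_⟩, ?_⟩
  · simp [output]
  · simp [output]
  · rw [← clustering_cost hS']
    exact (output_cost_le hs).trans (hopt _)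
  · have hn : 1 ≤ I.n := I.one_le_k.trans I.k_le_n
    rw [sum_data_bnd] at ht
    have h1 : t ≤ 22000 * (I.n * (I.k + I.m) ^ I.k * (I.k ^ 2 * (N + 1) ^ I.k)) :=
      ht.trans (totalTime_le hn I.one_le_k (by omega))
    have h2 : (t : ℝ) ≤ 22000 * (I.n * (I.k + I.m) ^ I.k *
        ((I.k : ℝ) ^ 2 * ((N + 1 : ℕ) : ℝ) ^ I.k)) := by exact_mod_cast h1
    have h3 := hguess I.k N ε I.one_le_k hε hN'
    -- There is a point, hence a class, so the linear factor `n` of the algorithm is at most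
    -- `n^(ω²)`.
    have hω : I.ω ^ 2 ≠ 0 := by
      have := (Nat.zero_le _).trans_lt (I.color ⟨0, hn⟩).2
      positivity
    have h4 : (I.n : ℝ) ≤ (I.n : ℝ) ^ (I.ω ^ 2) :=
      le_self_pow₀ (by exact_mod_cast hn) hω
    set L := Real.log (max 2 (max (I.k : ℝ) ((I.k : ℝ) / ε)))
    have hL : 0 ≤ L := Real.log_nonneg (le_max_of_le_left (by norm_num))
    calc (t : ℝ) ≤ 22000 * (I.n * (I.k + I.m) ^ I.k *
          ((I.k : ℝ) ^ 2 * ((N + 1 : ℕ) : ℝ) ^ I.k)) := h2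
      _ ≤ 22000 * ((I.n : ℝ) ^ (I.ω ^ 2) * (I.k + I.m) ^ I.k * (c * L ^ I.k)) := by gcongr
      _ = _ := by rw [mul_pow]; ring
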